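/- Let $d\in\{2,3\}$ and let $D\subset\mathbb{R}^d$ be a bounded Lipschitz domain with outer unit normal $\nu$, whose boundary is the disjoint union of measurable sets $\partial D_D,\partial D_N,\partial D_C,\partial D_0$, where $\partial D_D$ has positive surface measure. Let $\tau$ be a measurable unit tangent field on $\partial D_C$ and write $v_\nu=v\cdot\nu$, $v_\tau=v\cdot\tau$. Put $$V_D=\{v\in H^1(D;\mathbb{R}^d): v|_{\partial D_D}=0,\ v_\nu|_{\partial D_C}=0\},\qquad \varepsilon(v)=\tfrac12(\nabla v+\nabla v^T).$$ Let $\mathbb{C}=(C_{ijkl})$ with $C_{ijkl}\in L^\infty(D)$, $C_{ijkl}=C_{jikl}=C_{klij}$ and $\mathbb{C}A:A\ge m_{\mathbb{C}}|A|^2$ for symmetric matrices $A$, a.e. in $D$, where $m_{\mathbb C}>0$; let $f\in L^2(D)^d$ and $g_N\in L^2(\partial D_N)^d$. Let $0\le b<a$, $\alpha\ge0$, $\mu(t)=(a-b)e^{-\alpha t}+b$, let $\epsilon>0$, and let $\theta(s)=|s|$ for $|s|>\epsilon$, $\theta(s)=-\frac{s^4}{8\epsilon^3}+\frac{3s^2}{4\epsilon}+\frac{3\epsilon}{8}$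 for $|s|\le\epsilon$. Let $j(s)=\int_0^{\theta(s)}\mu(t)\,dt$ be the regularized friction potential, and let $\alpha_j\ge0$ be such that $j'(z_1)(z_2-z_1)+j'(z_2)(z_1-z_2)\le\alpha_j|z_1-z_2|^2$ for all $z_1,z_2\in\mathbb{R}$. Let $0<k_{\min}<1$, let $q\ge1$ be an integer, $k(t)=\max(t^q,k_{\min})$, and let $\mathcal F^*(\varphi)=k(\varphi)\mathbb{C}$ for $\varphi\in L^\infty(D)$ (so $\mathcal F^*=\mathbb{C}$ where $\varphi=1$ and $\mathcal F^*=k_{\min}\mathbb{C}$ where $\varphi=0$). Assume the smallness condition $\alpha_j<\lambda_1k_{\min}m_{\mathbb{C}}$, where $\lambda_1=\inf\{\|\varepsilon(v)\|_{L^2(D)}^2/\|v_\tau\|_{L^2(\partial D_C)}^2: v\in V_D,\ v_\tau\ne0\}$. For $\varphi\in L^\infty(D)$ let the state $u(\varphi)\in V_D$ be the solution of $$\int_D\mathcal F^*(\varphi)\varepsilon(u):\varepsilon(v)+\int_{\partial D_C}j'(u_\tau)v_\tau=\int_Df\cdot v+\int_{\partial D_N}g_N\cdot v\qquad\forall v\in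 V_D.$$ Let $m,r:\mathbb{R}^d\to\mathbb{R}$ be differentiable with Lipschitz continuous derivatives $m',r'$, and let $$\mathcal J(\varphi)=\int_Dm(u(\varphi))+\int_{\partial D}r(u(\varphi)).$$ Let $\phi\in L^\infty(D)$ (for instance a phase field, $0\le\phi\le1$) be such that $\phi^q\ne k_{\min}$ a.e. in $D$, so that $\mathcal F^*$ is differentiable at $\phi(x)$ for a.e. $x$. Let $u=u(\phi)$, and let the adjoint state $p\in V_D$ satisfy $$\int_D\mathcal F^*(\phi)\varepsilon(p):\varepsilon(v)+\int_{\partial D_C}j''(u_\tau)p_\tau v_\tau=-\int_Dm'(u)\cdot v-\int_{\partial D_N\cup\partial D_0}r'(u)\cdot v-\int_{\partial D_C}r'(u)\cdot(v-v_\nu\nu)\qquad\forall v\in V_D$$ (for $d=2$ the last integrand is $(r'(u)\cdot\tau)v_\tau$). Then $\mathcal F^{*\prime}(\phi)\varepsilon(u):\varepsilon(p)\in L^1(D)$, the functional $\mathcal J:L^\infty(D)\to\mathbb{R}$ is Fréchet differentiable at $\phi$, and $\mathcal J'(\phi)=\mathcal F^{*\prime}(\phi)\varepsilon(u):\varepsilon(p)$,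 that is, $$\langle\mathcal J'(\phi),\vartheta\rangle=\int_D\big(\mathcal F^{*\prime}(\phi)\varepsilon(u):\varepsilon(p)\big)\,\vartheta\,dx\qquad\forall\vartheta\in L^\infty(D).$$ -/

import Mathlib

open MeasureTheory Filter Topology Set
open scoped ENNReal NNReal ContDiff InnerProductSpace

noncomputable section

namespace PhaseField

/-- The space `ℝ^d` with its Euclidean norm. -/
abbrev E (d : ℕ) := EuclideanSpace ℝ (Fin d)

/-- Fourth-order tensors `(C_ijkl)`. -/
abbrev Tensor4 (d : ℕ) := Fin d → Fin d → Fin d → Fin d → ℝ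

/-! ### Lipschitz domains, surface measure, outer normal -/

/-- Bounded Lipschitz domain: open, connected, bounded, and near each boundary point the set of
points strictly below the graph of a Lipschitz function, in some direction `e` ("up"). -/
structure IsLipschitzDomain {d : ℕ} (D : Set (E d)) : Prop where
  isOpen : IsOpen D
  isConnected : IsConnected D
  isBounded : Bornology.IsBounded D
  lipschitz_boundary : ∀ x ∈ frontier D, ∃ (e : E d) (ρ : ℝ) (K : ℝ≥0) (γ : E d → ℝ),
    ‖e‖ = 1 ∧ 0 < ρ ∧ LipschitzWith K γ ∧
      ∀ y ∈ Metric.ball x ρ, y ∈ D ↔ ⟪y, e⟫_ℝ < γ (y - ⟪y, e⟫_ℝ • e)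

/-- Surface measure on `∂D`: the `(d-1)`-dimensional Hausdorff measure, with Euclidean
normalization. -/
def surface {d : ℕ} (D : Set (E d)) : Measure (E d) :=
  (Measure.euclideanHausdorffMeasure (d - 1)).restrict (frontier D)

/-- `n` is the outer unit normal of `D` at `x`: every open cone around `-n` with vertex `x` is
inside `D` near `x`, and every open cone around `n` is outside `D` near `x`. Such an `n` is unique;
for a Lipschitz domain it exists at almost every boundary point. -/
def IsOuterNormalAt {d : ℕ} (D : Set (E d)) (x n : E d) : Prop :=
  ‖n‖ = 1 ∧ ∀ δ > 0, ∃ ρ > 0, ∀ y ∈ Metric.ball x ρ,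
    (⟪y - x, n⟫_ℝ < -(δ * ‖y - x‖) → y ∈ D) ∧ (δ * ‖y - x‖ < ⟪y - x, n⟫_ℝ → y ∉ D)

open Classical in
/-- The outer unit normal `ν` (zero where there is none). -/
def outerNormal {d : ℕ} (D : Set (E d)) (x : E d) : E d :=
  if h : ∃ n, IsOuterNormalAt D x n then h.choose else 0

/-- The tangential part `w - (w·n) n` of a vector `w` with respect to a unit normal `n`. -/
def tangentialPart {d : ℕ} (n w : E d) : E d := w - ⟪w, n⟫_ℝ • n

theorem plane_identity (n₀ n₁ t₀ t₁ w₀ w₁ : ℝ) (h1 : n₀ ^ 2 + n₁ ^ 2 = 1)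
    (h2 : t₀ ^ 2 + t₁ ^ 2 = 1) (h3 : t₀ * n₀ + t₁ * n₁ = 0) :
    w₀ - (w₀ * n₀ + w₁ * n₁) * n₀ = (w₀ * t₀ + w₁ * t₁) * t₀ := by
  have h4 : t₀ ^ 2 = n₁ ^ 2 := by
    linear_combination -t₀ ^ 2 * h1 + n₁ ^ 2 * h2 + (t₀ * n₀ - t₁ * n₁) * h3
  have h6 : t₀ * t₁ = -(n₀ * n₁) := by
    linear_combination -(t₀ * t₁) * h1 - n₀ * n₁ * h2 + (t₁ * n₀ + t₀ * n₁) * h3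
  linear_combination -w₀ * h1 - w₀ * h4 - w₁ * h6

/-- In the plane the tangential part is `(w·t) t`, for a unit vector `t` orthogonal to `n`. -/
theorem tangentialPart_eq_of_two (n t w : E 2) (hn : ‖n‖ = 1) (ht : ‖t‖ = 1)
    (hnt : ⟪t, n⟫_ℝ = 0) : tangentialPart n w = ⟪w, t⟫_ℝ • t := by
  have h1 := EuclideanSpace.real_norm_sq_eq n
  have h2 := EuclideanSpace.real_norm_sq_eq t
  rw [hn, Fin.sum_univ_two] at h1
  rw [ht, Fin.sum_univ_two] at h2
  rw [PiLp.inner_apply, Fin.sum_univ_two] at hnt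
  simp only [RCLike.inner_apply, conj_trivial] at hnt
  ext i
  fin_cases i <;>
    simp only [tangentialPart, PiLp.inner_apply, Fin.sum_univ_two, RCLike.inner_apply,
      conj_trivial, PiLp.sub_apply, PiLp.smul_apply, smul_eq_mul, Fin.zero_eta, Fin.mk_one]
  · linear_combination plane_identity (n 0) (n 1) (t 0) (t 1) (w 0) (w 1) (by linarith)
      (by linarith) (by linarith)
  · linear_combination plane_identity (n 1) (n 0) (t 1) (t 0) (w 1) (w 0) (by linarith)
      (by linarith) (by linarith)

/-! ### `H^1(D; ℝ^d)` with traces -/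

/-- `G` is the weak Jacobian of `v` on `D`: `G_ij = ∂_j v_i` against test functions. -/
def IsWeakJacobian {d : ℕ} (D : Set (E d)) (v : E d → E d)
    (G : E d → Matrix (Fin d) (Fin d) ℝ) : Prop :=
  ∀ ψ : E d → ℝ, ContDiff ℝ ∞ ψ → HasCompactSupport ψ → tsupport ψ ⊆ D → ∀ i j : Fin d,
    ∫ x in D, v x i * fderiv ℝ ψ x (EuclideanSpace.single j 1) = -∫ x in D, G x i j * ψ x

/-- `g` is the trace on `∂D` of the function `v` with weak Jacobian `G`: the pair `(v, g)` is the
limit in `H^1(D) × L^2(∂D)` of the pairs `(w|_D, w|_∂D)`, `w` smooth on `ℝ^d`. -/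
def IsTrace {d : ℕ} (D : Set (E d)) (v : E d → E d) (G : E d → Matrix (Fin d) (Fin d) ℝ)
    (g : E d → E d) : Prop :=
  ∃ w : ℕ → E d → E d, (∀ n, ContDiff ℝ ∞ (w n)) ∧
    Tendsto (fun n => eLpNorm (fun x => w n x - v x) 2 (volume.restrict D)) atTop (𝓝 0) ∧
    (∀ i j : Fin d, Tendsto (fun n => eLpNorm
      (fun x => fderiv ℝ (w n) x (EuclideanSpace.single j 1) i - G x i j) 2 (volume.restrict D))
      atTop (𝓝 0)) ∧
    Tendsto (fun n => eLpNorm (fun x => w n x - g x) 2 (surface D)) atTop (𝓝 0)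

/-- An element of `H^1(D; ℝ^d)`, with representatives of its weak Jacobian and of its trace. -/
structure H1 {d : ℕ} (D : Set (E d)) where
  val : E d → E d
  jac : E d → Matrix (Fin d) (Fin d) ℝ
  trace : E d → E d
  memLp_val : MemLp val 2 (volume.restrict D)
  memLp_jac : ∀ i j, MemLp (fun x => jac x i j) 2 (volume.restrict D)
  memLp_trace : MemLp trace 2 (surface D)
  isWeakJacobian : IsWeakJacobian D val jac
  isTrace : IsTrace D val jac trace

/-- The strain `ε(v) = (Dv + Dvᵀ) / 2`. -/
def H1.strain {d : ℕ} {D : Set (E d)} (v : H1 D) (x : E d) : Matrix (Fin d) (Fin d) ℝ :=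
  (2⁻¹ : ℝ) • (v.jac x + (v.jac x).transpose)

/-- The product `A : B` of second-order tensors. -/
def ddot {d : ℕ} (A B : Matrix (Fin d) (Fin d) ℝ) : ℝ := ∑ i, ∑ j, A i j * B i j

/-- The tensor `C A`, with entries `∑_kl C_ijkl A_kl`. -/
def Tensor4.app {d : ℕ} (C : Tensor4 d) (A : Matrix (Fin d) (Fin d) ℝ) :
    Matrix (Fin d) (Fin d) ℝ :=
  Matrix.of fun i j => ∑ k, ∑ l, C i j k l * A k l

/-! ### Regularized friction potential -/

/-- The friction bound `μ(t) = (a - b) e^{-αt} + b`. -/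
def frictionBound (a b α t : ℝ) : ℝ := (a - b) * Real.exp (-α * t) + b

/-- The smoothing `θ(s, ε)` of `|s|`. -/
def smoothAbs (ε s : ℝ) : ℝ :=
  if ε < |s| then |s| else -(1 / (8 * ε ^ 3)) * |s| ^ 4 + 3 / (4 * ε) * |s| ^ 2 + 3 * ε / 8

/-- The regularized potential `j_{τ,ε}(s) = ∫_0^{θ(s,ε)} μ(t) dt`. -/
def potential (a b α ε s : ℝ) : ℝ := ∫ t in (0 : ℝ)..(smoothAbs ε s), frictionBound a b α t

/-! ### Interpolated stiffness -/

/-- The interpolation function `k(t) = max(t^q, k_min)`. -/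
def interp (kmin : ℝ) (q : ℕ) (t : ℝ) : ℝ := max (t ^ q) kmin

/-- Full material for `φ = 1`. -/
theorem interp_one {kmin : ℝ} (q : ℕ) (h : kmin ≤ 1) : interp kmin q 1 = 1 := by
  simp [interp, h]

/-- Weak material for `φ = 0`. -/
theorem interp_zero {kmin : ℝ} {q : ℕ} (h : 0 ≤ kmin) (hq : 0 < q) :
    interp kmin q 0 = kmin := by
  simp [interp, h, hq.ne']

/-! ### The design problem -/

/-- Data of the phase-field design problem. -/
structure Problem (d : ℕ) where
  /-- working domain -/
  D : Set (E d)
  /-- Dirichlet part of `∂D` -/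
  bdD : Set (E d)
  /-- part of `∂D` that carries the surface load -/
  bdN : Set (E d)
  /-- contact part of `∂D` -/
  bdC : Set (E d)
  /-- traction-free part of `∂D` -/
  bd0 : Set (E d)
  /-- unit tangent field on the contact part -/
  τ : E d → E d
  /-- elasticity tensor of the full material -/
  C : E d → Tensor4 d
  /-- stability constant of `C` -/
  mC : ℝ
  /-- parameters of the friction bound -/
  a : ℝ
  b : ℝ
  α : ℝ
  /-- regularization parameter -/
  ε : ℝ
  /-- constant in the relaxed monotonicity of the regularized potential -/
  αj : ℝ
  /-- stiffness of the weak material, relative to the full one -/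
  kmin : ℝ
  /-- exponent of the interpolation -/
  q : ℕ
  /-- body force -/
  f : E d → E d
  /-- surface load -/
  gN : E d → E d
  /-- integrand of the objective on `D` -/
  m : E d → ℝ
  /-- integrand of the objective on `∂D` -/
  r : E d → ℝ

namespace Problem

variable {d : ℕ} (P : Problem d)

/-- The interpolated stiffness `F*(t) = k(t) C` at the point `x`. -/
def Fstar (x : E d) (t : ℝ) : Tensor4 d := interp P.kmin P.q t • P.C x

/-- Phase fields and their variations: `L^∞(D)`. -/
abbrev Phase := Lp ℝ ∞ (volume.restrict P.D)

/-- `V_D = {v ∈ H^1(D; ℝ^d) : v = 0 on ∂D_D, v·ν = 0 on ∂D_C}`. -/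
def VD : Set (H1 P.D) :=
  {v | (∀ᵐ x ∂(surface P.D).restrict P.bdD, v.trace x = 0) ∧
    ∀ᵐ x ∂(surface P.D).restrict P.bdC, ⟪v.trace x, outerNormal P.D x⟫_ℝ = 0}

/-- The tangential component `v_τ = v·τ`. -/
def tang (v : H1 P.D) (x : E d) : ℝ := ⟪v.trace x, P.τ x⟫_ℝ

/-- `j_{τ,ε}` with the parameters of the problem. -/
def j : ℝ → ℝ := potential P.a P.b P.α P.ε

/-- The smallest eigenvalue `λ_1` of `(ε(u), ε(v))_D = λ (u_τ, v_τ)_{∂D_C}` on `V_D`, as the minimum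
of the Rayleigh quotient; it is the best constant in `λ ‖v_τ‖² ≤ ‖ε(v)‖²`
(and `∞` if `v_τ` vanishes for all `v`). -/
def eigenvalue : ℝ≥0∞ :=
  ⨅ (v : H1 P.D) (_ : v ∈ P.VD) (_ : 0 < ∫ x in P.bdC, P.tang v x ^ 2 ∂surface P.D),
    ENNReal.ofReal ((∫ x in P.D, ddot (v.strain x) (v.strain x)) /
      ∫ x in P.bdC, P.tang v x ^ 2 ∂surface P.D)

/-- Standing assumptions on the data. -/
structure Admissible : Prop where
  lipschitz : IsLipschitzDomain P.D
  -- the boundary is partitioned into four parts, and the Dirichlet part is not negligible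
  measurable_bdD : MeasurableSet P.bdD
  measurable_bdN : MeasurableSet P.bdN
  measurable_bdC : MeasurableSet P.bdC
  measurable_bd0 : MeasurableSet P.bd0
  boundary : P.bdD ∪ P.bdN ∪ P.bdC ∪ P.bd0 = frontier P.D
  disjoint_DN : Disjoint P.bdD P.bdN
  disjoint_DC : Disjoint P.bdD P.bdC
  disjoint_D0 : Disjoint P.bdD P.bd0
  disjoint_NC : Disjoint P.bdN P.bdC
  disjoint_N0 : Disjoint P.bdN P.bd0
  disjoint_C0 : Disjoint P.bdC P.bd0
  bdD_pos : 0 < surface P.D P.bdD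
  -- `τ` is a unit tangent field on the contact boundary
  measurable_τ : AEStronglyMeasurable P.τ ((surface P.D).restrict P.bdC)
  tangent : ∀ᵐ x ∂(surface P.D).restrict P.bdC, ‖P.τ x‖ = 1 ∧ ⟪P.τ x, outerNormal P.D x⟫_ℝ = 0
  -- `C` is symmetric, bounded and pointwise stable
  C_symm : ∀ᵐ x ∂volume.restrict P.D, ∀ i j k l,
    P.C x i j k l = P.C x j i k l ∧ P.C x i j k l = P.C x k l i j
  C_bdd : ∀ i j k l, MemLp (fun x => P.C x i j k l) ∞ (volume.restrict P.D)
  mC_pos : 0 < P.mC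
  C_stable : ∀ᵐ x ∂volume.restrict P.D, ∀ A : Matrix (Fin d) (Fin d) ℝ, A.IsSymm →
    P.mC * ddot A A ≤ ddot ((P.C x).app A) A
  -- loads
  f_mem : MemLp P.f 2 (volume.restrict P.D)
  gN_mem : MemLp P.gN 2 ((surface P.D).restrict P.bdN)
  -- parameters
  b_nonneg : 0 ≤ P.b
  b_lt_a : P.b < P.a
  α_nonneg : 0 ≤ P.α
  ε_pos : 0 < P.ε
  kmin_pos : 0 < P.kmin
  kmin_lt_one : P.kmin < 1
  q_pos : 0 < P.q
  -- relaxed monotonicity of `j_{τ,ε}`, and the smallness condition; `kmin * mC` is the stability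
  -- constant of the interpolated stiffness
  αj_nonneg : 0 ≤ P.αj
  relaxed_monotone : ∀ z₁ z₂ : ℝ,
    deriv P.j z₁ * (z₂ - z₁) + deriv P.j z₂ * (z₁ - z₂) ≤ P.αj * |z₁ - z₂| ^ 2
  small : ENNReal.ofReal P.αj < P.eigenvalue * ENNReal.ofReal (P.kmin * P.mC)
  -- the objective has continuously differentiable integrands with Lipschitz derivatives
  m_diff : Differentiable ℝ P.m
  m_lip : ∃ K : ℝ≥0, LipschitzWith K (fderiv ℝ P.m)
  r_diff : Differentiable ℝ P.r
  r_lip : ∃ K : ℝ≥0, LipschitzWith K (fderiv ℝ P.r)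

/-- `u` is the state for the phase field `φ`: the weak solution of the regularized problem. -/
def IsState (φ : P.Phase) (u : H1 P.D) : Prop :=
  u ∈ P.VD ∧ ∀ v ∈ P.VD,
    (∫ x in P.D, ddot ((P.Fstar x (φ x)).app (u.strain x)) (v.strain x)) +
        ∫ x in P.bdC, deriv P.j (P.tang u x) * P.tang v x ∂surface P.D =
      (∫ x in P.D, ⟪P.f x, v.val x⟫_ℝ) + ∫ x in P.bdN, ⟪P.gN x, v.trace x⟫_ℝ ∂surface P.D

/-- `p` is the adjoint state for the phase field `φ` and the state `u`. In the last integral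
`r'(u)` is applied to the tangential part of `v`; in the plane this is `(r'(u)·τ) v_τ`, by
`tangentialPart_eq_of_two`. -/
def IsAdjoint (φ : P.Phase) (u p : H1 P.D) : Prop :=
  p ∈ P.VD ∧ ∀ v ∈ P.VD,
    (∫ x in P.D, ddot ((P.Fstar x (φ x)).app (p.strain x)) (v.strain x)) +
        ∫ x in P.bdC, deriv (deriv P.j) (P.tang u x) * P.tang p x * P.tang v x ∂surface P.D =
      -(∫ x in P.D, fderiv ℝ P.m (u.val x) (v.val x)) -
        (∫ x in P.bdN ∪ P.bd0, fderiv ℝ P.r (u.trace x) (v.trace x) ∂surface P.D) -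
        ∫ x in P.bdC, fderiv ℝ P.r (u.trace x)
          (tangentialPart (outerNormal P.D x) (v.trace x)) ∂surface P.D

/-- The objective `J(u) = ∫_D m(u) + ∫_∂D r(u)`. -/
def objective (u : H1 P.D) : ℝ :=
  (∫ x in P.D, P.m (u.val x)) + ∫ x, P.r (u.trace x) ∂surface P.D

/-- The sensitivity `F*'(φ) ε(u) : ε(p)`. -/
def sensitivity (φ : P.Phase) (u p : H1 P.D) (x : E d) : ℝ :=
  ddot (Tensor4.app (deriv (P.Fstar x) (φ x)) (u.strain x)) (p.strain x)

end Problem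

end PhaseField

end

open MeasureTheory Filter Topology Set
open scoped ENNReal NNReal ContDiff InnerProductSpace

noncomputable section

namespace PhaseField

/-! ### Projection of hypersurfaces along a transversal direction -/

section Shadow

variable {d : ℕ}

/-! This is the adjoint method, with every remainder estimated by hand. Let `w` be the difference of
the states at `ψ` and `φ`, and `δ = ‖ψ - φ‖`. The smallness condition together with relaxed
monotonicity makes the difference equation coercive, so the energy of `w` is `O(δ ^ 2)`
(`exists_energy_sub_le`). Testing the difference of the state equations with `p`, and the adjoint
equation with `w`, eliminates all first-order terms containing `w`. What is left of the expansion of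
the objective is four errors (`exists_objective_sub_le`).

The product of the two increments is `O(δ ^ 2)`. So are the Taylor errors of `m` and `r`, once the
energy of `w` controls its `L^2` norms in `D` and on the boundary. The other two are only `o(δ)`.
The interpolation `k` has a kink where `φ ^ q = kmin`. Off the set `|φ ^ q - kmin| ≤ M δ` its
remainder is quadratic; on that set it is linear in `δ`, but the set shrinks to a null set and the
factor `C ε(u) : ε(p)` is integrable (`exists_interp_remainder_le`). For the friction law, a
quadratic remainder in `w_τ` times `p_τ` is not controlled by `L^2` norms alone. The remainder of
`j'` is however bounded by `M |h| min(|h|, 1)`, and truncating `p_τ` at a high level then suffices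
(`exists_integral_remainder_le`, `exists_friction_remainder_le`).

The analytic core is Korn's inequality with zero values on the Dirichlet part (`exists_korn`),
proved directly, without a compactness argument for sequences of fields. Along a line of direction
`ξ`, the component `⟪w, ξ⟫` has derivative `⟪Dw ξ, ξ⟫`, which involves the strain only, and finitely
many directions from any ball determine a vector. Integrating over families of segments carries
`L^2` control from the Dirichlet part to a ball in `D`, through the connected set `D`, then along
interior cones up to the boundary, and finally onto it. This is done for smooth fields, and the
approximating sequence in `IsTrace` transfers it to `V_D`. -/

/-- Fubini's theorem along the lines of direction `ξ`. -/
theorem lintegral_eq_lintegral_lines {ξ : E d} (hξ : ξ ≠ 0) {g : E d → ℝ≥0∞} (hg : Measurable g) :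
    ∫⁻ x, g x = ‖ξ‖ₑ * ∫⁻ b : (ℝ ∙ ξ)ᗮ, ∫⁻ t : ℝ, g ((b : E d) + t • ξ) := by
  have hmp := (ℝ ∙ ξ).measurePreserving_measurableEquivProd (0 : E d)
  rw [InnerProductSpace.euclideanHausdorffMeasure_eq_volume] at hmp
  have h1 := hmp.symm.lintegral_comp hg
  have hfin : Module.finrank ℝ (ℝ ∙ ξ) = 1 := finrank_span_singleton hξ
  let v : (ℝ ∙ ξ) := ⟨ξ, Submodule.mem_span_singleton_self ξ⟩
  have hv : v ≠ 0 := fun h => hξ (congrArg Subtype.val h)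
  -- Lebesgue measure on the line `ℝ ∙ ξ` is `‖ξ‖` times the image of `dt` under `t ↦ t • ξ`; this
  -- is the factor `‖ξ‖ₑ`.
  have hvol := volume_eq_of_finrank_eq_one hfin hv
  rw [← h1, Measure.volume_eq_prod, lintegral_prod_symm _ (by fun_prop),
    ← lintegral_const_mul _ (by fun_prop)]
  refine lintegral_congr fun b => ?_
  rw [hvol, lintegral_smul_measure, lintegral_map (by fun_prop) (by fun_prop)]
  simp [v, add_comm, Submodule.measurableEquivProd_symm_apply]
  rfl

/-- A set on which the projection along `ξ` is antilipschitz has surface measure dominated by the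
Lebesgue measure of its projection. -/
theorem map_orthogonalProjection_le {ξ : E d} (hξ : ξ ≠ 0) {S : Set (E d)} (hS : MeasurableSet S)
    {L : ℝ≥0} (hL : ∀ y ∈ S, ∀ y' ∈ S, ∀ c : ℝ, ‖y - y'‖ ≤ L * ‖y - y' - c • ξ‖) :
    ((Measure.euclideanHausdorffMeasure (d - 1) : Measure (E d)).restrict S).map
        ((ℝ ∙ ξ)ᗮ.orthogonalProjectionOnto) ≤ (L : ℝ≥0∞) ^ (d - 1) • volume := by
  set π := (ℝ ∙ ξ)ᗮ.orthogonalProjectionOnto with hπ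
  have hfin : Module.finrank ℝ (ℝ ∙ ξ)ᗮ = d - 1 := by
    have h := (ℝ ∙ ξ).finrank_add_finrank_orthogonal
    rw [finrank_span_singleton hξ, finrank_euclideanSpace_fin] at h
    omega
  have hdec (y : E d) : ∃ c : ℝ, y - c • ξ = (π y : E d) := by
    have := (ℝ ∙ ξ).starProjection_add_starProjection_orthogonal y
    obtain ⟨c, hc⟩ := Submodule.mem_span_singleton.1 ((ℝ ∙ ξ).starProjection_apply_mem y)
    refine ⟨c, ?_⟩
    rw [hc]
    nth_rewrite 1 [← this]
    simp [hπ]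
  have hdist : ∀ y ∈ S, ∀ y' ∈ S, dist y y' ≤ L * dist (π y) (π y') := by
    intro y hy y' hy'
    obtain ⟨c, hc⟩ := hdec (y - y')
    have := hL y hy y' hy' c
    rw [dist_eq_norm, dist_eq_norm, ← map_sub]
    rwa [hc] at this
  rw [Measure.le_iff]
  intro A hA
  rw [Measure.map_apply (by fun_prop) hA, Measure.restrict_apply' hS, Measure.smul_apply,
    smul_eq_mul, ← InnerProductSpace.euclideanHausdorffMeasure_eq_volume, hfin]
  rcases S.eq_empty_or_nonempty with rfl | ⟨y₀, hy₀⟩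
  · simp
  have : Nonempty (E d) := ⟨0⟩
  -- The inverse of the projection on `S` is `L`-Lipschitz, so it expands `(d - 1)`-dimensional
  -- Hausdorff measure by at most `L ^ (d - 1)`. Source and target carry the same normalizing
  -- constant, which cancels at the end.
  let f : (ℝ ∙ ξ)ᗮ → E d := Function.invFunOn π S
  have hf1 : ∀ b ∈ π '' S, f b ∈ S ∧ π (f b) = b := fun b hb =>
    ⟨Function.invFunOn_mem hb, Function.invFunOn_eq hb⟩
  have hinj : ∀ y ∈ S, f (π y) = y := by
    intro y hy
    have h := hf1 (π y) ⟨y, hy, rfl⟩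
    have := hdist _ h.1 _ hy
    rw [h.2, dist_self, mul_zero] at this
    exact dist_le_zero.1 this
  have hlip : LipschitzOnWith L f (π '' S ∩ A) := by
    refine LipschitzOnWith.of_dist_le_mul fun b hb b' hb' => ?_
    have h := hf1 b hb.1
    have h' := hf1 b' hb'.1
    have := hdist _ h.1 _ h'.1
    rwa [h.2, h'.2] at this
  have hsub : π ⁻¹' A ∩ S ⊆ f '' (π '' S ∩ A) := fun y hy =>
    ⟨π y, ⟨⟨y, hy.2, rfl⟩, hy.1⟩, hinj y hy.2⟩
  have hH := hlip.hausdorffMeasure_image_le (d := ((d - 1 : ℕ) : ℝ)) (by positivity)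
  rw [ENNReal.rpow_natCast] at hH
  simp only [Measure.euclideanHausdorffMeasure_def, Measure.smul_apply, ENNReal.smul_def,
    smul_eq_mul]
  rw [mul_left_comm]
  gcongr
  exact (measure_mono hsub).trans (hH.trans (by gcongr; exact inter_subset_right))

/-- Integration over a hypersurface and over the lines of a transversal direction `ξ`. -/
theorem lintegral_surface_lines_le {ξ : E d} (hξ : ξ ≠ 0) {S : Set (E d)} (hS : MeasurableSet S)
    {L : ℝ≥0} (hL : ∀ y ∈ S, ∀ y' ∈ S, ∀ c : ℝ, ‖y - y'‖ ≤ L * ‖y - y' - c • ξ‖)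
    {g : E d → ℝ≥0∞} (hg : Measurable g) :
    ‖ξ‖ₑ * ∫⁻ y in S, ∫⁻ t : ℝ, g (y + t • ξ) ∂(volume : Measure ℝ)
        ∂(Measure.euclideanHausdorffMeasure (d - 1) : Measure (E d)) ≤
      (L : ℝ≥0∞) ^ (d - 1) * ∫⁻ x, g x := by
  set π := (ℝ ∙ ξ)ᗮ.orthogonalProjectionOnto with hπ
  have hdec (y : E d) : ∃ c : ℝ, y = (π y : E d) + c • ξ := by
    have := (ℝ ∙ ξ).starProjection_add_starProjection_orthogonal y
    obtain ⟨c, hc⟩ := Submodule.mem_span_singleton.1 ((ℝ ∙ ξ).starProjection_apply_mem y)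
    refine ⟨c, ?_⟩
    rw [hc]
    nth_rewrite 1 [← this]
    simp [hπ, add_comm]
  have hmeas : Measurable fun b : (ℝ ∙ ξ)ᗮ => ∫⁻ t : ℝ, g ((b : E d) + t • ξ) := by
    have : Measurable fun p : (ℝ ∙ ξ)ᗮ × ℝ => g ((p.1 : E d) + p.2 • ξ) := by fun_prop
    exact this.lintegral_prod_right'
  -- By translation invariance in `t` the line integral depends on `y` only through `π y`, so the
  -- surface measure may be pushed forward by `π`.
  have hline (y : E d) : ∫⁻ t : ℝ, g (y + t • ξ) = ∫⁻ t : ℝ, g ((π y : E d) + t • ξ) := by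
    obtain ⟨c, hc⟩ := hdec y
    rw [← lintegral_add_left_eq_self (fun t : ℝ => g ((π y : E d) + t • ξ)) c]
    refine lintegral_congr fun t => ?_
    nth_rewrite 1 [hc]
    rw [add_smul, add_assoc]
  rw [lintegral_congr hline]
  rw [lintegral_eq_lintegral_lines hξ hg, mul_left_comm]
  gcongr
  rw [← lintegral_map (μ := (Measure.euclideanHausdorffMeasure (d - 1) : Measure (E d)).restrict S)
    (f := fun b : (ℝ ∙ ξ)ᗮ => ∫⁻ t : ℝ, g ((b : E d) + t • ξ)) hmeas (by fun_prop : Measurable π)]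
  refine (lintegral_mono' (map_orthogonalProjection_le hξ hS hL) le_rfl).trans ?_
  rw [lintegral_smul_measure, smul_eq_mul]

end Shadow

/-! ### Local geometry of Lipschitz domains -/

section Cone

variable {d : ℕ}

theorem tangentialPart_add (e x y : E d) :
    tangentialPart e (x + y) = tangentialPart e x + tangentialPart e y := by
  simp only [tangentialPart, inner_add_left, add_smul]
  abel

theorem tangentialPart_smul (e : E d) (t : ℝ) (x : E d) :
    tangentialPart e (t • x) = t • tangentialPart e x := by
  simp only [tangentialPart, real_inner_smul_left, mul_smul, smul_sub]

theorem tangentialPart_sub (e x y : E d) :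
    tangentialPart e (x - y) = tangentialPart e x - tangentialPart e y := by
  simp only [tangentialPart, inner_sub_left, sub_smul]
  abel

theorem norm_tangentialPart_le {e : E d} (he : ‖e‖ = 1) (x : E d) :
    ‖tangentialPart e x‖ ≤ ‖x‖ := by
  have h : ‖tangentialPart e x‖ ^ 2 = ‖x‖ ^ 2 - ⟪x, e⟫_ℝ ^ 2 := by
    rw [tangentialPart, @norm_sub_sq_real, real_inner_smul_right, norm_smul, he, mul_one,
      Real.norm_eq_abs, sq_abs]
    ring
  exact pow_le_pow_iff_left₀ (norm_nonneg _) (norm_nonneg _) two_ne_zero |>.1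
    (by rw [h]; nlinarith [sq_nonneg ⟪x, e⟫_ℝ])

theorem norm_le_abs_inner_add {e : E d} (he : ‖e‖ = 1) (x : E d) :
    ‖x‖ ≤ |⟪x, e⟫_ℝ| + ‖tangentialPart e x‖ := by
  have h : x = ⟪x, e⟫_ℝ • e + tangentialPart e x := by simp [tangentialPart]
  calc ‖x‖ = ‖⟪x, e⟫_ℝ • e + tangentialPart e x‖ := by rw [← h]
    _ ≤ _ := (norm_add_le _ _).trans (by rw [norm_smul, he, mul_one, Real.norm_eq_abs])

theorem abs_inner_le_norm_of_unit {e : E d} (he : ‖e‖ = 1) (x : E d) : |⟪x, e⟫_ℝ| ≤ ‖x‖ := by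
  simpa [he] using abs_real_inner_le_norm x e

/-- A vector that is flat with respect to `e` is controlled by its projection along a steep
vector. -/
theorem norm_le_of_flat_of_steep {e : E d} (he : ‖e‖ = 1) {K : ℝ} (hK : 0 ≤ K) {δ ξ : E d}
    (hδ : |⟪δ, e⟫_ℝ| ≤ K * ‖tangentialPart e δ‖)
    (hξ : (K + 1) * ‖tangentialPart e ξ‖ ≤ |⟪ξ, e⟫_ℝ|) (c : ℝ) :
    ‖δ‖ ≤ (1 + 2 * (K + 1) ^ 2) * ‖δ - c • ξ‖ := by
  set η := δ - c • ξ with hη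
  have hδη : δ = η + c • ξ := by simp [hη]
  set a := |c| * |⟪ξ, e⟫_ℝ|
  set b := |c| * ‖tangentialPart e ξ‖
  have h1 : a ≤ |⟪δ, e⟫_ℝ| + ‖η‖ := by
    have : c * ⟪ξ, e⟫_ℝ = ⟪δ, e⟫_ℝ - ⟪η, e⟫_ℝ := by
      rw [hδη, inner_add_left, real_inner_smul_left]; ring
    calc a = |c * ⟪ξ, e⟫_ℝ| := (abs_mul _ _).symm
      _ ≤ |⟪δ, e⟫_ℝ| + |⟪η, e⟫_ℝ| := by rw [this]; exact abs_sub _ _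
      _ ≤ _ := by gcongr; exact abs_inner_le_norm_of_unit he η
  have h2 : ‖tangentialPart e δ‖ ≤ ‖η‖ + b := by
    rw [hδη, tangentialPart_add, tangentialPart_smul]
    refine (norm_add_le _ _).trans ?_
    rw [norm_smul, Real.norm_eq_abs]
    gcongr
    exact norm_tangentialPart_le he η
  have h3 : (K + 1) * b ≤ a := by
    have := mul_le_mul_of_nonneg_left hξ (abs_nonneg c)
    simp only [a, b]; linarith
  have h4 : ‖δ‖ ≤ ‖η‖ + (a + b) := by
    conv_lhs => rw [hδη]
    refine (norm_add_le _ _).trans ?_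
    rw [norm_smul, Real.norm_eq_abs]
    have := mul_le_mul_of_nonneg_left (norm_le_abs_inner_add he ξ) (abs_nonneg c)
    simp only [a, b]; linarith
  have hb : 0 ≤ b := by positivity
  -- Flatness of `δ` bounds the vertical part `a` of `c • ξ` by `K` times its tangential part `b`,
  -- up to `‖η‖`. Steepness says `(K + 1) * b ≤ a`, so `K * b` is absorbed.
  have h5 : a ≤ (K + 1) * ‖η‖ + K * b := by nlinarith
  have h6 : b ≤ (K + 1) * ‖η‖ := by linarith
  have h7 : a + b ≤ 2 * (K + 1) ^ 2 * ‖η‖ := by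
    nlinarith [mul_le_mul_of_nonneg_left h6 hK, norm_nonneg η]
  linarith

/-- Near a boundary point of a Lipschitz domain there is an open cone of directions that lead into
the domain, and the boundary is transversal to all of them. -/
theorem IsLipschitzDomain.exists_cone {D : Set (E d)} (hD : IsLipschitzDomain D) {z : E d}
    (hz : z ∈ frontier D) : ∃ (η : E d) (θ ρ : ℝ) (L : ℝ≥0), 0 < θ ∧ 0 < ρ ∧
      (∀ ξ ∈ Metric.closedBall η θ, ξ ≠ 0) ∧
      (∀ ξ ∈ Metric.closedBall η θ, ∀ x ∈ closure D ∩ Metric.ball z ρ, ∀ t ∈ Ioc (0 : ℝ) 1,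
        x + t • ξ ∈ D) ∧
      ∀ ξ ∈ Metric.closedBall η θ, ∀ y ∈ frontier D ∩ Metric.ball z ρ,
        ∀ y' ∈ frontier D ∩ Metric.ball z ρ, ∀ c : ℝ, ‖y - y'‖ ≤ L * ‖y - y' - c • ξ‖ := by
  obtain ⟨e, ρ, K, γ, he, hρ, hγ, hgraph⟩ := hD.lipschitz_boundary z hz
  change ∀ y ∈ Metric.ball z ρ, y ∈ D ↔ ⟪y, e⟫_ℝ < γ (tangentialPart e y) at hgraph
  have hγc : Continuous fun y => γ (tangentialPart e y) := by
    refine hγ.continuous.comp ?_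
    unfold tangentialPart
    fun_prop
  have hlip (x y : E d) : |γ (tangentialPart e x) - γ (tangentialPart e y)| ≤
      K * ‖tangentialPart e (x - y)‖ := by
    have := hγ.dist_le_mul (tangentialPart e x) (tangentialPart e y)
    rwa [Real.dist_eq, dist_eq_norm, ← tangentialPart_sub] at this
  have hclos : ∀ x ∈ closure D ∩ Metric.ball z ρ, ⟪x, e⟫_ℝ ≤ γ (tangentialPart e x) := by
    rintro x ⟨hx, hxz⟩
    have hx' : x ∈ closure (D ∩ Metric.ball z ρ) :=
      Metric.isOpen_ball.closure_inter ⟨hx, hxz⟩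
    have hcl : IsClosed {x : E d | ⟪x, e⟫_ℝ ≤ γ (tangentialPart e x)} :=
      isClosed_le (by fun_prop) hγc
    exact closure_minimal (fun y hy => ((hgraph y hy.2).1 hy.1).le) hcl hx'
  have hfront : ∀ x ∈ frontier D ∩ Metric.ball z ρ, ⟪x, e⟫_ℝ = γ (tangentialPart e x) := by
    rintro x ⟨hx, hxz⟩
    refine le_antisymm (hclos x ⟨frontier_subset_closure hx, hxz⟩) ?_
    have : x ∉ D := by
      rw [hD.isOpen.frontier_eq] at hx
      exact hx.2
    rw [hgraph x hxz] at this
    exact not_lt.1 this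
  have hK0 : (0 : ℝ) ≤ K := K.2
  -- The cone is the ball of radius `θ` around `-σ • e`. Since `σ - θ = (K + 1) * θ`, its directions
  -- have the steepness required by `norm_le_of_flat_of_steep`. Their lengths are at most `σ + θ ≤ ρ
  -- / 2`, so unit segments from the half ball stay where the graph describes `D`.
  set σ := ρ / 4 with hσ
  have hσ0 : 0 < σ := by positivity
  set θ := σ / (K + 2) with hθ
  have hθ0 : 0 < θ := by positivity
  have hθσ : (K + 2) * θ = σ := by rw [hθ]; field_simp
  have hθle : θ ≤ σ := by nlinarith
  have hξ : ∀ ξ ∈ Metric.closedBall (-σ • e) θ,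
      ⟪ξ, e⟫_ℝ ≤ -(σ - θ) ∧ ‖tangentialPart e ξ‖ ≤ θ ∧ ‖ξ‖ ≤ ρ / 2 := by
    intro ξ hξ
    rw [Metric.mem_closedBall, dist_eq_norm] at hξ
    set ζ := ξ - (-σ • e) with hζ
    have hξζ : ξ = ζ + -σ • e := by simp [hζ]
    have hee : ⟪e, e⟫_ℝ = 1 := by rw [real_inner_self_eq_norm_sq, he, one_pow]
    refine ⟨?_, ?_, ?_⟩
    · rw [hξζ, inner_add_left, real_inner_smul_left, hee]
      have := (abs_le.1 (abs_inner_le_norm_of_unit he ζ)).2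
      linarith
    · rw [hξζ, tangentialPart_add, tangentialPart_smul]
      have : tangentialPart e e = 0 := by simp [tangentialPart, he]
      rw [this, smul_zero, add_zero]
      exact (norm_tangentialPart_le he ζ).trans hξ
    · rw [hξζ]
      refine (norm_add_le _ _).trans ?_
      rw [norm_smul, he, Real.norm_eq_abs, abs_neg, abs_of_pos hσ0]
      linarith
  have hsteep : ∀ ξ ∈ Metric.closedBall (-σ • e) θ,
      (K + 1) * ‖tangentialPart e ξ‖ ≤ -⟪ξ, e⟫_ℝ := by
    intro ξ h
    obtain ⟨h1, h2, -⟩ := hξ ξ h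
    nlinarith
  have hneg : ∀ ξ ∈ Metric.closedBall (-σ • e) θ, ⟪ξ, e⟫_ℝ < 0 := by
    intro ξ h
    obtain ⟨h1, h2, -⟩ := hξ ξ h
    nlinarith
  refine ⟨-σ • e, θ, ρ / 2, 1 + 2 * (K + 1) ^ 2, hθ0, by positivity, ?_, ?_, ?_⟩
  · rintro ξ h rfl
    simpa using hneg 0 h
  · rintro ξ h x ⟨hx, hxz⟩ t ⟨ht0, ht1⟩
    have hxρ : x ∈ Metric.ball z ρ := Metric.ball_subset_ball (by linarith) hxz
    have hyρ : x + t • ξ ∈ Metric.ball z ρ := by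
      rw [Metric.mem_ball, dist_eq_norm] at hxz ⊢
      have h3 : ‖t • ξ‖ ≤ ρ / 2 := by
        rw [norm_smul, Real.norm_eq_abs, abs_of_pos ht0]
        nlinarith [(hξ ξ h).2.2, norm_nonneg ξ]
      calc ‖x + t • ξ - z‖ = ‖(x - z) + t • ξ‖ := by congr 1; abel
        _ ≤ ‖x - z‖ + ‖t • ξ‖ := norm_add_le _ _
        _ < ρ := by linarith
    rw [hgraph _ hyρ, inner_add_left, real_inner_smul_left]
    have h1 := hclos x ⟨hx, hxρ⟩
    have h2 := hlip (x + t • ξ) x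
    rw [add_sub_cancel_left, tangentialPart_smul, norm_smul, Real.norm_eq_abs,
      abs_of_pos ht0] at h2
    have h3 := (abs_le.1 h2).1
    have h4 := hsteep ξ h
    have h5 := hneg ξ h
    have h6 : K * ‖tangentialPart e ξ‖ < -⟪ξ, e⟫_ℝ := by
      rcases (norm_nonneg (tangentialPart e ξ)).eq_or_lt with h0 | h0
      · rw [← h0]; linarith
      · linarith
    nlinarith
  · rintro ξ h y ⟨hy, hyz⟩ y' ⟨hy', hyz'⟩ c
    have hyρ : y ∈ Metric.ball z ρ := Metric.ball_subset_ball (by linarith) hyz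
    have hyρ' : y' ∈ Metric.ball z ρ := Metric.ball_subset_ball (by linarith) hyz'
    have hflat : |⟪y - y', e⟫_ℝ| ≤ K * ‖tangentialPart e (y - y')‖ := by
      rw [inner_sub_left, hfront y ⟨hy, hyρ⟩, hfront y' ⟨hy', hyρ'⟩]
      exact hlip y y'
    have hs : (K + 1) * ‖tangentialPart e ξ‖ ≤ |⟪ξ, e⟫_ℝ| :=
      (hsteep ξ h).trans (neg_le_abs _)
    have := norm_le_of_flat_of_steep he hK0 hflat hs c
    simpa using this

end Cone

/-! ### Strain of smooth fields along lines -/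

section Lines

variable {d : ℕ}

/-- The strain of a differentiable field. -/
def smoothStrain (w : E d → E d) (x : E d) : Matrix (Fin d) (Fin d) ℝ :=
  Matrix.of fun i j => 2⁻¹ * (fderiv ℝ w x (EuclideanSpace.single j 1) i +
    fderiv ℝ w x (EuclideanSpace.single i 1) j)

/-- The squared norm of the strain of a differentiable field. -/
def strainDensity (w : E d → E d) (x : E d) : ℝ≥0∞ :=
  ENNReal.ofReal (ddot (smoothStrain w x) (smoothStrain w x))

theorem ddot_self_nonneg (A : Matrix (Fin d) (Fin d) ℝ) : 0 ≤ ddot A A :=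
  Finset.sum_nonneg fun _ _ => Finset.sum_nonneg fun _ _ => mul_self_nonneg _

theorem continuous_smoothStrain_apply {w : E d → E d} (hw : ContDiff ℝ ∞ w) (i j : Fin d) :
    Continuous fun x => smoothStrain w x i j := by
  have h (k : Fin d) : Continuous fun x => fderiv ℝ w x (EuclideanSpace.single k 1) :=
    (hw.continuous_fderiv (by simp)).clm_apply continuous_const
  simp only [smoothStrain, Matrix.of_apply]
  have h1 := h i
  have h2 := h j
  fun_prop

theorem measurable_strainDensity {w : E d → E d} (hw : ContDiff ℝ ∞ w) :
    Measurable (strainDensity w) := by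
  have h := continuous_smoothStrain_apply hw
  unfold strainDensity ddot
  exact ENNReal.measurable_ofReal.comp (Continuous.measurable (by fun_prop))

theorem inner_clm_apply_eq_sum (A : E d →L[ℝ] E d) (ξ : E d) :
    ⟪A ξ, ξ⟫_ℝ = ∑ i, ∑ j, ξ i * ξ j * A (EuclideanSpace.single j 1) i := by
  have hξ : ξ = ∑ j, ξ j • EuclideanSpace.single j (1 : ℝ) := by
    have := (EuclideanSpace.basisFun (Fin d) ℝ).sum_repr ξ
    simpa using this.symm
  have hA : A ξ = ∑ j, ξ j • A (EuclideanSpace.single j 1) := by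
    conv_lhs => rw [hξ, map_sum]
    simp
  rw [hA, PiLp.inner_apply]
  refine Finset.sum_congr rfl fun i _ => ?_
  simp only [RCLike.inner_apply, conj_trivial, WithLp.ofLp_sum, Finset.sum_apply, PiLp.smul_apply,
    smul_eq_mul, Finset.mul_sum]
  exact Finset.sum_congr rfl fun j _ => by ring

/-- Cauchy–Schwarz for the strain in the direction `ξ`. -/
theorem inner_fderiv_sq_le (w : E d → E d) (x ξ : E d) :
    ⟪fderiv ℝ w x ξ, ξ⟫_ℝ ^ 2 ≤ ‖ξ‖ ^ 4 * ddot (smoothStrain w x) (smoothStrain w x) := by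
  have h1 : ⟪fderiv ℝ w x ξ, ξ⟫_ℝ =
      ∑ p : Fin d × Fin d, ξ p.1 * ξ p.2 * smoothStrain w x p.1 p.2 := by
    rw [Fintype.sum_prod_type, inner_clm_apply_eq_sum]
    set J : Fin d → Fin d → ℝ := fun i j => fderiv ℝ w x (EuclideanSpace.single j 1) i with hJ
    -- The tensor `ξ ⊗ ξ` is symmetric, so it only sees the symmetric part of the gradient.
    have hswap : ∑ i, ∑ j, ξ i * ξ j * J i j = ∑ i, ∑ j, ξ i * ξ j * J j i := by
      rw [Finset.sum_comm]
      exact Finset.sum_congr rfl fun i _ => Finset.sum_congr rfl fun j _ => by ring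
    have : ∑ i, ∑ j, ξ i * ξ j * smoothStrain w x i j =
        2⁻¹ * (∑ i, ∑ j, ξ i * ξ j * J i j) + 2⁻¹ * ∑ i, ∑ j, ξ i * ξ j * J j i := by
      simp only [Finset.mul_sum, ← Finset.sum_add_distrib]
      exact Finset.sum_congr rfl fun i _ => Finset.sum_congr rfl fun j _ => by
        simp only [smoothStrain, Matrix.of_apply, hJ]; ring
    rw [this, ← hswap]
    ring
  have h2 : ∑ p : Fin d × Fin d, (ξ p.1 * ξ p.2) ^ 2 = ‖ξ‖ ^ 4 := by
    have : ‖ξ‖ ^ 4 = (‖ξ‖ ^ 2) ^ 2 := by ring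
    rw [this, EuclideanSpace.real_norm_sq_eq, sq (∑ i, ξ i ^ 2), Finset.sum_mul_sum,
      Fintype.sum_prod_type]
    exact Finset.sum_congr rfl fun i _ => Finset.sum_congr rfl fun j _ => by ring
  have h3 : ∑ p : Fin d × Fin d, smoothStrain w x p.1 p.2 ^ 2 =
      ddot (smoothStrain w x) (smoothStrain w x) := by
    rw [Fintype.sum_prod_type, ddot]
    exact Finset.sum_congr rfl fun i _ => Finset.sum_congr rfl fun j _ => by ring
  rw [h1, ← h2, ← h3]
  exact Finset.sum_mul_sq_le_sq_mul_sq _ _ _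

/-- Expanding `0 ≤ ∫ (h - c) ^ 2` over `[0, s]`, with `c` the integral itself, gives `(2 - s) * c ^
2 ≤ ∫ h ^ 2`, and `s ≤ 1`. -/
theorem sq_intervalIntegral_le {h : ℝ → ℝ} (hh : Continuous h) {s : ℝ} (hs : s ∈ Icc (0 : ℝ) 1) :
    (∫ t in (0 : ℝ)..s, h t) ^ 2 ≤ ∫ t in (0 : ℝ)..1, h t ^ 2 := by
  set c := ∫ t in (0 : ℝ)..s, h t with hc
  have h0 : 0 ≤ ∫ t in (0 : ℝ)..s, (h t - c) ^ 2 :=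
    intervalIntegral.integral_nonneg hs.1 fun _ _ => sq_nonneg _
  have h1 : ∫ t in (0 : ℝ)..s, (h t - c) ^ 2 =
      (∫ t in (0 : ℝ)..s, h t ^ 2) - 2 * c * c + s * c ^ 2 := by
    have hi1 : IntervalIntegrable (fun t => h t ^ 2) volume 0 s :=
      (hh.pow 2).intervalIntegrable _ _
    have hi2 : IntervalIntegrable (fun t => 2 * c * h t) volume 0 s :=
      (continuous_const.mul hh).intervalIntegrable _ _
    calc ∫ t in (0 : ℝ)..s, (h t - c) ^ 2
        = ∫ t in (0 : ℝ)..s, (h t ^ 2 - 2 * c * h t + c ^ 2) := by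
          congr 1; ext t; ring
      _ = _ := by
          rw [intervalIntegral.integral_add (hi1.sub hi2) (by simp),
            intervalIntegral.integral_sub hi1 hi2, intervalIntegral.integral_const_mul,
            intervalIntegral.integral_const, ← hc]
          simp
  have h2 : (∫ t in (0 : ℝ)..s, h t ^ 2) ≤ ∫ t in (0 : ℝ)..1, h t ^ 2 := by
    have hc2 : Continuous fun t => h t ^ 2 := hh.pow 2
    rw [← intervalIntegral.integral_add_adjacent_intervals (b := s) (c := 1)
      (hc2.intervalIntegrable _ _) (hc2.intervalIntegrable _ _)]
    have := intervalIntegral.integral_nonneg (μ := volume) hs.2 fun t _ => sq_nonneg (h t)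
    linarith
  nlinarith [hs.2, sq_nonneg c]

/-- The component of a field in the direction `ξ` varies along `ξ` by the strain only. -/
theorem inner_sq_le_line {w : E d → E d} (hw : ContDiff ℝ ∞ w) (x ξ : E d) {s : ℝ}
    (hs : s ∈ Icc (0 : ℝ) 1) :
    ENNReal.ofReal (⟪w x, ξ⟫_ℝ ^ 2) ≤ 2 * ENNReal.ofReal (‖ξ‖ ^ 2) * ‖w (x + s • ξ)‖ₑ ^ 2 +
      2 * ENNReal.ofReal (‖ξ‖ ^ 4) * ∫⁻ t in Ioc (0 : ℝ) 1, strainDensity w (x + t • ξ) := by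
  set h : ℝ → ℝ := fun t => ⟪fderiv ℝ w (x + t • ξ) ξ, ξ⟫_ℝ with hh
  have hcont : Continuous h := by
    have h1 : Continuous (fderiv ℝ w) := hw.continuous_fderiv (by simp)
    have h2 : Continuous fun t : ℝ => fderiv ℝ w (x + t • ξ) := h1.comp (by fun_prop)
    exact (h2.clm_apply continuous_const).inner continuous_const
  have hderiv (t : ℝ) : HasDerivAt (fun t : ℝ => ⟪w (x + t • ξ), ξ⟫_ℝ) (h t) t := by
    have h1 : HasDerivAt (fun t : ℝ => x + t • ξ) ξ t := by
      simpa using ((hasDerivAt_id t).smul_const ξ).const_add x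
    have h2 := ((hw.differentiable (by simp)) (x + t • ξ)).hasFDerivAt.comp_hasDerivAt t h1
    simpa [hh] using h2.inner ℝ (hasDerivAt_const t ξ)
  have hint := intervalIntegral.integral_eq_sub_of_hasDerivAt (a := 0) (b := s)
    (fun t _ => hderiv t) (hcont.intervalIntegrable _ _)
  have hsq := sq_intervalIntegral_le hcont hs
  rw [hint] at hsq
  simp only [zero_smul, add_zero] at hsq
  have hb : ⟪w (x + s • ξ), ξ⟫_ℝ ^ 2 ≤ ‖ξ‖ ^ 2 * ‖w (x + s • ξ)‖ ^ 2 := by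
    rw [← mul_pow, mul_comm, ← sq_abs]
    gcongr
    exact abs_real_inner_le_norm _ _
  have hreal : ⟪w x, ξ⟫_ℝ ^ 2 ≤ 2 * ‖ξ‖ ^ 2 * ‖w (x + s • ξ)‖ ^ 2 +
      2 * ∫ t in (0 : ℝ)..1, h t ^ 2 := by
    nlinarith [sq_nonneg (⟪w (x + s • ξ), ξ⟫_ℝ - (⟪w (x + s • ξ), ξ⟫_ℝ - ⟪w x, ξ⟫_ℝ) * 2),
      sq_nonneg (2 * ⟪w (x + s • ξ), ξ⟫_ℝ - ⟪w x, ξ⟫_ℝ)]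
  have hI : ENNReal.ofReal (∫ t in (0 : ℝ)..1, h t ^ 2) ≤
      ENNReal.ofReal (‖ξ‖ ^ 4) * ∫⁻ t in Ioc (0 : ℝ) 1, strainDensity w (x + t • ξ) := by
    have hc2 : Continuous fun t => h t ^ 2 := hcont.pow 2
    have hm : Measurable fun t : ℝ => strainDensity w (x + t • ξ) :=
      (measurable_strainDensity hw).comp (by fun_prop)
    rw [intervalIntegral.integral_of_le zero_le_one, ofReal_integral_eq_lintegral_ofReal
      hc2.integrableOn_Ioc (Eventually.of_forall fun _ => sq_nonneg _),
      ← lintegral_const_mul _ hm]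
    refine lintegral_mono fun t => ?_
    rw [strainDensity, ← ENNReal.ofReal_mul (by positivity)]
    exact ENNReal.ofReal_le_ofReal (inner_fderiv_sq_le w _ ξ)
  refine (ENNReal.ofReal_le_ofReal hreal).trans ?_
  rw [ENNReal.ofReal_add (by positivity) (by
    have : 0 ≤ ∫ t in (0 : ℝ)..1, h t ^ 2 :=
      intervalIntegral.integral_nonneg zero_le_one fun _ _ => sq_nonneg _
    positivity), ENNReal.ofReal_mul (by positivity), ENNReal.ofReal_mul (by positivity),
    ENNReal.ofReal_mul (by positivity), ENNReal.ofReal_pow (norm_nonneg (w (x + s • ξ))),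
    ofReal_norm, ENNReal.ofReal_ofNat, mul_assoc 2 (ENNReal.ofReal (‖ξ‖ ^ 4))]
  gcongr

/-- A constant that is uniform in the direction allows integration over `ξ`. The endpoint `s`
remains free although the strain is integrated over the whole unit segment: `s = 1` serves for
shifts, and an average over `s` for traces. -/
theorem inner_sq_le_line_of_norm_le {w : E d → E d} (hw : ContDiff ℝ ∞ w) (x : E d) {ξ : E d}
    {M : ℝ≥0} (hξ : ‖ξ‖ ≤ M) {s : ℝ} (hs : s ∈ Icc (0 : ℝ) 1) :
    ENNReal.ofReal (⟪w x, ξ⟫_ℝ ^ 2) ≤ ((2 * M ^ 2 + 2 * M ^ 4 : ℝ≥0) : ℝ≥0∞) *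
      (‖w (x + s • ξ)‖ₑ ^ 2 + ∫⁻ t in Ioc (0 : ℝ) 1, strainDensity w (x + t • ξ)) := by
  refine (inner_sq_le_line hw x ξ hs).trans ?_
  rw [mul_add]
  have hk (k : ℕ) : ENNReal.ofReal (‖ξ‖ ^ k) ≤ (M : ℝ≥0∞) ^ k := by
    rw [ENNReal.ofReal_pow (norm_nonneg _)]
    gcongr
    rw [← ENNReal.ofReal_coe_nnreal]
    exact ENNReal.ofReal_le_ofReal hξ
  push_cast
  gcongr
  · exact (mul_le_mul_right (hk 2) _).trans le_self_add
  · exact (mul_le_mul_right (hk 4) _).trans le_add_self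

/-- Every ball of directions contains finitely many directions along which a vector is
determined. -/
theorem exists_spanning_directions (η : E d) {κ : ℝ} (hκ : 0 < κ) :
    ∃ (ξ : Option (Fin d) → E d) (C : ℝ≥0), (∀ o, ξ o ∈ Metric.closedBall η κ) ∧
      ∀ a : E d, ‖a‖ₑ ^ 2 ≤ C * ∑ o, ENNReal.ofReal (⟪a, ξ o⟫_ℝ ^ 2) := by
  -- Inner products with `η` and with `η + κ • e_i` differ by `κ * a i`, so these `d + 1` directions
  -- recover every coordinate.
  let ξ : Option (Fin d) → E d := fun o => o.elim η fun i => η + κ • EuclideanSpace.single i 1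
  refine ⟨ξ, Real.toNNReal ((2 * d + 2) / κ ^ 2), ?_, fun a => ?_⟩
  · rintro (_ | i)
    · simp [ξ, hκ.le]
    · simp [ξ, norm_smul, abs_of_pos hκ]
  · have h1 (i : Fin d) : κ ^ 2 * a i ^ 2 ≤ 2 * ⟪a, ξ (some i)⟫_ℝ ^ 2 + 2 * ⟪a, ξ none⟫_ℝ ^ 2 := by
      have : κ * a i = ⟪a, ξ (some i)⟫_ℝ - ⟪a, ξ none⟫_ℝ := by
        simp [ξ, inner_add_right, real_inner_smul_right, EuclideanSpace.inner_single_right]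
      rw [← mul_pow, this]
      nlinarith [sq_nonneg (⟪a, ξ (some i)⟫_ℝ + ⟪a, ξ none⟫_ℝ)]
    have h2 : κ ^ 2 * ‖a‖ ^ 2 ≤ (2 * d + 2) * ∑ o, ⟪a, ξ o⟫_ℝ ^ 2 := by
      rw [EuclideanSpace.real_norm_sq_eq, Finset.mul_sum, Fintype.sum_option]
      refine (Finset.sum_le_sum fun i _ => h1 i).trans ?_
      rw [Finset.sum_add_distrib, ← Finset.mul_sum, Finset.sum_const, Finset.card_univ,
        Fintype.card_fin, nsmul_eq_mul]
      have h3 : 0 ≤ ∑ i, ⟪a, ξ (some i)⟫_ℝ ^ 2 := Finset.sum_nonneg fun _ _ => sq_nonneg _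
      have h4 : (0 : ℝ) ≤ d := d.cast_nonneg
      nlinarith [sq_nonneg ⟪a, ξ none⟫_ℝ, mul_nonneg h4 h3]
    have h5 : ‖a‖ ^ 2 ≤ (2 * d + 2) / κ ^ 2 * ∑ o, ⟪a, ξ o⟫_ℝ ^ 2 := by
      rw [div_mul_eq_mul_div, le_div_iff₀ (by positivity)]
      linarith
    rw [← ofReal_norm, ← ENNReal.ofReal_pow (norm_nonneg _)]
    refine (ENNReal.ofReal_le_ofReal h5).trans ?_
    rw [ENNReal.ofReal_mul (by positivity), ENNReal.ofReal_sum_of_nonneg fun _ _ => sq_nonneg _]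
    rfl

/-- Pointwise bound of a field by its values and strains along a few lines, whose directions lie in
a prescribed ball. -/
theorem exists_enorm_sq_le_lines (η : E d) {κ : ℝ} (hκ : 0 < κ) :
    ∃ (ξ : Option (Fin d) → E d) (C : ℝ≥0), (∀ o, ξ o ∈ Metric.closedBall η κ) ∧
      ∀ w : E d → E d, ContDiff ℝ ∞ w → ∀ (x : E d), ∀ s ∈ Icc (0 : ℝ) 1,
        ‖w x‖ₑ ^ 2 ≤ C * ∑ o, (‖w (x + s • ξ o)‖ₑ ^ 2 +
          ∫⁻ t in Ioc (0 : ℝ) 1, strainDensity w (x + t • ξ o)) := by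
  obtain ⟨ξ, C, hξ, hC⟩ := exists_spanning_directions η hκ
  set M : ℝ≥0 := ‖η‖₊ + κ.toNNReal
  have hM (o) : ‖ξ o‖ ≤ M := by
    have := hξ o
    rw [Metric.mem_closedBall, dist_eq_norm] at this
    have h := norm_le_insert' (ξ o) η
    simp only [M, NNReal.coe_add, coe_nnnorm, Real.coe_toNNReal _ hκ.le]
    linarith
  refine ⟨ξ, C * (2 * M ^ 2 + 2 * M ^ 4), hξ, fun w hw x s hs => (hC _).trans ?_⟩
  rw [ENNReal.coe_mul, mul_assoc, Finset.mul_sum (a := ((2 * M ^ 2 + 2 * M ^ 4 : ℝ≥0) : ℝ≥0∞))]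
  gcongr with o
  exact inner_sq_le_line_of_norm_le hw x (hM o) hs

end Lines

/-! ### Measures controlled by the strain -/

section Control

variable {d : ℕ} {D : Set (E d)} {β α α' : Measure (E d)}

/-- The `L^2(α)` norm of a smooth field is bounded by the `L^2(D)` norm of its strain and its
`L^2(β)` norm. -/
def Controlled (D : Set (E d)) (β α : Measure (E d)) : Prop :=
  ∃ C : ℝ≥0, ∀ w : E d → E d, ContDiff ℝ ∞ w →
    ∫⁻ x, ‖w x‖ₑ ^ 2 ∂α ≤ C * ((∫⁻ x in D, strainDensity w x) + ∫⁻ x, ‖w x‖ₑ ^ 2 ∂β)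

theorem Controlled.mono (h : Controlled D β α) (hle : α' ≤ α) : Controlled D β α' := by
  obtain ⟨C, hC⟩ := h
  exact ⟨C, fun w hw => (lintegral_mono' hle le_rfl).trans (hC w hw)⟩

theorem Controlled.zero : Controlled D β 0 := ⟨0, fun w _ => by simp⟩

/-- Additivity of the constants makes control a local property, checked on finite covers. -/
theorem Controlled.restrict_union {μ : Measure (E d)} {A B : Set (E d)}
    (hA : Controlled D β (μ.restrict A)) (hB : Controlled D β (μ.restrict B)) :
    Controlled D β (μ.restrict (A ∪ B)) := by
  obtain ⟨C, hC⟩ := hA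
  obtain ⟨C', hC'⟩ := hB
  refine ⟨C + C', fun w hw => (lintegral_union_le _ _ _).trans ?_⟩
  rw [ENNReal.coe_add, add_mul]
  exact add_le_add (hC w hw) (hC' w hw)

theorem Controlled.restrict_mono {μ : Measure (E d)} {A B : Set (E d)} (hAB : A ⊆ B)
    (hB : Controlled D β (μ.restrict B)) : Controlled D β (μ.restrict A) :=
  hB.mono (Measure.restrict_mono hAB le_rfl)

/-- Control near every point of a compact set gives control on the set. -/
theorem Controlled.of_isCompact {μ : Measure (E d)} {K : Set (E d)} (hK : IsCompact K)
    (h : ∀ z ∈ K, ∃ r > 0, Controlled D β (μ.restrict (K ∩ Metric.ball z r))) :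
    Controlled D β (μ.restrict K) := by
  have := hK.induction_on (p := fun s => Controlled D β (μ.restrict (K ∩ s))) ?_ ?_ ?_ ?_
  · simpa using this
  · simpa using Controlled.zero
  · exact fun s t hst ht => ht.restrict_mono (inter_subset_inter_right _ hst)
  · intro s t hs ht
    rw [inter_union_distrib_left]
    exact hs.restrict_union ht
  · intro z hz
    obtain ⟨r, hr, hc⟩ := h z hz
    exact ⟨_, mem_nhdsWithin_of_mem_nhds (Metric.ball_mem_nhds z hr), hc⟩

theorem measurable_enorm_sq {w : E d → E d} (hw : ContDiff ℝ ∞ w) :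
    Measurable fun x => ‖w x‖ₑ ^ 2 := by
  have := hw.continuous.measurable
  fun_prop

/-- Integrals over translates inside `D`. -/
theorem setLIntegral_lines_le (hD : MeasurableSet D) {A : Set (E d)} (hA : MeasurableSet A)
    {ξ : E d} (hseg : ∀ x ∈ A, ∀ t ∈ Ioc (0 : ℝ) 1, x + t • ξ ∈ D) {g : E d → ℝ≥0∞}
    (hg : Measurable g) :
    ∫⁻ x in A, ∫⁻ t in Ioc (0 : ℝ) 1, g (x + t • ξ) ≤ ∫⁻ x in D, g x := by
  have hm : Measurable fun p : E d × ℝ => g (p.1 + p.2 • ξ) := by fun_prop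
  -- For fixed `t` the map `x ↦ x + t • ξ` is a translation that sends `A` into `D`.
  rw [lintegral_lintegral_swap hm.aemeasurable]
  calc ∫⁻ t in Ioc (0 : ℝ) 1, ∫⁻ x in A, g (x + t • ξ)
      ≤ ∫⁻ t in Ioc (0 : ℝ) 1, ∫⁻ x in D, g x := by
        refine setLIntegral_mono' measurableSet_Ioc fun t ht => ?_
        rw [← lintegral_indicator hD, ← lintegral_add_right_eq_self (D.indicator g) (t • ξ)]
        refine le_trans ?_ (setLIntegral_le_lintegral A _)
        refine setLIntegral_mono' hA fun x hx => ?_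
        rw [indicator_of_mem (hseg x hx t ht)]
    _ = ∫⁻ x in D, g x := by simp

/-- Control spreads from a set to the points which are joined to it by segments in `D`. -/
theorem Controlled.shift (hD : MeasurableSet D) {A B : Set (E d)} (hA : MeasurableSet A)
    (hB : MeasurableSet B) {η : E d} {κ : ℝ} (hκ : 0 < κ)
    (hseg : ∀ ξ ∈ Metric.closedBall η κ, ∀ x ∈ A, ∀ t ∈ Ioc (0 : ℝ) 1, x + t • ξ ∈ D)
    (hAB : ∀ ξ ∈ Metric.closedBall η κ, ∀ x ∈ A, x + ξ ∈ B)
    (hBc : Controlled D β (volume.restrict B)) : Controlled D β (volume.restrict A) := by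
  obtain ⟨ξ, C, hξ, hC⟩ := exists_enorm_sq_le_lines η hκ
  obtain ⟨C', hC'⟩ := hBc
  refine ⟨C * ∑ _o : Option (Fin d), (C' + 1), fun w hw => ?_⟩
  have hn := measurable_enorm_sq hw
  have hs := measurable_strainDensity hw
  have hm1 (o) : Measurable fun x => ‖w (x + ξ o)‖ₑ ^ 2 := hn.comp (measurable_add_const (ξ o))
  have hm2 (o) : Measurable fun x => ∫⁻ t in Ioc (0 : ℝ) 1, strainDensity w (x + t • ξ o) := by
    have : Measurable fun p : E d × ℝ => strainDensity w (p.1 + p.2 • ξ o) :=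
      hs.comp (by fun_prop)
    exact this.lintegral_prod_right'
  calc ∫⁻ x in A, ‖w x‖ₑ ^ 2
      ≤ ∫⁻ x in A, C * ∑ o, (‖w (x + ξ o)‖ₑ ^ 2 +
          ∫⁻ t in Ioc (0 : ℝ) 1, strainDensity w (x + t • ξ o)) :=
        -- The endpoint is `s = 1`, where `x + ξ o` lies in `B`.
        lintegral_mono fun x => by simpa using hC w hw x 1 (by simp)
    _ = C * ∑ o, ((∫⁻ x in A, ‖w (x + ξ o)‖ₑ ^ 2) +
          ∫⁻ x in A, ∫⁻ t in Ioc (0 : ℝ) 1, strainDensity w (x + t • ξ o)) := by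
        have hm (o) : Measurable fun x => ‖w (x + ξ o)‖ₑ ^ 2 +
            ∫⁻ t in Ioc (0 : ℝ) 1, strainDensity w (x + t • ξ o) := (hm1 o).add (hm2 o)
        rw [lintegral_const_mul _ (Finset.measurable_fun_sum _ fun o _ => hm o),
          lintegral_finsetSum _ fun o _ => hm o]
        congr 1
        exact Finset.sum_congr rfl fun o _ => lintegral_add_left (hm1 o) _
    _ ≤ C * ∑ _o : Option (Fin d), (((C' + 1 : ℝ≥0) : ℝ≥0∞) *
          ((∫⁻ x in D, strainDensity w x) + ∫⁻ x, ‖w x‖ₑ ^ 2 ∂β)) := by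
        gcongr with o
        rw [ENNReal.coe_add, ENNReal.coe_one, add_mul, one_mul]
        refine add_le_add ?_ ((setLIntegral_lines_le hD hA (hseg _ (hξ o)) hs).trans le_self_add)
        refine le_trans ?_ (hC' w hw)
        rw [← lintegral_indicator hB,
          ← lintegral_add_right_eq_self (B.indicator fun x => ‖w x‖ₑ ^ 2) (ξ o)]
        refine le_trans ?_ (setLIntegral_le_lintegral A _)
        refine setLIntegral_mono' hA fun x hx => ?_
        rw [indicator_of_mem (hAB _ (hξ o) x hx)]
    _ = _ := by
        rw [← Finset.sum_mul, ENNReal.coe_mul, mul_assoc]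
        simp

/-- Integrals over the lines that leave the boundary of `D` in a fixed direction. -/
theorem setLIntegral_surface_lines_le (hD : MeasurableSet D) {S : Set (E d)}
    (hS : MeasurableSet S) (hSD : S ⊆ frontier D) {L : ℝ≥0} {ξ : E d} (hξ : ξ ≠ 0)
    (hL : ∀ y ∈ S, ∀ y' ∈ S, ∀ c : ℝ, ‖y - y'‖ ≤ L * ‖y - y' - c • ξ‖)
    (hseg : ∀ x ∈ S, ∀ t ∈ Ioc (0 : ℝ) 1, x + t • ξ ∈ D) {g : E d → ℝ≥0∞}
    (hg : Measurable g) :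
    ∫⁻ y in S, (∫⁻ t in Ioc (0 : ℝ) 1, g (y + t • ξ)) ∂(surface D) ≤
      ((‖ξ‖₊⁻¹ * L ^ (d - 1) : ℝ≥0) : ℝ≥0∞) * ∫⁻ x in D, g x := by
  have hξ0 : ‖ξ‖ₑ ≠ 0 := by simpa using hξ
  have hcore := lintegral_surface_lines_le hξ hS hL (hg.indicator hD)
  rw [lintegral_indicator hD] at hcore
  have hrestr : (surface D).restrict S =
      (Measure.euclideanHausdorffMeasure (d - 1) : Measure (E d)).restrict S := by
    rw [surface, Measure.restrict_restrict hS, inter_eq_left.2 hSD]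
  rw [hrestr, ENNReal.coe_mul, ENNReal.coe_inv (by simpa using hξ), mul_assoc]
  change _ ≤ ‖ξ‖ₑ⁻¹ * _
  rw [mul_comm, ← div_eq_mul_inv, ENNReal.le_div_iff_mul_le (Or.inl hξ0) (Or.inl (by simp)),
    mul_comm]
  push_cast
  -- The unit segment lies in `D`, so cutting `g` off outside `D` changes nothing on it, and the
  -- segment can then be enlarged to the full line.
  refine le_trans (mul_le_mul_right ?_ _) hcore
  refine setLIntegral_mono' hS fun y hy => ?_
  refine le_trans ?_ (setLIntegral_le_lintegral (Ioc (0 : ℝ) 1) _)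
  refine setLIntegral_mono' measurableSet_Ioc fun t ht => ?_
  rw [indicator_of_mem (hseg y hy t ht)]

/-- The surface measure of a Lipschitz domain is finite. -/
theorem IsLipschitzDomain.isFiniteMeasure_surface (hD : IsLipschitzDomain D) :
    IsFiniteMeasure (surface D) := by
  have hcomp : IsCompact (frontier D) :=
    Metric.isCompact_of_isClosed_isBounded isClosed_frontier
      (hD.isBounded.closure.subset frontier_subset_closure)
  have hvol : volume D < ⊤ := hD.isBounded.measure_lt_top
  have hfin : surface D (frontier D) < ⊤ := by
    refine hcomp.measure_lt_top_of_nhdsWithin fun z hz => ?_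
    obtain ⟨η, θ, ρ, L, hθ, hρ, hne, hseg, hL⟩ := hD.exists_cone hz
    have hη : η ∈ Metric.closedBall η θ := Metric.mem_closedBall_self hθ.le
    refine ⟨frontier D ∩ Metric.ball z ρ, inter_mem_nhdsWithin _ (Metric.ball_mem_nhds z hρ), ?_⟩
    -- With integrand `1` the left side is the surface measure of the boundary piece, and the right
    -- side a multiple of the volume of `D`.
    have h := setLIntegral_surface_lines_le (S := frontier D ∩ Metric.ball z ρ)
      hD.isOpen.measurableSet
      (isClosed_frontier.measurableSet.inter measurableSet_ball) inter_subset_left (hne η hη)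
      (hL η hη) (fun x hx => hseg η hη x ⟨frontier_subset_closure hx.1, hx.2⟩)
      (measurable_const (a := (1 : ℝ≥0∞)))
    simp only [lintegral_const, one_mul, Measure.restrict_apply MeasurableSet.univ, univ_inter,
      Real.volume_Ioc, sub_zero, ENNReal.ofReal_one] at h
    exact h.trans_lt (ENNReal.mul_lt_top ENNReal.coe_lt_top hvol)
  refine ⟨?_⟩
  rwa [surface, Measure.restrict_apply MeasurableSet.univ, univ_inter, ← inter_self (frontier D),
    ← Measure.restrict_apply isClosed_frontier.measurableSet]

/-- Control on the domain gives control on its boundary. -/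
theorem IsLipschitzDomain.controlled_surface (hD : IsLipschitzDomain D)
    (h : Controlled D β (volume.restrict D)) : Controlled D β (surface D) := by
  have hfin := hD.isFiniteMeasure_surface
  have hcomp : IsCompact (frontier D) :=
    Metric.isCompact_of_isClosed_isBounded isClosed_frontier
      (hD.isBounded.closure.subset frontier_subset_closure)
  suffices hs : Controlled D β ((surface D).restrict (frontier D)) by
    rwa [surface, Measure.restrict_restrict isClosed_frontier.measurableSet, inter_self,
      ← surface] at hs
  refine Controlled.of_isCompact hcomp fun z hz => ?_
  obtain ⟨η, θ, ρ, L, hθ, hρ, hne, hseg, hL⟩ := hD.exists_cone hz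
  refine ⟨ρ, hρ, ?_⟩
  set S := frontier D ∩ Metric.ball z ρ
  have hS : MeasurableSet S := isClosed_frontier.measurableSet.inter measurableSet_ball
  obtain ⟨ξ, C, hξ, hC⟩ := exists_enorm_sq_le_lines η hθ
  obtain ⟨C', hC'⟩ := h
  refine ⟨C * ∑ o : Option (Fin d), (‖ξ o‖₊⁻¹ * L ^ (d - 1)) * (C' + 1), fun w hw => ?_⟩
  have hn := measurable_enorm_sq hw
  have hs := measurable_strainDensity hw
  have hg : Measurable fun x => ‖w x‖ₑ ^ 2 + strainDensity w x := hn.add hs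
  have hm (o) : Measurable fun x => ∫⁻ t in Ioc (0 : ℝ) 1,
      (‖w (x + t • ξ o)‖ₑ ^ 2 + strainDensity w (x + t • ξ o)) := by
    have : Measurable fun p : E d × ℝ =>
      (‖w (p.1 + p.2 • ξ o)‖ₑ ^ 2 + strainDensity w (p.1 + p.2 • ξ o)) := hg.comp (by fun_prop)
    exact this.lintegral_prod_right'
  have hmn (x : E d) (o) : Measurable fun t : ℝ => ‖w (x + t • ξ o)‖ₑ ^ 2 :=
    hn.comp (by fun_prop)
  -- Averaging over the endpoint `s` replaces a value at one shifted point by a line integral.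
  -- Integrated over the boundary, the latter is bounded by a volume integral.
  have hpt (x : E d) : ‖w x‖ₑ ^ 2 ≤ C * ∑ o, ∫⁻ t in Ioc (0 : ℝ) 1,
      (‖w (x + t • ξ o)‖ₑ ^ 2 + strainDensity w (x + t • ξ o)) := by
    calc ‖w x‖ₑ ^ 2 = ∫⁻ _s in Ioc (0 : ℝ) 1, ‖w x‖ₑ ^ 2 := by simp
      _ ≤ ∫⁻ s in Ioc (0 : ℝ) 1, C * ∑ o, (‖w (x + s • ξ o)‖ₑ ^ 2 +
          ∫⁻ t in Ioc (0 : ℝ) 1, strainDensity w (x + t • ξ o)) :=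
        setLIntegral_mono' measurableSet_Ioc fun s hs => hC w hw x s ⟨hs.1.le, hs.2⟩
      _ = _ := by
        have hm' (o) : Measurable fun s : ℝ => ‖w (x + s • ξ o)‖ₑ ^ 2 +
            ∫⁻ t in Ioc (0 : ℝ) 1, strainDensity w (x + t • ξ o) :=
          (hmn x o).add measurable_const
        rw [lintegral_const_mul _ (Finset.measurable_fun_sum _ fun o _ => hm' o),
          lintegral_finsetSum _ fun o _ => hm' o]
        congr 1
        refine Finset.sum_congr rfl fun o _ => ?_
        rw [lintegral_add_left (hmn x o), lintegral_add_left (hmn x o)]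
        simp
  calc ∫⁻ x in S, ‖w x‖ₑ ^ 2 ∂surface D
      ≤ ∫⁻ x in S, (C * ∑ o, ∫⁻ t in Ioc (0 : ℝ) 1,
          (‖w (x + t • ξ o)‖ₑ ^ 2 + strainDensity w (x + t • ξ o))) ∂surface D := lintegral_mono hpt
    _ = C * ∑ o, ∫⁻ x in S, (∫⁻ t in Ioc (0 : ℝ) 1,
          (‖w (x + t • ξ o)‖ₑ ^ 2 + strainDensity w (x + t • ξ o))) ∂surface D := by
        rw [lintegral_const_mul _ (Finset.measurable_fun_sum _ fun o _ => hm o),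
          lintegral_finsetSum _ fun o _ => hm o]
    _ ≤ C * ∑ o, ((‖ξ o‖₊⁻¹ * L ^ (d - 1) : ℝ≥0) : ℝ≥0∞) * (((C' + 1 : ℝ≥0) : ℝ≥0∞) *
          ((∫⁻ x in D, strainDensity w x) + ∫⁻ x, ‖w x‖ₑ ^ 2 ∂β)) := by
        gcongr with o
        refine (setLIntegral_surface_lines_le hD.isOpen.measurableSet hS inter_subset_left
          (hne _ (hξ o)) (hL _ (hξ o))
          (fun x hx => hseg _ (hξ o) x ⟨frontier_subset_closure hx.1, hx.2⟩) hg).trans ?_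
        gcongr
        rw [lintegral_add_left hn, ENNReal.coe_add, ENNReal.coe_one, add_mul, one_mul]
        exact add_le_add (hC' w hw) le_self_add
    _ = _ := by
        simp_rw [← mul_assoc (ENNReal.ofNNReal _) (ENNReal.ofNNReal _), ← ENNReal.coe_mul]
        rw [← Finset.sum_mul, ← ENNReal.ofNNReal_finsetSum, ← mul_assoc, ← ENNReal.coe_mul]

end Control

/-! ### Korn's inequality with boundary values on a part of the boundary -/

section Korn

variable {d : ℕ} {D : Set (E d)}

/-- The intersection of two transversal hyperplanes has no surface measure. -/
theorem euclideanHausdorffMeasure_inter_hyperplanes {a b : E d} (hab : LinearIndependent ℝ ![a, b])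
    (s t : ℝ) :
    (Measure.euclideanHausdorffMeasure (d - 1) : Measure (E d))
      {y | ⟪a, y⟫_ℝ = s ∧ ⟪b, y⟫_ℝ = t} = 0 := by
  rcases Set.eq_empty_or_nonempty {y : E d | ⟪a, y⟫_ℝ = s ∧ ⟪b, y⟫_ℝ = t} with h | ⟨y₀, h1, h2⟩
  · rw [h, measure_empty]
  set W := Submodule.span ℝ (range ![a, b]) with hW
  have hfin : Module.finrank ℝ W = 2 := by
    rw [hW, finrank_span_eq_card hab, Fintype.card_fin]
  have hfin' : Module.finrank ℝ Wᗮ + 2 = d := by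
    have := W.finrank_add_finrank_orthogonal
    rw [hfin, finrank_euclideanSpace_fin] at this
    omega
  have hsub : {y : E d | ⟪a, y⟫_ℝ = s ∧ ⟪b, y⟫_ℝ = t} ⊆
      range fun v : Wᗮ => y₀ + (v : E d) := by
    rintro y ⟨hy1, hy2⟩
    refine ⟨⟨y - y₀, ?_⟩, by simp⟩
    rw [hW, Submodule.mem_orthogonal]
    intro u hu
    induction hu using Submodule.span_induction with
    | mem x hx =>
      obtain ⟨i, rfl⟩ := hx
      fin_cases i <;> simp [inner_sub_right, *]
    | zero => simp
    | add x y _ _ hx hy => rw [inner_add_left, hx, hy, add_zero]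
    | smul c x _ hx => rw [real_inner_smul_left, hx, mul_zero]
  refine measure_mono_null hsub ?_
  have hiso : Isometry fun v : Wᗮ => y₀ + (v : E d) :=
    (isometry_add_left y₀).comp isometry_subtype_coe
  have hzero : (Measure.hausdorffMeasure ((d - 1 : ℕ) : ℝ) : Measure Wᗮ) = 0 :=
    -- The intersection is a translate of a subset of `Wᗮ`, which has dimension `d - 2`.
    Real.hausdorffMeasure_of_finrank_lt (by
      have : Module.finrank ℝ Wᗮ < d - 1 := by omega
      exact_mod_cast this)
  rw [← image_univ, hiso.euclideanHausdorffMeasure_image, Measure.euclideanHausdorffMeasure_def,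
    Measure.smul_apply, hzero]
  simp

/-- Near any point there are points which see a set of positive surface measure in all
directions. -/
theorem exists_mem_ball_forall_not_ae_inner_eq {μ : Measure (E d)} (hμ0 : μ ≠ 0)
    (hμ : μ ≪ (Measure.euclideanHausdorffMeasure (d - 1) : Measure (E d))) (x₁ : E d) {r : ℝ}
    (hr : 0 < r) :
    ∃ x₀ ∈ Metric.ball x₁ r, ∀ a : E d, a ≠ 0 → ¬ ∀ᵐ y ∂μ, ⟪a, x₀ - y⟫_ℝ = 0 := by
  have : (ae μ).NeBot := ae_neBot.2 hμ0
  -- If `μ` lives on a hyperplane, `x₀` is chosen off it. A bad direction `a` would put `μ` on a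
  -- second hyperplane, through `x₀`, which is therefore not the first one. It is not parallel to
  -- it, since both carry `μ`, and transversal ones meet in a null set. If `μ` lives on no
  -- hyperplane, `x₁` itself works.
  by_cases hH : ∃ (b : E d) (c : ℝ), b ≠ 0 ∧ ∀ᵐ y ∂μ, ⟪b, y⟫_ℝ = c
  · obtain ⟨b, c, hb, hbc⟩ := hH
    obtain ⟨x₀, hx₀, hx₀c⟩ : ∃ x₀ ∈ Metric.ball x₁ r, ⟪b, x₀⟫_ℝ ≠ c := by
      by_cases h : ⟪b, x₁⟫_ℝ = c
      · have hb' : 0 < ‖b‖ := norm_pos_iff.2 hb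
        refine ⟨x₁ + (r / (2 * ‖b‖)) • b, ?_, ?_⟩
        · rw [Metric.mem_ball, dist_eq_norm, add_sub_cancel_left, norm_smul, Real.norm_eq_abs,
            abs_of_pos (by positivity)]
          field_simp
          linarith
        · rw [inner_add_right, real_inner_smul_right, h, real_inner_self_eq_norm_sq]
          have : 0 < r / (2 * ‖b‖) * ‖b‖ ^ 2 := by positivity
          linarith
      · exact ⟨x₁, Metric.mem_ball_self hr, h⟩
    refine ⟨x₀, hx₀, fun a ha hae => ?_⟩
    have hboth : ∀ᵐ y ∂μ, ⟪b, y⟫_ℝ = c ∧ ⟪a, y⟫_ℝ = ⟪a, x₀⟫_ℝ := by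
      filter_upwards [hbc, hae] with y h1 h2
      rw [inner_sub_right] at h2
      exact ⟨h1, by linarith⟩
    have hli : LinearIndependent ℝ ![b, a] := by
      rw [LinearIndependent.pair_iff' hb]
      intro k hk
      obtain ⟨y, hy1, hy2⟩ := hboth.exists
      rw [← hk, real_inner_smul_left, real_inner_smul_left, hy1] at hy2
      have hk0 : k ≠ 0 := by
        rintro rfl
        exact ha (by rw [← hk, zero_smul])
      exact hx₀c (mul_left_cancel₀ hk0 hy2.symm)
    have hzero := hμ (euclideanHausdorffMeasure_inter_hyperplanes hli c ⟪a, x₀⟫_ℝ)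
    have hnull : ∀ᵐ y ∂μ, ¬ (⟪b, y⟫_ℝ = c ∧ ⟪a, y⟫_ℝ = ⟪a, x₀⟫_ℝ) := by
      rw [ae_iff]; simpa using hzero
    obtain ⟨y, hy1, hy2⟩ := (hboth.and hnull).exists
    exact hy2 hy1
  · simp only [not_exists, not_and] at hH
    refine ⟨x₁, Metric.mem_ball_self hr, fun a ha hae => hH a ⟪a, x₁⟫_ℝ ha ?_⟩
    filter_upwards [hae] with y hy
    rw [inner_sub_right] at hy
    linarith

/-- Averaged squares of inner products bound the norm, uniformly near `x₀`. -/
theorem exists_norm_sq_le_integral_inner_sq {μ : Measure (E d)} [IsFiniteMeasure μ] {z : E d}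
    {R : ℝ} (hbdd : ∀ᵐ y ∂μ, y ∈ Metric.ball z R) {x₀ : E d}
    (hx₀ : ∀ a : E d, a ≠ 0 → ¬ ∀ᵐ y ∂μ, ⟪a, x₀ - y⟫_ℝ = 0) :
    ∃ c > 0, ∃ r > 0, ∀ x ∈ Metric.ball x₀ r, ∀ a : E d,
      c * ‖a‖ ^ 2 ≤ ∫ y, ⟪a, y - x⟫_ℝ ^ 2 ∂μ := by
  have hbd (x : E d) : ∀ᵐ y ∂μ, ‖y - x‖ ≤ R + ‖z - x‖ := by
    filter_upwards [hbdd] with y hy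
    rw [Metric.mem_ball, dist_eq_norm] at hy
    calc ‖y - x‖ = ‖(y - z) + (z - x)‖ := by congr 1; abel
      _ ≤ _ := (norm_add_le _ _).trans (by linarith)
  have hbd2 (x a : E d) : ∀ᵐ y ∂μ, ‖⟪a, y - x⟫_ℝ ^ 2‖ ≤ (‖a‖ * (R + ‖z - x‖)) ^ 2 := by
    filter_upwards [hbd x] with y hy
    rw [norm_pow, Real.norm_eq_abs]
    gcongr
    exact (abs_real_inner_le_norm _ _).trans (by gcongr)
  have hcont (x a : E d) : Continuous fun y : E d => ⟪a, y - x⟫_ℝ ^ 2 := by fun_prop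
  have hint (x a : E d) : Integrable (fun y => ⟪a, y - x⟫_ℝ ^ 2) μ :=
    Integrable.of_bound (hcont x a).aestronglyMeasurable _ (hbd2 x a)
  -- At `x₀` the quadratic form is positive on the compact unit sphere, hence bounded below there;
  -- an empty sphere leaves only the vector `0`.
  obtain ⟨c, hc, hcle⟩ : ∃ c > 0, ∀ a : E d, c * ‖a‖ ^ 2 ≤ ∫ y, ⟪a, y - x₀⟫_ℝ ^ 2 ∂μ := by
    rcases (Metric.sphere (0 : E d) 1).eq_empty_or_nonempty with he | hne
    · refine ⟨1, one_pos, fun a => ?_⟩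
      have : a = 0 := by
        by_contra ha
        have : ‖a‖⁻¹ • a ∈ Metric.sphere (0 : E d) 1 := by
          simp [norm_smul, ha]
        simp [he] at this
      simp [this]
    have hQc : ContinuousOn (fun a : E d => ∫ y, ⟪a, y - x₀⟫_ℝ ^ 2 ∂μ)
        (Metric.sphere (0 : E d) 1) := by
      refine continuousOn_of_dominated (bound := fun _ => (R + ‖z - x₀‖) ^ 2)
        (fun a _ => (hcont x₀ a).aestronglyMeasurable) (fun a ha => ?_) (integrable_const _)
        (Eventually.of_forall fun y => by fun_prop)
      have ha1 : ‖a‖ = 1 := by simpa using ha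
      filter_upwards [hbd2 x₀ a] with y hy
      simpa [ha1] using hy
    obtain ⟨a₀, ha₀, hmin⟩ := (isCompact_sphere (0 : E d) 1).exists_isMinOn hne hQc
    have ha₀1 : ‖a₀‖ = 1 := by simpa using ha₀
    have hnn : 0 ≤ᵐ[μ] fun y => ⟪a₀, y - x₀⟫_ℝ ^ 2 := Eventually.of_forall fun _ => sq_nonneg _
    have hpos : 0 < ∫ y, ⟪a₀, y - x₀⟫_ℝ ^ 2 ∂μ := by
      refine (integral_nonneg fun _ => sq_nonneg _).lt_of_ne fun h0 => ?_
      rw [eq_comm, integral_eq_zero_iff_of_nonneg_ae hnn (hint x₀ a₀)] at h0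
      refine hx₀ a₀ (by rintro rfl; simp at ha₀1) ?_
      filter_upwards [h0] with y hy
      have : ⟪a₀, y - x₀⟫_ℝ = 0 := by simpa using hy
      rw [← neg_sub, inner_neg_right, this, neg_zero]
    refine ⟨_, hpos, fun a => ?_⟩
    rcases eq_or_ne a 0 with rfl | ha
    · simp
    have hna : 0 < ‖a‖ := norm_pos_iff.2 ha
    have hs : ‖a‖⁻¹ • a ∈ Metric.sphere (0 : E d) 1 := by simp [norm_smul, ha]
    have := hmin hs
    simp only [mem_ofPred_eq, real_inner_smul_left, mul_pow, integral_const_mul] at this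
    rw [← le_div_iff₀ (by positivity)]
    refine this.trans (le_of_eq ?_)
    field_simp
  set V := μ.real univ with hV
  have hV0 : 0 ≤ V := measureReal_nonneg
  -- Moving from `x₀` to `x` keeps half of the form, so `c / 2`, and costs at most `‖x - x₀‖ ^ 2 * V
  -- * ‖a‖ ^ 2`. The radius makes this loss at most `c / 4`.
  refine ⟨c / 4, by positivity, Real.sqrt (c / (4 * (V + 1))), by positivity, fun x hx a => ?_⟩
  rw [Metric.mem_ball, dist_eq_norm] at hx
  have hx2 : ‖x - x₀‖ ^ 2 * V ≤ c / 4 := by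
    have h1 : ‖x - x₀‖ ^ 2 ≤ c / (4 * (V + 1)) := by
      rw [← Real.sq_sqrt (show 0 ≤ c / (4 * (V + 1)) by positivity)]
      gcongr
    calc ‖x - x₀‖ ^ 2 * V ≤ c / (4 * (V + 1)) * (V + 1) := by gcongr; linarith
      _ = c / 4 := by field_simp
  have hpt (y : E d) : 2⁻¹ * ⟪a, y - x₀⟫_ℝ ^ 2 - ‖a‖ ^ 2 * ‖x - x₀‖ ^ 2 ≤ ⟪a, y - x⟫_ℝ ^ 2 := by
    have h1 : ⟪a, y - x₀⟫_ℝ = ⟪a, y - x⟫_ℝ + ⟪a, x - x₀⟫_ℝ := by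
      rw [← inner_add_right]; congr 1; abel
    have h2 : ⟪a, x - x₀⟫_ℝ ^ 2 ≤ ‖a‖ ^ 2 * ‖x - x₀‖ ^ 2 := by
      rw [← mul_pow, ← sq_abs]
      gcongr
      exact abs_real_inner_le_norm _ _
    rw [h1]
    nlinarith [sq_nonneg (⟪a, y - x⟫_ℝ - ⟪a, x - x₀⟫_ℝ)]
  have hint' : Integrable (fun y => 2⁻¹ * ⟪a, y - x₀⟫_ℝ ^ 2 - ‖a‖ ^ 2 * ‖x - x₀‖ ^ 2) μ :=
    ((hint x₀ a).const_mul 2⁻¹).sub (integrable_const _)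
  have := integral_mono hint' (hint x a) hpt
  rw [integral_sub ((hint x₀ a).const_mul 2⁻¹) (integrable_const _), integral_const_mul,
    integral_const, smul_eq_mul, ← hV] at this
  have h3 := hcle a
  nlinarith [mul_le_mul_of_nonneg_left hx2 (sq_nonneg ‖a‖)]

/-- Reverses the segments between the ball and the boundary: the pointwise bound starts in the ball,
the surface estimate at the boundary. Reflection turns `(0, 1]` into `[0, 1)`, hence the passage
through the open interval. -/
theorem setLIntegral_Ioc_one_sub {f : ℝ → ℝ≥0∞} :
    ∫⁻ t in Ioc (0 : ℝ) 1, f (1 - t) = ∫⁻ t in Ioc (0 : ℝ) 1, f t := by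
  rw [← setLIntegral_congr (Ioo_ae_eq_Ioc (μ := volume) (a := (0 : ℝ)) (b := 1)),
    ← setLIntegral_congr (Ioo_ae_eq_Ioc (μ := volume) (a := (0 : ℝ)) (b := 1)),
    ← lintegral_indicator measurableSet_Ioo, ← lintegral_indicator measurableSet_Ioo,
    ← lintegral_sub_left_eq_self ((Ioo (0 : ℝ) 1).indicator f) 1]
  refine lintegral_congr fun t => ?_
  have : t ∈ Ioo (0 : ℝ) 1 ↔ 1 - t ∈ Ioo (0 : ℝ) 1 := by
    simp only [mem_Ioo]
    constructor <;> intro h <;> constructor <;> linarith [h.1, h.2]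
  by_cases h : t ∈ Ioo (0 : ℝ) 1
  · rw [indicator_of_mem h, indicator_of_mem (this.1 h)]
  · rw [indicator_of_notMem h, indicator_of_notMem (fun h' => h (this.2 h'))]

/-- Boundary values on a set of positive surface measure control the field on some ball. -/
theorem IsLipschitzDomain.exists_controlled_ball (hD : IsLipschitzDomain D) {G : Set (E d)}
    (hG : MeasurableSet G) (hGD : G ⊆ frontier D) (hpos : 0 < surface D G) :
    ∃ x₀ ∈ D, ∃ r > 0,
      Controlled D ((surface D).restrict G) (volume.restrict (Metric.ball x₀ r)) := by
  have := hD.isFiniteMeasure_surface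
  obtain ⟨z, hzG, hz⟩ := exists_mem_forall_mem_nhdsWithin_pos_measure hpos.ne'
  obtain ⟨η, θ, ρ, L, hθ, hρ, hne, hseg, hL⟩ := hD.exists_cone (hGD hzG)
  -- Half of `θ` is for points near `z + η` and half for boundary points near `z`, so that all their
  -- differences are admissible directions.
  set r₁ := min ρ (θ / 2) with hr₁
  have hr₁0 : 0 < r₁ := by positivity
  set S := G ∩ Metric.ball z r₁ with hS
  have hSm : MeasurableSet S := hG.inter measurableSet_ball
  have hSpos : 0 < surface D S :=
    hz S (inter_mem_nhdsWithin _ (Metric.ball_mem_nhds z hr₁0))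
  have hSf : S ⊆ frontier D ∩ Metric.ball z ρ := fun y hy =>
    ⟨hGD hy.1, Metric.ball_subset_ball (min_le_left _ _) hy.2⟩
  set μ := (surface D).restrict S with hμ
  have hμ0 : μ ≠ 0 := by
    rw [hμ, Ne, Measure.restrict_eq_zero]
    exact hSpos.ne'
  have hμac : μ ≪ (Measure.euclideanHausdorffMeasure (d - 1) : Measure (E d)) :=
    Measure.absolutelyContinuous_of_le (Measure.restrict_le_self.trans Measure.restrict_le_self)
  obtain ⟨x₀, hx₀, hx₀a⟩ := exists_mem_ball_forall_not_ae_inner_eq hμ0 hμac (z + η) hr₁0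
  have hμball : ∀ᵐ y ∂μ, y ∈ Metric.ball z r₁ := by
    filter_upwards [ae_restrict_mem hSm] with y hy using hy.2
  obtain ⟨c, hc, r₂, hr₂, hQ⟩ := exists_norm_sq_le_integral_inner_sq hμball hx₀a
  obtain ⟨r₃, hr₃, hball⟩ := Metric.isOpen_iff.1 Metric.isOpen_ball x₀ hx₀
  set r := min r₂ r₃ with hr
  have hr0 : 0 < r := by positivity
  set B := Metric.ball x₀ r with hB
  have hdir : ∀ x ∈ B, ∀ y ∈ S, x - y ∈ Metric.closedBall η θ := by
    intro x hx y hy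
    have h1 : x ∈ Metric.ball (z + η) r₁ := hball (Metric.ball_subset_ball (min_le_right _ _) hx)
    have h2 := hy.2
    rw [Metric.mem_ball, dist_eq_norm] at h1 h2
    rw [Metric.mem_closedBall, dist_eq_norm]
    have h3 : r₁ ≤ θ / 2 := min_le_right _ _
    calc ‖x - y - η‖ = ‖(x - (z + η)) - (y - z)‖ := by congr 1; abel
      _ ≤ ‖x - (z + η)‖ + ‖y - z‖ := norm_sub_le _ _
      _ ≤ θ := by linarith
  -- The closed ball of directions omits `0`. This gives a positive lower bound `m` for their
  -- lengths, needed because the surface estimate has the factor `‖ξ‖⁻¹`.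
  have hθη : θ < ‖η‖ := by
    by_contra! h
    exact hne 0 (by simpa using h) rfl
  set m : ℝ≥0 := (‖η‖ - θ).toNNReal with hm
  have hm0 : m ≠ 0 := by
    have : 0 < m := Real.toNNReal_pos.2 (by linarith)
    exact this.ne'
  have hmle : ∀ ξ ∈ Metric.closedBall η θ, m ≤ ‖ξ‖₊ := by
    intro ξ hξ
    rw [Metric.mem_closedBall, dist_eq_norm] at hξ
    rw [hm, Real.toNNReal_le_iff_le_coe, coe_nnnorm]
    have := norm_le_insert ξ η
    linarith
  set M : ℝ≥0 := ‖η‖₊ + θ.toNNReal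
  have hMle : ∀ ξ ∈ Metric.closedBall η θ, ‖ξ‖ ≤ M := by
    intro ξ hξ
    rw [Metric.mem_closedBall, dist_eq_norm] at hξ
    have h := norm_le_insert' ξ η
    simp only [M, NNReal.coe_add, coe_nnnorm, Real.coe_toNNReal _ hθ.le]
    linarith
  obtain ⟨y₁, hy₁⟩ : S.Nonempty := nonempty_of_measure_ne_zero hSpos.ne'
  have hx₀D : x₀ ∈ D := by
    have := hseg (x₀ - y₁) (hdir x₀ (Metric.mem_ball_self hr0) y₁ hy₁) y₁
      ⟨frontier_subset_closure (hGD hy₁.1), (hSf hy₁).2⟩ 1 (by simp)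
    simpa using this
  have hBvol : volume B ≠ ⊤ := measure_ball_lt_top.ne
  have hKvol : volume (Metric.closedBall η θ) ≠ ⊤ := measure_closedBall_lt_top.ne
  set K₀ : ℝ≥0 := 2 * M ^ 2 + 2 * M ^ 4
  set K₁ : ℝ≥0 := (volume B).toNNReal
  set K₂ : ℝ≥0 := (volume (Metric.closedBall η θ)).toNNReal
  set K₃ : ℝ≥0 := m⁻¹ * L ^ (d - 1)
  refine ⟨x₀, hx₀D, r, hr0, c.toNNReal⁻¹ * (K₀ * (K₁ + K₃ * K₂)), fun w hw => ?_⟩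
  have hn := measurable_enorm_sq hw
  have hs := measurable_strainDensity hw
  have hF : Measurable fun p : E d × E d =>
      ∫⁻ t in Ioc (0 : ℝ) 1, strainDensity w (p.2 + t • p.1) := by
    have : Measurable fun q : (E d × E d) × ℝ => strainDensity w (q.1.2 + q.2 • q.1.1) :=
      hs.comp (by fun_prop)
    exact this.lintegral_prod_right'
  have hF' : Measurable fun p : E d × E d =>
      ∫⁻ t in Ioc (0 : ℝ) 1, strainDensity w (p.2 + t • (p.1 - p.2)) := by
    have : Measurable fun q : (E d × E d) × ℝ => strainDensity w (q.1.2 + q.2 • (q.1.1 - q.1.2)) :=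
      hs.comp (by fun_prop)
    exact this.lintegral_prod_right'
  -- the lines that join the ball to the boundary portion
  have hlines : ∫⁻ x in B, (∫⁻ y, (∫⁻ t in Ioc (0 : ℝ) 1, strainDensity w (y + t • (x - y))) ∂μ) ≤
      K₃ * K₂ * ∫⁻ x in D, strainDensity w x := by
    rw [lintegral_lintegral_swap hF'.aemeasurable]
    -- For fixed `y` the variable `x` is replaced by the direction `ξ = x - y`. After a second
    -- exchange of integrals `ξ` is fixed while `y` runs over the boundary, as the surface estimate
    -- requires.
    calc ∫⁻ y, (∫⁻ x in B, ∫⁻ t in Ioc (0 : ℝ) 1, strainDensity w (y + t • (x - y))) ∂μ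
        ≤ ∫⁻ y, (∫⁻ ξ in Metric.closedBall η θ,
            ∫⁻ t in Ioc (0 : ℝ) 1, strainDensity w (y + t • ξ)) ∂μ := by
          refine setLIntegral_mono' hSm fun y hy => ?_
          rw [← lintegral_indicator measurableSet_ball,
            ← lintegral_indicator Metric.isClosed_closedBall.measurableSet,
            ← lintegral_add_right_eq_self _ y]
          refine lintegral_mono fun ξ => ?_
          by_cases h : ξ + y ∈ B
          · have h' : ξ ∈ Metric.closedBall η θ := by simpa using hdir _ h y hy
            rw [indicator_of_mem h, indicator_of_mem h', add_sub_cancel_right]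
          · rw [indicator_of_notMem h]
            exact zero_le
      _ = ∫⁻ ξ in Metric.closedBall η θ, (∫⁻ y,
            (∫⁻ t in Ioc (0 : ℝ) 1, strainDensity w (y + t • ξ)) ∂μ) := by
          exact lintegral_lintegral_swap (hF.comp measurable_swap).aemeasurable
      _ ≤ ∫⁻ _ξ in Metric.closedBall η θ, (K₃ * ∫⁻ x in D, strainDensity w x) := by
          refine setLIntegral_mono' Metric.isClosed_closedBall.measurableSet fun ξ hξ => ?_
          refine (setLIntegral_surface_lines_le hD.isOpen.measurableSet hSm
            (hSf.trans inter_subset_left) (hne ξ hξ)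
            (fun y hy y' hy' => hL ξ hξ y (hSf hy) y' (hSf hy'))
            (fun y hy => hseg ξ hξ y ⟨frontier_subset_closure (hSf hy).1, (hSf hy).2⟩) hs).trans ?_
          gcongr
          simp only [K₃]
          gcongr
          exact hmle ξ hξ
      _ = _ := by
          rw [setLIntegral_const, ← ENNReal.coe_toNNReal hKvol]
          ring
  have hpt : ∀ x ∈ B, ENNReal.ofReal c * ‖w x‖ₑ ^ 2 ≤ K₀ * ((∫⁻ y, ‖w y‖ₑ ^ 2 ∂μ) +
      ∫⁻ y, (∫⁻ t in Ioc (0 : ℝ) 1, strainDensity w (y + t • (x - y))) ∂μ) := by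
    intro x hx
    have h1 := hQ x (Metric.ball_subset_ball (min_le_left _ _) hx) (w x)
    have h2 : ENNReal.ofReal (∫ y, ⟪w x, y - x⟫_ℝ ^ 2 ∂μ) ≤
        ∫⁻ y, ENNReal.ofReal (⟪w x, y - x⟫_ℝ ^ 2) ∂μ := by
      by_cases hi : Integrable (fun y => ⟪w x, y - x⟫_ℝ ^ 2) μ
      · exact (ofReal_integral_eq_lintegral_ofReal hi
          (Eventually.of_forall fun _ => sq_nonneg _)).le
      · simp [integral_undef hi]
    rw [← ofReal_norm, ← ENNReal.ofReal_pow (norm_nonneg _), ← ENNReal.ofReal_mul hc.le]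
    refine (ENNReal.ofReal_le_ofReal h1).trans (h2.trans ?_)
    have hFx : Measurable fun y => ∫⁻ t in Ioc (0 : ℝ) 1, strainDensity w (y + t • (x - y)) := by
      have : Measurable fun q : E d × ℝ => strainDensity w (q.1 + q.2 • (x - q.1)) :=
        hs.comp (by fun_prop)
      exact this.lintegral_prod_right'
    have hadd : Measurable fun y => ‖w y‖ₑ ^ 2 +
        ∫⁻ t in Ioc (0 : ℝ) 1, strainDensity w (y + t • (x - y)) := hn.add hFx
    rw [← lintegral_add_left hn, ← lintegral_const_mul _ hadd]
    refine setLIntegral_mono' hSm fun y hy => ?_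
    have hyx : ‖y - x‖ ≤ M := by
      rw [norm_sub_rev]
      exact hMle _ (hdir x hx y hy)
    have h3 := inner_sq_le_line_of_norm_le hw x hyx (s := 1) (by simp)
    rw [one_smul, add_sub_cancel] at h3
    refine h3.trans (le_of_eq ?_)
    congr 2
    rw [← setLIntegral_Ioc_one_sub]
    refine lintegral_congr fun t => ?_
    congr 1
    module
  have hcalc : ENNReal.ofReal c * ∫⁻ x in B, ‖w x‖ₑ ^ 2 ≤
      ((K₀ * (K₁ + K₃ * K₂) : ℝ≥0) : ℝ≥0∞) * ((∫⁻ x in D, strainDensity w x) +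
        ∫⁻ x in G, ‖w x‖ₑ ^ 2 ∂surface D) := by
    rw [← lintegral_const_mul _ hn]
    calc ∫⁻ x in B, ENNReal.ofReal c * ‖w x‖ₑ ^ 2
        ≤ ∫⁻ x in B, K₀ * ((∫⁻ y, ‖w y‖ₑ ^ 2 ∂μ) +
          ∫⁻ y, (∫⁻ t in Ioc (0 : ℝ) 1, strainDensity w (y + t • (x - y))) ∂μ) :=
          setLIntegral_mono' measurableSet_ball hpt
      _ = K₀ * (K₁ * (∫⁻ y, ‖w y‖ₑ ^ 2 ∂μ) + ∫⁻ x in B, (∫⁻ y,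
            (∫⁻ t in Ioc (0 : ℝ) 1, strainDensity w (y + t • (x - y))) ∂μ)) := by
          rw [lintegral_const_mul' _ _ ENNReal.coe_ne_top, lintegral_add_left measurable_const,
            setLIntegral_const, mul_comm (K₁ : ℝ≥0∞), ENNReal.coe_toNNReal hBvol]
      _ ≤ K₀ * (K₁ * (∫⁻ x in G, ‖w x‖ₑ ^ 2 ∂surface D) +
            K₃ * K₂ * ∫⁻ x in D, strainDensity w x) := by
          have hμle : μ ≤ (surface D).restrict G :=
            Measure.restrict_mono inter_subset_left le_rfl
          gcongr
      _ ≤ _ := by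
          push_cast
          rw [mul_assoc (K₀ : ℝ≥0∞) (_ + _)]
          refine mul_le_mul' le_rfl ?_
          rw [add_mul]
          exact add_le_add (mul_le_mul' le_rfl le_add_self) (mul_le_mul' le_rfl le_self_add)
  have hc0 : c.toNNReal ≠ 0 := (Real.toNNReal_pos.2 hc).ne'
  rw [ENNReal.coe_mul, mul_assoc, ENNReal.coe_inv hc0, mul_comm (ENNReal.ofNNReal _)⁻¹,
    ← div_eq_mul_inv, ENNReal.le_div_iff_mul_le (by simp [hc0]) (by simp), mul_comm]
  exact hcalc

/-- **Korn's inequality**: a smooth field is controlled by its strain and by its values on a part of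
the boundary with positive surface measure. -/
theorem IsLipschitzDomain.controlled (hD : IsLipschitzDomain D) {G : Set (E d)}
    (hG : MeasurableSet G) (hGD : G ⊆ frontier D) (hpos : 0 < surface D G) :
    Controlled D ((surface D).restrict G) (volume.restrict D) := by
  set β := (surface D).restrict G
  have hDm : MeasurableSet D := hD.isOpen.measurableSet
  obtain ⟨x₀, hx₀, r₀, hr₀, hx₀c⟩ := hD.exists_controlled_ball hG hGD hpos
  -- Points with a controlled ball form an open set that meets `D`. By `Controlled.shift` it is also
  -- relatively closed in `D`, so connectedness gives `D ⊆ U`.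
  set U : Set (E d) := {x | ∃ r > 0, Controlled D β (volume.restrict (Metric.ball x r))} with hU
  have hUo : IsOpen U := by
    rw [Metric.isOpen_iff]
    rintro x ⟨r, hr, hxc⟩
    refine ⟨r, hr, fun y hy => ⟨r - dist y x, by simpa using hy, hxc.restrict_mono ?_⟩⟩
    exact Metric.ball_subset_ball' (by linarith)
  have hDU : D ⊆ U := by
    refine hD.isConnected.isPreconnected.subset_of_closure_inter_subset hUo
      ⟨x₀, hx₀, r₀, hr₀, hx₀c⟩ ?_
    rintro x ⟨hxU, hxD⟩
    obtain ⟨R, hR, hRD⟩ := Metric.isOpen_iff.1 hD.isOpen x hxD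
    obtain ⟨y, ⟨s, hs, hyc⟩, hy⟩ := Metric.mem_closure_iff.1 hxU (R / 2) (by positivity)
    -- The bound `R / 4`, used for the position and for the direction, keeps the segments in the
    -- ball of radius `R`, since `‖y - x‖ < R / 2`. The bound `s / 2` makes them end in the
    -- controlled ball at `y`.
    set r := min (s / 2) (R / 4) with hr
    have hr0 : 0 < r := by positivity
    have hrs : r ≤ s / 2 := min_le_left _ _
    have hrR : r ≤ R / 4 := min_le_right _ _
    refine ⟨r, hr0, Controlled.shift hDm measurableSet_ball measurableSet_ball hr0
      (η := y - x) ?_ ?_ hyc⟩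
    · intro ξ hξ x' hx' t ht
      apply hRD
      rw [Metric.mem_closedBall, dist_eq_norm] at hξ
      rw [Metric.mem_ball, dist_eq_norm] at hx' ⊢
      rw [dist_comm, dist_eq_norm] at hy
      have h1 : ‖ξ‖ ≤ r + ‖y - x‖ := by
        have := norm_le_insert' ξ (y - x)
        linarith
      have h2 : ‖t • ξ‖ ≤ ‖ξ‖ := by
        rw [norm_smul, Real.norm_eq_abs, abs_of_pos ht.1]
        exact mul_le_of_le_one_left (norm_nonneg _) ht.2
      calc ‖x' + t • ξ - x‖ = ‖(x' - x) + t • ξ‖ := by congr 1; abel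
        _ ≤ ‖x' - x‖ + ‖t • ξ‖ := norm_add_le _ _
        _ < R := by linarith
    · intro ξ hξ x' hx'
      rw [Metric.mem_closedBall, dist_eq_norm] at hξ
      rw [Metric.mem_ball, dist_eq_norm] at hx' ⊢
      calc ‖x' + ξ - y‖ = ‖(x' - x) + (ξ - (y - x))‖ := by congr 1; abel
        _ ≤ ‖x' - x‖ + ‖ξ - (y - x)‖ := norm_add_le _ _
        _ < s := by linarith
  have hcomp : IsCompact (closure D) := hD.isBounded.isCompact_closure
  suffices h : Controlled D β ((volume.restrict D).restrict (closure D)) by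
    rwa [Measure.restrict_restrict isClosed_closure.measurableSet,
      inter_eq_right.2 subset_closure] at h
  refine Controlled.of_isCompact hcomp fun z hz => ?_
  by_cases hzD : z ∈ D
  · obtain ⟨r, hr, hc⟩ := hDU hzD
    refine ⟨r, hr, hc.mono ?_⟩
    rw [Measure.restrict_restrict (isClosed_closure.measurableSet.inter measurableSet_ball)]
    exact Measure.restrict_mono (fun x hx => hx.1.2) le_rfl
  · have hzf : z ∈ frontier D := by
      rw [hD.isOpen.frontier_eq]
      exact ⟨hz, hzD⟩
    obtain ⟨η, θ, ρ, L, hθ, hρ, hne, hseg, hL⟩ := hD.exists_cone hzf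
    have hη : η ∈ Metric.closedBall η θ := Metric.mem_closedBall_self hθ.le
    -- Near the boundary, control is pulled back along the interior cone from a ball around `z + η`.
    have hzη : z + η ∈ D := by
      simpa using hseg η hη z ⟨hz, Metric.mem_ball_self hρ⟩ 1 (by simp)
    obtain ⟨s, hs, hc⟩ := hDU hzη
    set r := min ρ (s / 2) with hr
    have hr0 : 0 < r := by positivity
    refine ⟨r, hr0, ?_⟩
    rw [Measure.restrict_restrict (isClosed_closure.measurableSet.inter measurableSet_ball)]
    set κ := min θ (s / 2) with hκ
    have hκ0 : 0 < κ := by positivity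
    refine Controlled.shift hDm
      ((isClosed_closure.measurableSet.inter measurableSet_ball).inter hDm) measurableSet_ball hκ0
      (η := η) ?_ ?_ hc
    · intro ξ hξ x hx t ht
      exact hseg ξ (Metric.closedBall_subset_closedBall (min_le_left _ _) hξ) x
        ⟨hx.1.1, Metric.ball_subset_ball (min_le_left _ _) hx.1.2⟩ t ht
    · intro ξ hξ x hx
      have h1 := hx.1.2
      have h2 : κ ≤ s / 2 := min_le_right _ _
      have h3 : r ≤ s / 2 := min_le_right _ _
      rw [Metric.mem_closedBall, dist_eq_norm] at hξ
      rw [Metric.mem_ball, dist_eq_norm] at h1 ⊢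
      calc ‖x + ξ - (z + η)‖ = ‖(x - z) + (ξ - η)‖ := by congr 1; abel
        _ ≤ ‖x - z‖ + ‖ξ - η‖ := norm_add_le _ _
        _ < s := by linarith

end Korn

/-! ### Korn's inequality in `V_D` -/

section SobolevKorn

variable {d : ℕ} {D : Set (E d)}

theorem tendsto_lintegral_enorm_sq_of_eLpNorm {X F : Type*} [MeasurableSpace X]
    [NormedAddCommGroup F] {μ : Measure X} {f : ℕ → X → F}
    (h : Tendsto (fun n => eLpNorm (f n) 2 μ) atTop (𝓝 0)) :
    Tendsto (fun n => ∫⁻ x, ‖f n x‖ₑ ^ 2 ∂μ) atTop (𝓝 0) := by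
  have heq (g : X → F) : ∫⁻ x, ‖g x‖ₑ ^ 2 ∂μ = eLpNorm g 2 μ ^ 2 := by
    have := eLpNorm_nnreal_pow_eq_lintegral (f := g) (μ := μ) (p := 2) two_ne_zero
    simpa using this.symm
  simp_rw [heq]
  simpa using ENNReal.Tendsto.pow (n := 2) h

theorem enorm_sq_le_two_mul {F : Type*} [NormedAddCommGroup F] (a b : F) :
    ‖a‖ₑ ^ 2 ≤ 2 * ‖b‖ₑ ^ 2 + 2 * ‖b - a‖ₑ ^ 2 := by
  have h : ‖a‖ ^ 2 ≤ 2 * ‖b‖ ^ 2 + 2 * ‖b - a‖ ^ 2 := by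
    have h1 : ‖a‖ ≤ ‖b‖ + ‖b - a‖ := by
      have := norm_sub_le b (b - a)
      rwa [sub_sub_cancel] at this
    nlinarith [sq_nonneg (‖b‖ - ‖b - a‖), norm_nonneg a]
  have := ENNReal.ofReal_le_ofReal h
  rw [ENNReal.ofReal_add (by positivity) (by positivity), ENNReal.ofReal_mul (by norm_num),
    ENNReal.ofReal_mul (by norm_num)] at this
  simpa [ENNReal.ofReal_pow, ofReal_norm] using this

/-- The two strains differ by the symmetrized gradient error, so `(a + b) ^ 2 ≤ 2 a ^ 2 + 2 b ^ 2`
applies. The factor `4` is not sharp: the second term only has to vanish along an approximating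
sequence. -/
theorem strainDensity_le (v : H1 D) (w : E d → E d) (x : E d) :
    strainDensity w x ≤ 2 * ENNReal.ofReal (ddot (v.strain x) (v.strain x)) +
      4 * ∑ i, ∑ j, ‖fderiv ℝ w x (EuclideanSpace.single j 1) i - v.jac x i j‖ₑ ^ 2 := by
  set A : Fin d → Fin d → ℝ := fun i j =>
    fderiv ℝ w x (EuclideanSpace.single j 1) i - v.jac x i j with hA
  have hreal : ddot (smoothStrain w x) (smoothStrain w x) ≤
      2 * ddot (v.strain x) (v.strain x) + 4 * ∑ i, ∑ j, A i j ^ 2 := by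
    have hswap : ∑ i, ∑ j, A j i ^ 2 = ∑ i, ∑ j, A i j ^ 2 := Finset.sum_comm
    have h4 : 4 * ∑ i, ∑ j, A i j ^ 2 =
        2 * ∑ i, ∑ j, A i j ^ 2 + 2 * ∑ i, ∑ j, A j i ^ 2 := by
      rw [hswap]; ring
    rw [h4]
    simp only [ddot, Finset.mul_sum, ← Finset.sum_add_distrib]
    refine Finset.sum_le_sum fun i _ => Finset.sum_le_sum fun j _ => ?_
    have h : smoothStrain w x i j = v.strain x i j + 2⁻¹ * (A i j + A j i) := by
      simp only [smoothStrain, H1.strain, Matrix.of_apply, Matrix.smul_apply, Matrix.add_apply,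
        Matrix.transpose_apply, smul_eq_mul, hA]
      ring
    rw [h]
    nlinarith [sq_nonneg (v.strain x i j - 2⁻¹ * (A i j + A j i)), sq_nonneg (A i j - A j i),
      sq_nonneg (A i j), sq_nonneg (A j i)]
  refine (ENNReal.ofReal_le_ofReal hreal).trans ?_
  have hs0 : 0 ≤ ∑ i, ∑ j, A i j ^ 2 :=
    Finset.sum_nonneg fun _ _ => Finset.sum_nonneg fun _ _ => sq_nonneg _
  rw [ENNReal.ofReal_add (mul_nonneg zero_le_two (ddot_self_nonneg _)) (by positivity),
    ENNReal.ofReal_mul zero_le_two, ENNReal.ofReal_mul (by norm_num), ENNReal.ofReal_ofNat,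
    ENNReal.ofReal_ofNat,
    ENNReal.ofReal_sum_of_nonneg fun _ _ => Finset.sum_nonneg fun _ _ => sq_nonneg _]
  gcongr with i
  rw [ENNReal.ofReal_sum_of_nonneg fun _ _ => sq_nonneg _]
  gcongr with j
  rw [← ofReal_norm, ← ENNReal.ofReal_pow (norm_nonneg _), Real.norm_eq_abs, sq_abs]

theorem H1.memLp_strain (v : H1 D) (i j : Fin d) :
    MemLp (fun x => v.strain x i j) 2 (volume.restrict D) :=
  ((v.memLp_jac i j).add (v.memLp_jac j i)).const_mul 2⁻¹

theorem H1.integrable_ddot_strain (v w : H1 D) :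
    Integrable (fun x => ddot (v.strain x) (w.strain x)) (volume.restrict D) :=
  integrable_finsetSum _ fun i _ => integrable_finsetSum _ fun j _ =>
    (v.memLp_strain i j).integrable_mul (w.memLp_strain i j)

/-- The control of smooth fields passes to fields in `H^1` with vanishing trace on `G`. -/
theorem Controlled.lintegral_le {G : Set (E d)} {α : Measure (E d)}
    (h : Controlled D ((surface D).restrict G) α) :
    ∃ C : ℝ≥0, ∀ (v : H1 D), (∀ᵐ x ∂(surface D).restrict G, v.trace x = 0) →
      ∀ w : ℕ → E d → E d, (∀ n, ContDiff ℝ ∞ (w n)) →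
      (∀ i j : Fin d, Tendsto (fun n => eLpNorm (fun x => fderiv ℝ (w n) x
        (EuclideanSpace.single j 1) i - v.jac x i j) 2 (volume.restrict D)) atTop (𝓝 0)) →
      Tendsto (fun n => eLpNorm (fun x => w n x - v.trace x) 2 (surface D)) atTop (𝓝 0) →
      ∀ f : E d → E d, Tendsto (fun n => eLpNorm (fun x => w n x - f x) 2 α) atTop (𝓝 0) →
      ∫⁻ x, ‖f x‖ₑ ^ 2 ∂α ≤
        C * ∫⁻ x in D, ENNReal.ofReal (ddot (v.strain x) (v.strain x)) := by
  obtain ⟨C, hC⟩ := h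
  refine ⟨4 * C, fun v hv w hw hjac htr f hf => ?_⟩
  set e := ∫⁻ x in D, ENNReal.ofReal (ddot (v.strain x) (v.strain x)) with he
  set J : ℕ → Fin d → Fin d → ℝ≥0∞ := fun n i j => ∫⁻ x in D,
    ‖fderiv ℝ (w n) x (EuclideanSpace.single j 1) i - v.jac x i j‖ₑ ^ 2 with hJ
  set T : ℕ → ℝ≥0∞ := fun n => ∫⁻ x, ‖w n x - v.trace x‖ₑ ^ 2 ∂surface D with hT
  set F : ℕ → ℝ≥0∞ := fun n => ∫⁻ x, ‖w n x - f x‖ₑ ^ 2 ∂α with hF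
  have hJ0 (i j) : Tendsto (fun n => J n i j) atTop (𝓝 0) :=
    tendsto_lintegral_enorm_sq_of_eLpNorm (hjac i j)
  have hT0 : Tendsto T atTop (𝓝 0) := tendsto_lintegral_enorm_sq_of_eLpNorm htr
  have hF0 : Tendsto F atTop (𝓝 0) := tendsto_lintegral_enorm_sq_of_eLpNorm hf
  have hstr (n) : ∫⁻ x in D, strainDensity (w n) x ≤ 2 * e + 4 * ∑ i, ∑ j, J n i j := by
    have hm (i j) : AEMeasurable (fun x => ‖fderiv ℝ (w n) x (EuclideanSpace.single j 1) i -
        v.jac x i j‖ₑ ^ 2) (volume.restrict D) := by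
      have h1 : Continuous fun x => fderiv ℝ (w n) x (EuclideanSpace.single j 1) :=
        ((hw n).continuous_fderiv (by simp)).clm_apply continuous_const
      have h2 : Continuous fun x => fderiv ℝ (w n) x (EuclideanSpace.single j 1) i := by fun_prop
      have h3 := (h2.aestronglyMeasurable.sub (v.memLp_jac i j).1).enorm
      exact h3.pow_const 2
    have hme : AEMeasurable (fun x => ENNReal.ofReal (ddot (v.strain x) (v.strain x)))
        (volume.restrict D) :=
      (v.integrable_ddot_strain v).1.aemeasurable.ennreal_ofReal
    refine (lintegral_mono fun x => strainDensity_le v (w n) x).trans (le_of_eq ?_)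
    have hmi (i) : AEMeasurable (fun x => ∑ j, ‖fderiv ℝ (w n) x (EuclideanSpace.single j 1) i -
        v.jac x i j‖ₑ ^ 2) (volume.restrict D) :=
      Finset.aemeasurable_fun_sum _ fun j _ => hm i j
    rw [lintegral_add_left' (hme.const_mul 2), lintegral_const_mul'' _ hme,
      lintegral_const_mul'' _ (Finset.aemeasurable_fun_sum _ fun i _ => hmi i),
      lintegral_finsetSum' _ fun i _ => hmi i]
    simp_rw [lintegral_finsetSum' _ fun j _ => hm _ j]
    rfl
  -- The trace vanishes on `G`, so the boundary values of the approximations there are pure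
  -- approximation error.
  have hG (n) : ∫⁻ x in G, ‖w n x‖ₑ ^ 2 ∂surface D ≤ T n := by
    calc ∫⁻ x in G, ‖w n x‖ₑ ^ 2 ∂surface D
        = ∫⁻ x in G, ‖w n x - v.trace x‖ₑ ^ 2 ∂surface D := by
          refine lintegral_congr_ae ?_
          filter_upwards [hv] with x hx
          rw [hx, sub_zero]
      _ ≤ T n := setLIntegral_le_lintegral _ _
  have hle (n) : ∫⁻ x, ‖f x‖ₑ ^ 2 ∂α ≤ ((4 * C : ℝ≥0) : ℝ≥0∞) * e +
      (2 * C * (4 * ∑ i, ∑ j, J n i j + T n) + 2 * F n) := by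
    calc ∫⁻ x, ‖f x‖ₑ ^ 2 ∂α
        ≤ ∫⁻ x, (2 * ‖w n x‖ₑ ^ 2 + 2 * ‖w n x - f x‖ₑ ^ 2) ∂α :=
          lintegral_mono fun x => enorm_sq_le_two_mul _ _
      _ = 2 * (∫⁻ x, ‖w n x‖ₑ ^ 2 ∂α) + 2 * F n := by
          have hm := measurable_enorm_sq (hw n)
          rw [lintegral_add_left (hm.const_mul 2), lintegral_const_mul _ hm,
            lintegral_const_mul' _ _ (by simp)]
      _ ≤ 2 * (C * ((2 * e + 4 * ∑ i, ∑ j, J n i j) + T n)) + 2 * F n := by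
          gcongr
          exact (hC (w n) (hw n)).trans (by gcongr; exacts [hstr n, hG n])
      _ = _ := by
          push_cast
          ring
  have hlim : Tendsto (fun n => ((4 * C : ℝ≥0) : ℝ≥0∞) * e +
      (2 * C * (4 * ∑ i, ∑ j, J n i j + T n) + 2 * F n)) atTop
      (𝓝 (((4 * C : ℝ≥0) : ℝ≥0∞) * e + (2 * C * (4 * ∑ _i : Fin d, ∑ _j : Fin d, 0 + 0) +
        2 * 0))) := by
    refine tendsto_const_nhds.add (Tendsto.add ?_ ?_)
    · refine ENNReal.Tendsto.const_mul ?_ (Or.inr (by finiteness))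
      refine Tendsto.add ?_ hT0
      refine ENNReal.Tendsto.const_mul ?_ (Or.inr (by finiteness))
      exact tendsto_finsetSum _ fun i _ => tendsto_finsetSum _ fun j _ => hJ0 i j
    · exact ENNReal.Tendsto.const_mul hF0 (Or.inr (by finiteness))
  have := ge_of_tendsto' hlim hle
  simpa using this

/-- The square of the `L^2` norm of the strain. -/
def H1.energy (v : H1 D) : ℝ := ∫ x in D, ddot (v.strain x) (v.strain x)

theorem H1.energy_nonneg (v : H1 D) : 0 ≤ v.energy :=
  integral_nonneg fun _ => ddot_self_nonneg _

theorem integral_norm_sq_le_of_lintegral {X F : Type*} [MeasurableSpace X] [NormedAddCommGroup F]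
    {μ : Measure X} {f : X → F} (hf : MemLp f 2 μ) {c : ℝ} (hc : 0 ≤ c)
    (h : ∫⁻ x, ‖f x‖ₑ ^ 2 ∂μ ≤ ENNReal.ofReal c) : ∫ x, ‖f x‖ ^ 2 ∂μ ≤ c := by
  rw [← ENNReal.ofReal_le_ofReal_iff hc]
  rw [ofReal_integral_eq_lintegral_ofReal hf.norm.integrable_sq
    (Eventually.of_forall fun _ => sq_nonneg _)]
  refine le_trans (le_of_eq (lintegral_congr fun x => ?_)) h
  rw [ENNReal.ofReal_pow (norm_nonneg _), ofReal_norm]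

/-- **Korn's inequality** in `V_D`, with the norms of the values in `D` and on the boundary. -/
theorem Problem.Admissible.exists_korn {P : Problem d} (hP : P.Admissible) :
    ∃ C : ℝ, 0 ≤ C ∧ ∀ v ∈ P.VD, (∫ x in P.D, ‖v.val x‖ ^ 2) ≤ C * v.energy ∧
      (∫ x, ‖v.trace x‖ ^ 2 ∂surface P.D) ≤ C * v.energy := by
  have hsub : P.bdD ⊆ frontier P.D := by
    rw [← hP.boundary]
    exact fun x hx => Or.inl (Or.inl (Or.inl hx))
  have h1 := hP.lipschitz.controlled hP.measurable_bdD hsub hP.bdD_pos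
  have h2 := hP.lipschitz.controlled_surface h1
  obtain ⟨C₁, hC₁⟩ := h1.lintegral_le
  obtain ⟨C₂, hC₂⟩ := h2.lintegral_le
  refine ⟨max C₁ C₂, by positivity, fun v hv => ?_⟩
  -- One sequence approximates the values, the Jacobian and the trace at once, and serves both
  -- estimates.
  obtain ⟨w, hw, hval, hjac, htr⟩ := v.isTrace
  have he : ∫⁻ x in P.D, ENNReal.ofReal (ddot (v.strain x) (v.strain x)) =
      ENNReal.ofReal v.energy :=
    (ofReal_integral_eq_lintegral_ofReal (v.integrable_ddot_strain v)
      (Eventually.of_forall fun _ => ddot_self_nonneg _)).symm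
  have key (C : ℝ≥0) (hC : C ≤ max C₁ C₂) :
      (C : ℝ≥0∞) * ENNReal.ofReal v.energy ≤ ENNReal.ofReal (max (C₁ : ℝ) C₂ * v.energy) := by
    rw [ENNReal.ofReal_mul (by positivity)]
    gcongr
    rw [← ENNReal.ofReal_coe_nnreal]
    exact ENNReal.ofReal_le_ofReal (by exact_mod_cast hC)
  have hnn : 0 ≤ max (C₁ : ℝ) C₂ * v.energy := mul_nonneg (by positivity) v.energy_nonneg
  constructor
  · refine integral_norm_sq_le_of_lintegral v.memLp_val hnn ?_
    refine (hC₁ v hv.1 w hw hjac htr v.val hval).trans ?_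
    rw [he]
    exact key C₁ (le_max_left _ _)
  · refine integral_norm_sq_le_of_lintegral v.memLp_trace hnn ?_
    refine (hC₂ v hv.1 w hw hjac htr v.trace htr).trans ?_
    rw [he]
    exact key C₂ (le_max_right _ _)

end SobolevKorn

/-! ### Differences of elements of `H^1` -/

section Sub

variable {d : ℕ} {D : Set (E d)}

theorem tendsto_eLpNorm_sub_sub {X F : Type*} [MeasurableSpace X] [NormedAddCommGroup F]
    {μ : Measure X} {f g : ℕ → X → F} {f₀ g₀ : X → F}
    (hf : ∀ n, AEStronglyMeasurable (fun x => f n x - f₀ x) μ)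
    (hg : ∀ n, AEStronglyMeasurable (fun x => g n x - g₀ x) μ)
    (h : Tendsto (fun n => eLpNorm (fun x => f n x - f₀ x) 2 μ) atTop (𝓝 0))
    (h' : Tendsto (fun n => eLpNorm (fun x => g n x - g₀ x) 2 μ) atTop (𝓝 0)) :
    Tendsto (fun n => eLpNorm (fun x => (f n x - g n x) - (f₀ x - g₀ x)) 2 μ) atTop (𝓝 0) := by
  have hsum := h.add h'
  rw [add_zero] at hsum
  refine tendsto_of_tendsto_of_tendsto_of_le_of_le tendsto_const_nhds hsum
    (fun _ => zero_le) fun n => ?_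
  refine le_trans (le_of_eq ?_) (eLpNorm_sub_le (hf n) (hg n) (by norm_num))
  congr 1
  ext x
  simp only [Pi.sub_apply]
  abel

theorem IsWeakJacobian.sub {u v : E d → E d} {G H : E d → Matrix (Fin d) (Fin d) ℝ}
    (hu : MemLp u 2 (volume.restrict D)) (hv : MemLp v 2 (volume.restrict D))
    (hG : ∀ i j, MemLp (fun x => G x i j) 2 (volume.restrict D))
    (hH : ∀ i j, MemLp (fun x => H x i j) 2 (volume.restrict D))
    (h : IsWeakJacobian D u G) (h' : IsWeakJacobian D v H) :
    IsWeakJacobian D (fun x => u x - v x) (fun x => G x - H x) := by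
  intro ψ hψ hc hs i j
  have hψm : MemLp ψ 2 (volume.restrict D) :=
    hψ.continuous.memLp_of_hasCompactSupport hc
  have hψ'c : Continuous fun x => fderiv ℝ ψ x (EuclideanSpace.single j 1) :=
    (hψ.continuous_fderiv (by simp)).clm_apply continuous_const
  have hψ'm : MemLp (fun x => fderiv ℝ ψ x (EuclideanSpace.single j 1)) 2 (volume.restrict D) :=
    hψ'c.memLp_of_hasCompactSupport (hc.fderiv_apply ℝ _)
  have hcoord {f : E d → E d} (hf : MemLp f 2 (volume.restrict D)) :
      MemLp (fun x => f x i) 2 (volume.restrict D) :=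
    (EuclideanSpace.proj (𝕜 := ℝ) i).comp_memLp' hf
  have e1 := h ψ hψ hc hs i j
  have e2 := h' ψ hψ hc hs i j
  simp only [PiLp.sub_apply, Matrix.sub_apply, sub_mul]
  have hI {f g : E d → ℝ} (hf : MemLp f 2 (volume.restrict D))
      (hg : MemLp g 2 (volume.restrict D)) :
      Integrable (fun x => f x * g x) (volume.restrict D) := hf.integrable_mul hg
  rw [integral_sub (hI (hcoord hu) hψ'm) (hI (hcoord hv) hψ'm),
    integral_sub (hI (hG i j) hψm) (hI (hH i j) hψm), e1, e2]
  ring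

theorem IsTrace.sub {u v g k : E d → E d} {G H : E d → Matrix (Fin d) (Fin d) ℝ}
    (hu : MemLp u 2 (volume.restrict D)) (hv : MemLp v 2 (volume.restrict D))
    (hG : ∀ i j, MemLp (fun x => G x i j) 2 (volume.restrict D))
    (hH : ∀ i j, MemLp (fun x => H x i j) 2 (volume.restrict D))
    (hg : MemLp g 2 (surface D)) (hk : MemLp k 2 (surface D))
    (h : IsTrace D u G g) (h' : IsTrace D v H k) :
    IsTrace D (fun x => u x - v x) (fun x => G x - H x) (fun x => g x - k x) := by
  obtain ⟨w, hw, hwu, hwG, hwg⟩ := h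
  obtain ⟨z, hz, hzv, hzH, hzk⟩ := h'
  have hc {w : E d → E d} (hw : ContDiff ℝ ∞ w) (i j : Fin d) :
      Continuous fun x => fderiv ℝ w x (EuclideanSpace.single j 1) i := by
    have : Continuous fun x => fderiv ℝ w x (EuclideanSpace.single j 1) :=
      (hw.continuous_fderiv (by simp)).clm_apply continuous_const
    fun_prop
  refine ⟨fun n x => w n x - z n x, fun n => (hw n).sub (hz n), ?_, fun i j => ?_, ?_⟩
  · exact tendsto_eLpNorm_sub_sub
      (fun n => (hw n).continuous.aestronglyMeasurable.sub hu.1)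
      (fun n => (hz n).continuous.aestronglyMeasurable.sub hv.1) hwu hzv
  · have := tendsto_eLpNorm_sub_sub
      (fun n => (hc (hw n) i j).aestronglyMeasurable.sub (hG i j).1)
      (fun n => (hc (hz n) i j).aestronglyMeasurable.sub (hH i j).1) (hwG i j) (hzH i j)
    refine this.congr fun n => ?_
    congr 1
    ext x
    rw [fderiv_fun_sub ((hw n).differentiable (by simp) x) ((hz n).differentiable (by simp) x)]
    simp
  · exact tendsto_eLpNorm_sub_sub
      (fun n => (hw n).continuous.aestronglyMeasurable.sub hg.1)
      (fun n => (hz n).continuous.aestronglyMeasurable.sub hk.1) hwg hzk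

/-- The difference of two elements of `H^1`. -/
def H1.sub (u v : H1 D) : H1 D where
  val x := u.val x - v.val x
  jac x := u.jac x - v.jac x
  trace x := u.trace x - v.trace x
  memLp_val := u.memLp_val.sub v.memLp_val
  memLp_jac i j := (u.memLp_jac i j).sub (v.memLp_jac i j)
  memLp_trace := u.memLp_trace.sub v.memLp_trace
  isWeakJacobian := IsWeakJacobian.sub u.memLp_val v.memLp_val u.memLp_jac v.memLp_jac
    u.isWeakJacobian v.isWeakJacobian
  isTrace := IsTrace.sub u.memLp_val v.memLp_val u.memLp_jac v.memLp_jac u.memLp_trace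
    v.memLp_trace u.isTrace v.isTrace

theorem H1.strain_sub (u v : H1 D) (x : E d) :
    (u.sub v).strain x = u.strain x - v.strain x := by
  ext i j
  simp only [H1.strain, H1.sub, Matrix.transpose_sub, Matrix.smul_apply, Matrix.add_apply,
    Matrix.sub_apply, smul_eq_mul, Matrix.transpose_apply]
  ring

theorem Problem.tang_sub (P : Problem d) (u v : H1 P.D) (x : E d) :
    P.tang (u.sub v) x = P.tang u x - P.tang v x := by
  simp [Problem.tang, H1.sub, inner_sub_left]

theorem Problem.sub_mem_VD (P : Problem d) {u v : H1 P.D} (hu : u ∈ P.VD) (hv : v ∈ P.VD) :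
    u.sub v ∈ P.VD := by
  constructor
  · filter_upwards [hu.1, hv.1] with x h1 h2
    simp [H1.sub, h1, h2]
  · filter_upwards [hu.2, hv.2] with x h1 h2
    simp [H1.sub, inner_sub_left, h1, h2]

end Sub

/-! ### Taylor remainders -/

section Taylor

/-- Mean value inequality on the ball of radius `‖h‖` around `x`, where the derivative deviates from
its value at `x` by at most `K * ‖h‖`. -/
theorem norm_taylor_le {F G : Type*} [NormedAddCommGroup F] [NormedSpace ℝ F]
    [NormedAddCommGroup G] [NormedSpace ℝ G] {f : F → G} (hf : Differentiable ℝ f) {K : ℝ}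
    (hK : ∀ x y, ‖fderiv ℝ f x - fderiv ℝ f y‖ ≤ K * ‖x - y‖) (x h : F) :
    ‖f (x + h) - f x - fderiv ℝ f x h‖ ≤ K * ‖h‖ ^ 2 := by
  rcases eq_or_ne h 0 with rfl | hh
  · simp
  have hK0 : 0 ≤ K := by
    have := (norm_nonneg _).trans (hK (x + h) x)
    rw [add_sub_cancel_left] at this
    exact nonneg_of_mul_nonneg_left this (norm_pos_iff.2 hh)
  have := (convex_closedBall x ‖h‖).norm_image_sub_le_of_norm_hasFDerivWithin_le' (f := f)
    (f' := fderiv ℝ f) (φ := fderiv ℝ f x) (C := K * ‖h‖) (x := x) (y := x + h)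
    (fun y _ => (hf y).hasFDerivAt.hasFDerivWithinAt)
    (fun y hy => (hK y x).trans (by
      rw [Metric.mem_closedBall, dist_eq_norm] at hy
      gcongr)) (by simp) (by simp)
  rw [add_sub_cancel_left] at this
  linarith

/-- Localized to `[-R, R]`, because derivatives of powers are Lipschitz only on bounded sets. -/
theorem abs_taylor_le_of_abs_le {f f' : ℝ → ℝ} {s R K : ℝ}
    (hf : ∀ t, HasDerivAt f (f' t) t)
    (hK : ∀ x, |x| ≤ R → |f' x - f' s| ≤ K * |x - s|) (hK0 : 0 ≤ K) (hs : |s| ≤ R) {t : ℝ}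
    (ht : |t| ≤ R) : |f t - f s - f' s * (t - s)| ≤ K * |t - s| ^ 2 := by
  have hg (x : ℝ) : HasDerivAt (fun x => f x - f' s * x) (f' x - f' s) x := by
    simpa using (hf x).fun_sub ((hasDerivAt_id' x).const_mul (f' s))
  have hbd : ∀ x ∈ uIcc s t, |x| ≤ R ∧ |x - s| ≤ |t - s| := by
    intro x hx
    constructor
    · have := (convex_Icc (-R) R).ordConnected.uIcc_subset (abs_le.1 hs) (abs_le.1 ht) hx
      exact abs_le.2 this
    · exact abs_sub_left_of_mem_uIcc hx
  have := (convex_uIcc s t).norm_image_sub_le_of_norm_hasDerivWithin_le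
    (f := fun x => f x - f' s * x) (C := K * |t - s|) (fun x _ => (hg x).hasDerivWithinAt)
    (fun x hx => ((hK x (hbd x hx).1).trans (by
      have := (hbd x hx).2
      gcongr))) left_mem_uIcc right_mem_uIcc
  rw [Real.norm_eq_abs, Real.norm_eq_abs] at this
  calc |f t - f s - f' s * (t - s)| = |f t - f' s * t - (f s - f' s * s)| := by
        congr 1; ring
    _ ≤ K * |t - s| ^ 2 := by linarith

end Taylor

/-! ### Regularity of the friction potential -/

section Potential

/-- Bounded Lipschitz functions on the line. -/
def BddLip (f : ℝ → ℝ) : Prop :=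
  ∃ M : ℝ, 0 ≤ M ∧ (∀ s, |f s| ≤ M) ∧ ∀ s t, |f s - f t| ≤ M * |s - t|

theorem BddLip.const (c : ℝ) : BddLip fun _ => c :=
  ⟨|c|, abs_nonneg c, fun _ => le_rfl, fun s t => by
    rw [sub_self, abs_zero]; positivity⟩

theorem BddLip.add {f g : ℝ → ℝ} (hf : BddLip f) (hg : BddLip g) :
    BddLip fun s => f s + g s := by
  obtain ⟨M, hM, hf1, hf2⟩ := hf
  obtain ⟨N, hN, hg1, hg2⟩ := hg
  refine ⟨M + N, by positivity, fun s => (abs_add_le _ _).trans (add_le_add (hf1 s) (hg1 s)),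
    fun s t => ?_⟩
  calc |f s + g s - (f t + g t)| = |(f s - f t) + (g s - g t)| := by congr 1; ring
    _ ≤ |f s - f t| + |g s - g t| := abs_add_le _ _
    _ ≤ (M + N) * |s - t| := by rw [add_mul]; exact add_le_add (hf2 s t) (hg2 s t)

/-- A product of Lipschitz functions is Lipschitz when the factors are bounded; this is why the two
bounds are recorded together. -/
theorem BddLip.mul {f g : ℝ → ℝ} (hf : BddLip f) (hg : BddLip g) :
    BddLip fun s => f s * g s := by
  obtain ⟨M, hM, hf1, hf2⟩ := hf
  obtain ⟨N, hN, hg1, hg2⟩ := hg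
  refine ⟨2 * M * N, by positivity, fun s => ?_, fun s t => ?_⟩
  · rw [abs_mul]
    nlinarith [mul_le_mul (hf1 s) (hg1 s) (abs_nonneg _) hM, mul_nonneg hM hN]
  · calc |f s * g s - f t * g t| = |(f s - f t) * g s + f t * (g s - g t)| := by congr 1; ring
      _ ≤ |f s - f t| * |g s| + |f t| * |g s - g t| := by
        rw [← abs_mul, ← abs_mul]; exact abs_add_le _ _
      _ ≤ (M * |s - t|) * N + M * (N * |s - t|) :=
        add_le_add (mul_le_mul (hf2 s t) (hg1 s) (abs_nonneg _) (by positivity))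
          (mul_le_mul (hf1 t) (hg2 s t) (abs_nonneg _) hM)
      _ = 2 * M * N * |s - t| := by ring

theorem BddLip.continuous {f : ℝ → ℝ} (hf : BddLip f) : Continuous f := by
  obtain ⟨M, hM, -, h⟩ := hf
  have : LipschitzWith M.toNNReal f := LipschitzWith.of_dist_le_mul fun s t => by
    rw [Real.dist_eq, Real.dist_eq, Real.coe_toNNReal _ hM]
    exact h s t
  exact this.continuous

theorem BddLip.of_hasDerivAt {f f' : ℝ → ℝ} (hf : ∀ s, HasDerivAt f (f' s) s) {M N : ℝ}
    (hM : ∀ s, |f s| ≤ M) (hN : ∀ s, |f' s| ≤ N) : BddLip f := by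
  have hM0 : 0 ≤ M := (abs_nonneg _).trans (hM 0)
  have hN0 : 0 ≤ N := (abs_nonneg _).trans (hN 0)
  refine ⟨M + N, by positivity, fun s => (hM s).trans (by linarith), fun s t => ?_⟩
  have := convex_univ.norm_image_sub_le_of_norm_hasDerivWithin_le (f := f) (C := N)
    (fun x _ => (hf x).hasDerivWithinAt) (fun x _ => hN x) (mem_univ t) (mem_univ s)
  rw [Real.norm_eq_abs, Real.norm_eq_abs] at this
  nlinarith [abs_nonneg (s - t)]

/-- Two differentiable functions which agree to first order at `c` can be glued. -/
theorem hasDerivAt_ite_le {f g f' g' : ℝ → ℝ} {c : ℝ} (hf : ∀ s, HasDerivAt f (f' s) s)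
    (hg : ∀ s, HasDerivAt g (g' s) s) (h : f c = g c) (h' : f' c = g' c) (s : ℝ) :
    HasDerivAt (fun s => if s ≤ c then f s else g s) (if s ≤ c then f' s else g' s) s := by
  rcases lt_trichotomy s c with hs | rfl | hs
  · rw [if_pos hs.le]
    refine (hf s).congr_of_eventuallyEq ?_
    filter_upwards [Iio_mem_nhds hs] with t ht
    rw [if_pos (le_of_lt ht)]
  · rw [if_pos le_rfl, ← hasDerivWithinAt_univ, ← Iic_union_Ici (a := s)]
    refine HasDerivWithinAt.union ?_ ?_
    · exact (hf s).hasDerivWithinAt.congr (fun t ht => if_pos ht) (if_pos le_rfl)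
    · rw [h']
      refine (hg s).hasDerivWithinAt.congr (fun t ht => ?_) (by rw [if_pos le_rfl, h])
      by_cases hts : t ≤ s
      · have : t = s := le_antisymm hts ht
        subst this
        rw [if_pos le_rfl, h]
      · rw [if_neg hts]
  · rw [if_neg (not_le.2 hs)]
    refine (hg s).congr_of_eventuallyEq ?_
    filter_upwards [Ioi_mem_nhds hs] with t ht
    rw [if_neg (not_le.2 ht)]

/-- The truncation of `s` to `[-ε, ε]`. -/
def truncate (ε s : ℝ) : ℝ := max (-ε) (min s ε)

/-- The derivative of `smoothAbs`. -/
def smoothSign (ε s : ℝ) : ℝ :=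
  -(1 / (2 * ε ^ 3)) * truncate ε s ^ 3 + 3 / (2 * ε) * truncate ε s

/-- The second derivative of `smoothAbs`. -/
def smoothSign' (ε s : ℝ) : ℝ := -(3 / (2 * ε ^ 3)) * truncate ε s ^ 2 + 3 / (2 * ε)

theorem truncate_of_neg_le {ε s : ℝ} (hs : -ε ≤ s) (hε : 0 < ε) :
    truncate ε s = if s ≤ ε then s else ε := by
  rw [truncate, max_eq_right (le_min hs (by linarith)), min_def]

theorem truncate_neg {ε : ℝ} (hε : 0 < ε) (s : ℝ) : truncate ε (-s) = -truncate ε s := by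
  simp only [truncate, max_def, min_def]
  split_ifs <;> linarith

theorem bddLip_truncate {ε : ℝ} (hε : 0 < ε) : BddLip (truncate ε) := by
  refine ⟨max ε 1, by positivity, fun s => ?_, fun s t => ?_⟩
  · refine le_trans (abs_le.2 ⟨le_max_left _ _, max_le (by linarith) (min_le_right _ _)⟩)
      (le_max_left _ _)
  · have h1 : |truncate ε s - truncate ε t| ≤ |s - t| :=
      (abs_max_sub_max_le_max _ _ _ _).trans (by
        rw [sub_self, abs_zero]
        refine max_le (abs_nonneg _) ((abs_min_sub_min_le_max _ _ _ _).trans ?_)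
        rw [sub_self, abs_zero]
        exact max_le le_rfl (abs_nonneg _))
    nlinarith [le_max_right ε 1, abs_nonneg (s - t)]

theorem bddLip_smoothSign {ε : ℝ} (hε : 0 < ε) : BddLip (smoothSign ε) := by
  have h := bddLip_truncate hε
  have h3 : BddLip fun s => truncate ε s ^ 3 := by
    simpa only [pow_succ, pow_zero, one_mul] using (h.mul h).mul h
  exact ((BddLip.const _).mul h3).add ((BddLip.const _).mul h)

theorem bddLip_smoothSign' {ε : ℝ} (hε : 0 < ε) : BddLip (smoothSign' ε) := by
  have h := bddLip_truncate hε
  have h2 : BddLip fun s => truncate ε s ^ 2 := by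
    simpa only [pow_succ, pow_zero, one_mul] using h.mul h
  exact ((BddLip.const _).mul h2).add (BddLip.const _)

theorem smoothAbs_neg (ε s : ℝ) : smoothAbs ε (-s) = smoothAbs ε s := by
  simp [smoothAbs]

theorem smoothAbs_nonneg {ε : ℝ} (hε : 0 < ε) (s : ℝ) : 0 ≤ smoothAbs ε s := by
  unfold smoothAbs
  split_ifs with h
  · exact abs_nonneg s
  · have h1 : |s| ^ 2 ≤ ε ^ 2 := by
      have := not_lt.1 h
      gcongr
    have h2 : -(1 / (8 * ε ^ 3)) * |s| ^ 4 + 3 / (4 * ε) * |s| ^ 2 + 3 * ε / 8 =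
        |s| ^ 2 * (6 * ε ^ 2 - |s| ^ 2) / (8 * ε ^ 3) + 3 * ε / 8 := by
      field_simp
      ring
    rw [h2]
    have : 0 ≤ 6 * ε ^ 2 - |s| ^ 2 := by nlinarith [sq_nonneg ε]
    positivity

theorem smoothAbs_of_neg_lt {ε s : ℝ} (hs : -ε < s) :
    smoothAbs ε s = if s ≤ ε then
      -(1 / (8 * ε ^ 3)) * s ^ 4 + 3 / (4 * ε) * s ^ 2 + 3 * ε / 8 else s := by
  have h4 : |s| ^ 4 = s ^ 4 := by
    rw [show |s| ^ 4 = (|s| ^ 2) ^ 2 by ring, sq_abs]; ring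
  unfold smoothAbs
  by_cases h : s ≤ ε
  · rw [if_pos h, if_neg (not_lt.2 (abs_le.2 ⟨hs.le, h⟩)), sq_abs, h4]
  · have h' := not_le.1 h
    rw [if_neg h, if_pos (h'.trans_le (le_abs_self s)), abs_of_pos (by linarith)]

/-- At `ε` the quartic has value `ε` and slope `1`, so it glues to the identity. Evenness gives the
other half line. Written as a polynomial in `truncate`, the derivative needs no case distinction. -/
theorem hasDerivAt_smoothAbs {ε : ℝ} (hε : 0 < ε) (s : ℝ) :
    HasDerivAt (smoothAbs ε) (smoothSign ε s) s := by
  have key {s : ℝ} (hs : -ε < s) : HasDerivAt (smoothAbs ε) (smoothSign ε s) s := by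
    have hp (s : ℝ) : HasDerivAt (fun s : ℝ =>
        -(1 / (8 * ε ^ 3)) * s ^ 4 + 3 / (4 * ε) * s ^ 2 + 3 * ε / 8)
        (-(1 / (2 * ε ^ 3)) * s ^ 3 + 3 / (2 * ε) * s) s := by
      have := (((hasDerivAt_pow 4 s).const_mul (-(1 / (8 * ε ^ 3)))).add
        ((hasDerivAt_pow 2 s).const_mul (3 / (4 * ε)))).add_const (3 * ε / 8)
      refine this.congr_deriv ?_
      push_cast
      field_simp
      ring
    have hglue := hasDerivAt_ite_le (c := ε) hp hasDerivAt_id' (by field_simp; ring)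
      (by field_simp; ring) s
    have hval : (if s ≤ ε then -(1 / (2 * ε ^ 3)) * s ^ 3 + 3 / (2 * ε) * s else 1) =
        smoothSign ε s := by
      rw [smoothSign, truncate_of_neg_le hs.le hε]
      split_ifs
      · rfl
      · field_simp; ring
    rw [hval] at hglue
    refine hglue.congr_of_eventuallyEq ?_
    filter_upwards [Ioi_mem_nhds hs] with t ht
    exact smoothAbs_of_neg_lt ht
  rcases lt_or_ge (-ε) s with hs | hs
  · exact key hs
  · have h := (key (s := -s) (by linarith)).comp s (hasDerivAt_neg s)
    have he : smoothAbs ε ∘ Neg.neg = smoothAbs ε := funext fun t => smoothAbs_neg ε t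
    rw [he] at h
    refine h.congr_deriv ?_
    simp only [smoothSign, truncate_neg hε]
    ring

/-- The second derivative of the quartic vanishes at `ε`, so its first derivative glues to the
constant `1` with matching slopes; oddness gives the other half line. -/
theorem hasDerivAt_smoothSign {ε : ℝ} (hε : 0 < ε) (s : ℝ) :
    HasDerivAt (smoothSign ε) (smoothSign' ε s) s := by
  have key {s : ℝ} (hs : -ε < s) : HasDerivAt (smoothSign ε) (smoothSign' ε s) s := by
    have hp (s : ℝ) : HasDerivAt (fun s : ℝ => -(1 / (2 * ε ^ 3)) * s ^ 3 + 3 / (2 * ε) * s)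
        (-(3 / (2 * ε ^ 3)) * s ^ 2 + 3 / (2 * ε)) s := by
      have := ((hasDerivAt_pow 3 s).const_mul (-(1 / (2 * ε ^ 3)))).add
        ((hasDerivAt_id s).const_mul (3 / (2 * ε)))
      refine this.congr_deriv ?_
      push_cast
      field_simp
    have hglue := hasDerivAt_ite_le (c := ε) hp (fun s => hasDerivAt_const s (1 : ℝ))
      (by field_simp; ring) (by field_simp; ring) s
    have hval : (if s ≤ ε then -(3 / (2 * ε ^ 3)) * s ^ 2 + 3 / (2 * ε) else 0) =
        smoothSign' ε s := by
      rw [smoothSign', truncate_of_neg_le hs.le hε]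
      split_ifs
      · rfl
      · field_simp; ring
    rw [hval] at hglue
    refine hglue.congr_of_eventuallyEq ?_
    filter_upwards [Ioi_mem_nhds hs] with t ht
    rw [smoothSign, truncate_of_neg_le (le_of_lt ht) hε]
    split_ifs
    · rfl
    · field_simp; ring
  rcases lt_or_ge (-ε) s with hs | hs
  · exact key hs
  · have h := ((key (s := -s) (by linarith)).comp s (hasDerivAt_neg s)).neg
    have he : -(smoothSign ε ∘ Neg.neg) = smoothSign ε := funext fun t => by
      simp only [Pi.neg_apply, Function.comp_apply, smoothSign, truncate_neg hε]
      ring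
    rw [he] at h
    refine h.congr_deriv ?_
    simp only [smoothSign', truncate_neg hε]
    ring

variable {a b α ε : ℝ}

theorem continuous_frictionBound : Continuous (frictionBound a b α) := by
  unfold frictionBound
  fun_prop

theorem hasDerivAt_potential (hε : 0 < ε) (s : ℝ) :
    HasDerivAt (potential a b α ε) (frictionBound a b α (smoothAbs ε s) * smoothSign ε s) s := by
  have hc := continuous_frictionBound (a := a) (b := b) (α := α)
  have h1 := intervalIntegral.integral_hasDerivAt_right (a := 0) (b := smoothAbs ε s)
    (hc.intervalIntegrable _ _) hc.aestronglyMeasurable.stronglyMeasurableAtFilter hc.continuousAt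
  exact h1.comp s (hasDerivAt_smoothAbs hε s)

theorem deriv_potential (hε : 0 < ε) : deriv (potential a b α ε) =
    fun s => frictionBound a b α (smoothAbs ε s) * smoothSign ε s :=
  funext fun s => (hasDerivAt_potential hε s).deriv

theorem hasDerivAt_exp_smoothAbs (hε : 0 < ε) (s : ℝ) :
    HasDerivAt (fun s => Real.exp (-α * smoothAbs ε s))
      (Real.exp (-α * smoothAbs ε s) * (-α * smoothSign ε s)) s :=
  ((hasDerivAt_smoothAbs hε s).const_mul (-α)).exp

/-- Since `smoothAbs` is nonnegative and `0 ≤ α`, the exponential is at most `1` although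
`smoothAbs` is unbounded. -/
theorem bddLip_exp_smoothAbs (hε : 0 < ε) (hα : 0 ≤ α) :
    BddLip fun s => Real.exp (-α * smoothAbs ε s) := by
  obtain ⟨M, hM, hb, -⟩ := bddLip_smoothSign hε
  have h1 (s : ℝ) : |Real.exp (-α * smoothAbs ε s)| ≤ 1 := by
    rw [abs_of_pos (Real.exp_pos _), Real.exp_le_one_iff]
    nlinarith [smoothAbs_nonneg hε s]
  refine BddLip.of_hasDerivAt (hasDerivAt_exp_smoothAbs hε) h1 (N := α * M) fun s => ?_
  rw [abs_mul, abs_mul, abs_neg, abs_of_nonneg hα]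
  have := mul_le_mul_of_nonneg_left (hb s) hα
  nlinarith [h1 s, abs_nonneg (Real.exp (-α * smoothAbs ε s)), abs_nonneg (smoothSign ε s),
    mul_nonneg hα (abs_nonneg (smoothSign ε s))]

theorem hasDerivAt_deriv_potential (hε : 0 < ε) (s : ℝ) :
    HasDerivAt (deriv (potential a b α ε))
      ((a - b) * (-α) * Real.exp (-α * smoothAbs ε s) * (smoothSign ε s * smoothSign ε s) +
        ((a - b) * Real.exp (-α * smoothAbs ε s) + b) * smoothSign' ε s) s := by
  rw [deriv_potential hε]
  have h1 : HasDerivAt (fun s => frictionBound a b α (smoothAbs ε s))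
      ((a - b) * (Real.exp (-α * smoothAbs ε s) * (-α * smoothSign ε s))) s :=
    ((hasDerivAt_exp_smoothAbs hε s).const_mul (a - b)).add_const b
  refine (h1.mul (hasDerivAt_smoothSign hε s)).congr_deriv ?_
  simp only [frictionBound]
  ring

theorem bddLip_deriv_potential (hε : 0 < ε) (hα : 0 ≤ α) :
    BddLip (deriv (potential a b α ε)) := by
  rw [deriv_potential hε]
  exact (((BddLip.const (a - b)).mul (bddLip_exp_smoothAbs hε hα)).add (BddLip.const b)).mul
    (bddLip_smoothSign hε)

theorem bddLip_deriv_deriv_potential (hε : 0 < ε) (hα : 0 ≤ α) :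
    BddLip (deriv (deriv (potential a b α ε))) := by
  have h : deriv (deriv (potential a b α ε)) = fun s =>
      ((a - b) * (-α) * Real.exp (-α * smoothAbs ε s) * (smoothSign ε s * smoothSign ε s) +
        ((a - b) * Real.exp (-α * smoothAbs ε s) + b) * smoothSign' ε s) :=
    funext fun s => (hasDerivAt_deriv_potential hε s).deriv
  rw [h]
  have hexp := bddLip_exp_smoothAbs hε hα
  have hs := bddLip_smoothSign hε
  exact ((((BddLip.const _).mul hexp).mul (hs.mul hs))).add
    ((((BddLip.const _).mul hexp).add (BddLip.const b)).mul (bddLip_smoothSign' hε))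

/-- The derivative of the friction potential is continuously differentiable, with a remainder which
is quadratic for small and linear for large increments. -/
theorem exists_deriv_potential_remainder (hε : 0 < ε) (hα : 0 ≤ α) :
    ∃ M : ℝ, 0 ≤ M ∧ ∀ s h : ℝ,
      |deriv (potential a b α ε) (s + h) - deriv (potential a b α ε) s -
        deriv (deriv (potential a b α ε)) s * h| ≤ M * |h| * min |h| 1 := by
  obtain ⟨M₁, hM₁, -, hl₁⟩ := bddLip_deriv_potential (a := a) (b := b) hε hα
  obtain ⟨M₂, hM₂, hb₂, hl₂⟩ := bddLip_deriv_deriv_potential (a := a) (b := b) hε hα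
  refine ⟨M₁ + M₂, by positivity, fun s h => ?_⟩
  have hd (t : ℝ) : HasDerivAt (deriv (potential a b α ε))
      (deriv (deriv (potential a b α ε)) t) t :=
    (hasDerivAt_deriv_potential hε t).differentiableAt.hasDerivAt
  have hq := abs_taylor_le_of_abs_le (s := s) (t := s + h) (R := max |s| |s + h|) hd
    (fun x _ => hl₂ x s) hM₂ (le_max_left _ _) (le_max_right _ _)
  have hlin := hl₁ (s + h) s
  rw [add_sub_cancel_left] at hq hlin
  have h0 := abs_nonneg h
  -- Small increments use the Lipschitz bound of the second derivative, large ones the Lipschitz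
  -- bound of the first and the bound of the second.
  rcases le_total |h| 1 with h1 | h1
  · rw [min_eq_left h1]
    nlinarith [mul_nonneg hM₁ (mul_nonneg h0 h0)]
  · rw [min_eq_right h1]
    refine (abs_sub _ _).trans ?_
    rw [abs_mul]
    nlinarith [mul_le_mul_of_nonneg_right (hb₂ s) h0]

end Potential

/-! ### The interpolation function -/

section Interp

theorem exists_abs_pow_sub_pow_le (q : ℕ) (R : ℝ) :
    ∃ M : ℝ, 0 ≤ M ∧ ∀ s t : ℝ, |s| ≤ R → |t| ≤ R → |s ^ q - t ^ q| ≤ M * |s - t| := by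
  induction q with
  | zero => exact ⟨0, le_rfl, fun s t _ _ => by simp⟩
  | succ q ih =>
    obtain ⟨M, hM, h⟩ := ih
    refine ⟨|R| * M + |R| ^ q, by positivity, fun s t hs ht => ?_⟩
    have hs' : |s| ≤ |R| := hs.trans (le_abs_self R)
    have ht' : |t| ≤ |R| := ht.trans (le_abs_self R)
    calc |s ^ (q + 1) - t ^ (q + 1)| = |s * (s ^ q - t ^ q) + t ^ q * (s - t)| := by
          congr 1; ring
      _ ≤ |s| * |s ^ q - t ^ q| + |t| ^ q * |s - t| := by
          rw [← abs_mul, ← abs_pow, ← abs_mul]; exact abs_add_le _ _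
      _ ≤ |R| * (M * |s - t|) + |R| ^ q * |s - t| := by
          gcongr
          exact h s t hs ht
      _ = _ := by ring

/-- The derivative of the interpolation function, off the points `t` with `t ^ q = kmin`. -/
def interpDeriv (kmin : ℝ) (q : ℕ) (t : ℝ) : ℝ := if kmin < t ^ q then q * t ^ (q - 1) else 0

theorem measurable_interpDeriv (kmin : ℝ) (q : ℕ) : Measurable (interpDeriv kmin q) :=
  Measurable.ite (measurableSet_lt measurable_const (measurable_id.pow_const q))
    (measurable_const.mul (measurable_id.pow_const _)) measurable_const

theorem hasDerivAt_interp {kmin t : ℝ} {q : ℕ} (ht : t ^ q ≠ kmin) :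
    HasDerivAt (interp kmin q) (interpDeriv kmin q t) t := by
  have hc : Continuous fun t : ℝ => t ^ q := continuous_pow q
  rcases ht.lt_or_gt with h | h
  · rw [interpDeriv, if_neg (not_lt.2 h.le)]
    refine (hasDerivAt_const t kmin).congr_of_eventuallyEq ?_
    filter_upwards [hc.continuousAt.eventually_lt continuousAt_const h] with s hs
    exact max_eq_right hs.le
  · rw [interpDeriv, if_pos h]
    refine (hasDerivAt_pow q t).congr_of_eventuallyEq ?_
    filter_upwards [continuousAt_const.eventually_lt hc.continuousAt h] with s hs
    exact max_eq_left hs.le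

/-- Local Lipschitz bound and first-order remainder of the interpolation function. -/
theorem exists_interp_bounds (kmin : ℝ) (q : ℕ) (R : ℝ) :
    ∃ M : ℝ, 0 ≤ M ∧ (∀ t, |t| ≤ R → |interp kmin q t| ≤ M) ∧
      (∀ t, |t| ≤ R → |interpDeriv kmin q t| ≤ M) ∧
      ∀ s t, |s| ≤ R → |t| ≤ R → |interp kmin q t - interp kmin q s| ≤ M * |t - s| ∧
        |interp kmin q t - interp kmin q s -
          interpDeriv kmin q s * (t - s)| ≤ 2 * M * |t - s| ∧
        (M * |t - s| < |s ^ q - kmin| → |interp kmin q t - interp kmin q s -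
          interpDeriv kmin q s * (t - s)| ≤ M * |t - s| ^ 2) := by
  obtain ⟨M₁, hM₁, h₁⟩ := exists_abs_pow_sub_pow_le q R
  obtain ⟨M₂, hM₂, h₂⟩ := exists_abs_pow_sub_pow_le (q - 1) R
  -- The summands bound, in order, the Lipschitz constants of `t ^ q` and of its derivative, the
  -- size of `interp`, and the size of `interpDeriv`.
  set M := M₁ + q * M₂ + (|R| ^ q + |kmin|) + q * |R| ^ (q - 1) with hM
  have hqM₂ : 0 ≤ q * M₂ := by positivity
  have hR : 0 ≤ |R| ^ q + |kmin| := by positivity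
  have hR' : 0 ≤ q * |R| ^ (q - 1) := by positivity
  have hM0 : 0 ≤ M := by positivity
  have hder : ∀ t, |t| ≤ R → |interpDeriv kmin q t| ≤ M := by
    intro t ht
    unfold interpDeriv
    split_ifs
    · rw [abs_mul, abs_pow, Nat.abs_cast]
      have : |t| ^ (q - 1) ≤ |R| ^ (q - 1) := by
        have := ht.trans (le_abs_self R)
        gcongr
      have := mul_le_mul_of_nonneg_left this (Nat.cast_nonneg (α := ℝ) q)
      linarith
    · simpa using hM0
  have hlip : ∀ s t, |s| ≤ R → |t| ≤ R → |interp kmin q t - interp kmin q s| ≤ M * |t - s| := by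
    intro s t hs ht
    refine (abs_max_sub_max_le_max _ _ _ _).trans ?_
    rw [sub_self, abs_zero, max_eq_left (abs_nonneg _)]
    refine (h₁ t s ht hs).trans ?_
    gcongr
    linarith
  refine ⟨M, hM0, fun t ht => ?_, hder, fun s t hs ht => ⟨hlip s t hs ht, ?_, fun hfar => ?_⟩⟩
  · have h3 : |t ^ q| ≤ |R| ^ q := by
      rw [abs_pow]
      have := ht.trans (le_abs_self R)
      gcongr
    refine (abs_max_le_max_abs_abs (a := t ^ q) (b := kmin)).trans (max_le ?_ ?_)
    · linarith [abs_nonneg kmin]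
    · linarith [abs_nonneg kmin, pow_nonneg (abs_nonneg R) q]
  · refine (abs_sub _ _).trans ?_
    rw [abs_mul]
    nlinarith [hlip s t hs ht, mul_le_mul_of_nonneg_right (hder s hs) (abs_nonneg (t - s))]
  · have hst := h₁ t s ht hs
    -- Hence `t ^ q` and `s ^ q` lie on the same side of `kmin`, and the same branch of the maximum
    -- is active at both points.
    have hst' : |t ^ q - s ^ q| < |s ^ q - kmin| := by
      refine hst.trans_lt (lt_of_le_of_lt ?_ hfar)
      gcongr
      linarith
    have habs := abs_le.1 hst'.le
    by_cases h : kmin < s ^ q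
    · rw [abs_of_pos (by linarith : 0 < s ^ q - kmin)] at hst' habs
      have htk : kmin ≤ t ^ q := by linarith [habs.1]
      rw [interpDeriv, if_pos h, interp, interp, max_eq_left htk, max_eq_left h.le]
      have := abs_taylor_le_of_abs_le (f := fun t => t ^ q) (f' := fun t => q * t ^ (q - 1))
        (s := s) (t := t) (R := R) (K := q * M₂) (fun t => hasDerivAt_pow q t) (fun x hx => by
          rw [← mul_sub, abs_mul, Nat.abs_cast, mul_assoc]
          gcongr
          exact h₂ x s hx hs) hqM₂ hs ht
      refine this.trans ?_
      gcongr
      linarith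
    · have hsk := not_lt.1 h
      rw [abs_of_nonpos (by linarith : s ^ q - kmin ≤ 0)] at hst' habs
      have htk : t ^ q ≤ kmin := by linarith [habs.2]
      rw [interpDeriv, if_neg h, interp, interp, max_eq_right htk, max_eq_right hsk]
      simp only [sub_self, zero_mul, abs_zero]
      positivity

theorem continuous_interp (kmin : ℝ) (q : ℕ) : Continuous (interp kmin q) :=
  (continuous_pow q).max continuous_const

theorem le_interp (kmin : ℝ) (q : ℕ) (t : ℝ) : kmin ≤ interp kmin q t := le_max_right _ _

end Interp

/-! ### Remainder estimates under the integral sign -/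

section Remainder

variable {X : Type*} [MeasurableSpace X] {μ : Measure X}

theorem Lp_top_ae_abs_le (f : Lp ℝ ∞ μ) : ∀ᵐ x ∂μ, |f x| ≤ ‖f‖ := by
  have h := enorm_ae_le_eLpNormEssSup f μ
  filter_upwards [h] with x hx
  rw [← eLpNorm_exponent_top, ← Lp.enorm_def] at hx
  have := ENNReal.toReal_mono (by simp) hx
  simpa using this

/-- The integral over `{g ≤ r}` of an integrable function is small for small `r`, if `g` is
positive. -/
theorem exists_setIntegral_le {f g : X → ℝ} (hf : Integrable f μ) (hg : Measurable g)
    (hpos : ∀ᵐ x ∂μ, 0 < g x) {e : ℝ} (he : 0 < e) :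
    ∃ ρ > 0, ∀ r ≤ ρ, ∫ x in {x | g x ≤ r}, |f x| ∂μ ≤ e := by
  set s : ℕ → Set X := fun n => {x | g x ≤ 1 / ((n : ℝ) + 1)} with hs
  have hsm (n) : MeasurableSet (s n) := measurableSet_le hg measurable_const
  have hanti : Antitone s := by
    intro m n hmn x hx
    have hmn' : (m : ℝ) ≤ n := by exact_mod_cast hmn
    exact le_trans hx (one_div_le_one_div_of_le (by positivity : (0 : ℝ) < m + 1) (by linarith))
  have hlim := tendsto_setIntegral_of_antitone hsm hanti ⟨0, hf.abs.integrableOn⟩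
  -- The sublevel sets decrease to `{g ≤ 0}`, which is null.
  have hzero : ∫ x in ⋂ n, s n, |f x| ∂μ = 0 := by
    refine setIntegral_measure_zero _ (measure_mono_null (fun x hx => ?_) (ae_iff.1 hpos))
    simp only [mem_ofPred_eq, not_lt]
    rw [mem_iInter] at hx
    exact ge_of_tendsto' tendsto_one_div_add_atTop_nhds_zero_nat hx
  rw [hzero] at hlim
  obtain ⟨n, hn⟩ := (hlim.eventually (gt_mem_nhds he)).exists
  refine ⟨1 / ((n : ℝ) + 1), by positivity, fun r hr => le_trans ?_ hn.le⟩
  exact setIntegral_mono_set hf.abs.integrableOn (Eventually.of_forall fun _ => abs_nonneg _)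
    (Eventually.of_forall fun x (hx : g x ≤ r) => hx.trans hr)

/-- The tails of a square integrable function. -/
theorem exists_integral_tail_sq_le {p : X → ℝ} (hp : MemLp p 2 μ) {e : ℝ} (he : 0 < e) :
    ∃ N : ℕ, ∫ x, max (|p x| - N) 0 ^ 2 ∂μ ≤ e := by
  have hlim := tendsto_integral_of_dominated_convergence (μ := μ)
    (F := fun (n : ℕ) x => max (|p x| - n) 0 ^ 2) (f := fun _ => (0 : ℝ)) (fun x => p x ^ 2)
    (fun n => (by fun_prop : Continuous fun t : ℝ => max (|t| - n) 0 ^ 2).comp_aestronglyMeasurable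
      hp.1) hp.integrable_sq
    (fun n => Eventually.of_forall fun x => by
      rw [Real.norm_eq_abs, abs_of_nonneg (sq_nonneg _), ← sq_abs (p x)]
      have h : max (|p x| - n) 0 ≤ |p x| :=
        max_le (by linarith [n.cast_nonneg (α := ℝ)]) (abs_nonneg _)
      gcongr)
    (Eventually.of_forall fun x => by
      obtain ⟨n, hn⟩ := exists_nat_ge |p x|
      refine tendsto_const_nhds.congr' ?_
      filter_upwards [eventually_ge_atTop n] with k hk
      have : |p x| - k ≤ 0 := by
        have : (n : ℝ) ≤ k := by exact_mod_cast hk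
        linarith
      rw [max_eq_right this]
      simp)
  rw [integral_zero] at hlim
  obtain ⟨n, hn⟩ := (hlim.eventually (gt_mem_nhds he)).exists
  exact ⟨n, hn.le⟩

/-- A remainder which is quadratic for small and linear for large increments is of lower order in
`L^2`, when it is tested with a fixed function in `L^2`. -/
theorem exists_integral_remainder_le {p : X → ℝ} (hp : MemLp p 2 μ) {C : ℝ} (hC : 0 ≤ C) {e : ℝ}
    (he : 0 < e) :
    ∃ ρ > 0, ∀ δ, 0 < δ → δ ≤ ρ → ∀ w : X → ℝ, MemLp w 2 μ →
      ∫ x, w x ^ 2 ∂μ ≤ C * δ ^ 2 → ∫ x, |w x| * min |w x| 1 * |p x| ∂μ ≤ e * δ := by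
  set η := e / (C + 1) with hη
  have hη0 : 0 < η := by positivity
  have hηC : η * C ≤ e := by
    rw [hη, div_mul_eq_mul_div, div_le_iff₀ (by positivity)]
    nlinarith
  obtain ⟨N, hN⟩ := exists_integral_tail_sq_le hp (e := η * e / 2) (by positivity)
  refine ⟨e / (4 * (N * C + 1)), by positivity, fun δ hδ hδρ w hw hwδ => ?_⟩
  set h : X → ℝ := fun x => max (|p x| - N) 0 ^ 2 with hh
  have hhm : AEStronglyMeasurable h μ :=
    (by fun_prop : Continuous fun t : ℝ => max (|t| - N) 0 ^ 2).comp_aestronglyMeasurable hp.1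
  have hhi : Integrable h μ := hp.integrable_sq.mono' hhm (Eventually.of_forall fun x => by
    rw [Real.norm_eq_abs, abs_of_nonneg (sq_nonneg _), ← sq_abs (p x)]
    have h : max (|p x| - N) 0 ≤ |p x| :=
      max_le (by linarith [N.cast_nonneg (α := ℝ)]) (abs_nonneg _)
    exact pow_le_pow_left₀ (le_max_right _ _) h 2)
  -- Split `|p| ≤ N + t` with `t` the excess over `N`. The level `N` is paired with the quadratic
  -- bound, the tail `t` with the linear one. Young's inequality with weight `η / δ` gives both its
  -- terms the order `δ`. The final budget is `e / 4` for the level, `e / 2` and `e / 4` for the two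
  -- Young terms.
  have hpt (x : X) : |w x| * min |w x| 1 * |p x| ≤
      (N + η / (2 * δ)) * w x ^ 2 + δ / (2 * η) * h x := by
    set a := |w x|
    set b := |p x|
    have ha : 0 ≤ a := abs_nonneg _
    have hb : 0 ≤ b := abs_nonneg _
    set t := max (b - N) 0 with ht
    have ht0 : 0 ≤ t := le_max_right _ _
    have hbt : b ≤ N + t := by linarith [le_max_left (b - N) 0]
    have hm0 : 0 ≤ min a 1 := le_min ha zero_le_one
    have h1 : a * min a 1 * b ≤ N * a ^ 2 + a * t := by
      calc a * min a 1 * b ≤ a * min a 1 * (N + t) := by gcongr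
        _ = N * (a * min a 1) + a * (min a 1) * t := by ring
        _ ≤ N * (a * a) + a * 1 * t := by
            gcongr
            · exact min_le_left _ _
            · exact min_le_right _ _
        _ = _ := by ring
    have h2 : a * t ≤ η / (2 * δ) * a ^ 2 + δ / (2 * η) * t ^ 2 := by
      have : η / (2 * δ) * a ^ 2 + δ / (2 * η) * t ^ 2 - a * t =
          (η * a - δ * t) ^ 2 / (2 * δ * η) := by
        field_simp
        ring
      have h3 : 0 ≤ (η * a - δ * t) ^ 2 / (2 * δ * η) := by positivity
      linarith
    have h3 : w x ^ 2 = a ^ 2 := (sq_abs _).symm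
    rw [h3]
    linarith
  have hint : Integrable (fun x => (N + η / (2 * δ)) * w x ^ 2 + δ / (2 * η) * h x) μ :=
    (hw.integrable_sq.const_mul _).add (hhi.const_mul _)
  have hle := integral_mono_of_nonneg (Eventually.of_forall fun x => by positivity) hint
    (Eventually.of_forall hpt)
  refine hle.trans ?_
  rw [integral_add (hw.integrable_sq.const_mul _) (hhi.const_mul _), integral_const_mul,
    integral_const_mul]
  have t1 : (N + η / (2 * δ)) * ∫ x, w x ^ 2 ∂μ ≤ (N + η / (2 * δ)) * (C * δ ^ 2) := by gcongr
  have t2 : δ / (2 * η) * ∫ x, h x ∂μ ≤ δ / (2 * η) * (η * e / 2) := by gcongr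
  have t3 : (N + η / (2 * δ)) * (C * δ ^ 2) = (N * C * δ) * δ + η * C * δ / 2 := by
    field_simp
  have t4 : δ / (2 * η) * (η * e / 2) = e * δ / 4 := by
    field_simp
    ring
  have t5 : N * C * δ ≤ e / 4 := by
    calc N * C * δ ≤ (N * C + 1) * (e / (4 * (N * C + 1))) := by gcongr; linarith
      _ = e / 4 := by field_simp
  have t6 : N * C * δ * δ ≤ e / 4 * δ := by gcongr
  have t7 : η * C * δ ≤ e * δ := by gcongr
  linarith

variable {d : ℕ} {m : E d → ℝ} {K : ℝ≥0}

theorem norm_fderiv_sub_le (hm' : LipschitzWith K (fderiv ℝ m)) (x y : E d) :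
    ‖fderiv ℝ m x - fderiv ℝ m y‖ ≤ K * ‖x - y‖ := by
  have := hm'.dist_le_mul x y
  rwa [dist_eq_norm, dist_eq_norm] at this

/-- Taylor's formula at `0` gives quadratic growth, and the constant term is integrable because the
measure is finite. -/
theorem integrable_comp_of_lipschitz_fderiv [IsFiniteMeasure μ] (hm : Differentiable ℝ m)
    (hm' : LipschitzWith K (fderiv ℝ m)) {u : X → E d} (hu : MemLp u 2 μ) :
    Integrable (fun x => m (u x)) μ := by
  have hbound : Integrable (fun x => |m 0| + ‖fderiv ℝ m 0‖ * ‖u x‖ + K * ‖u x‖ ^ 2) μ :=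
    ((integrable_const _).add ((hu.integrable (by norm_num)).norm.const_mul _)).add
      (hu.norm.integrable_sq.const_mul _)
  refine hbound.mono' (hm.continuous.comp_aestronglyMeasurable hu.1)
    (Eventually.of_forall fun x => ?_)
  have h1 := norm_taylor_le hm (norm_fderiv_sub_le hm') 0 (u x)
  rw [zero_add, Real.norm_eq_abs] at h1
  have h2 := (fderiv ℝ m 0).le_opNorm (u x)
  rw [Real.norm_eq_abs] at h2 ⊢
  calc |m (u x)| = |(m (u x) - m 0 - fderiv ℝ m 0 (u x)) + m 0 + fderiv ℝ m 0 (u x)| := by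
        congr 1; ring
    _ ≤ |m (u x) - m 0 - fderiv ℝ m 0 (u x)| + |m 0| + |fderiv ℝ m 0 (u x)| := abs_add_three _ _ _
    _ ≤ _ := by linarith

theorem integrable_fderiv_comp [IsFiniteMeasure μ] (hm' : LipschitzWith K (fderiv ℝ m))
    {u v : X → E d} (hu : MemLp u 2 μ) (hv : MemLp v 2 μ) :
    Integrable (fun x => fderiv ℝ m (u x) (v x)) μ := by
  have hbound : Integrable (fun x => ‖fderiv ℝ m 0‖ * ‖v x‖ + K * (‖u x‖ * ‖v x‖)) μ :=
    ((hv.integrable (by norm_num)).norm.const_mul _).add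
      ((hu.norm.integrable_mul hv.norm).const_mul _)
  have hmeas : AEStronglyMeasurable (fun x => fderiv ℝ m (u x) (v x)) μ := by
    have hc : Continuous fun p : E d × E d => fderiv ℝ m p.1 p.2 :=
      (hm'.continuous.comp continuous_fst).clm_apply continuous_snd
    exact hc.comp_aestronglyMeasurable (hu.1.prodMk hv.1)
  refine hbound.mono' hmeas (Eventually.of_forall fun x => ?_)
  have h1 := (fderiv ℝ m (u x)).le_opNorm (v x)
  have h2 : ‖fderiv ℝ m (u x)‖ ≤ ‖fderiv ℝ m 0‖ + K * ‖u x‖ := by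
    have := norm_fderiv_sub_le hm' (u x) 0
    rw [sub_zero] at this
    have h3 := norm_le_insert' (fderiv ℝ m (u x)) (fderiv ℝ m 0)
    linarith
  calc ‖fderiv ℝ m (u x) (v x)‖ ≤ (‖fderiv ℝ m 0‖ + K * ‖u x‖) * ‖v x‖ :=
        h1.trans (by gcongr)
    _ = _ := by ring

/-- First-order expansion of an integral functional. -/
theorem abs_integral_taylor_le [IsFiniteMeasure μ] (hm : Differentiable ℝ m)
    (hm' : LipschitzWith K (fderiv ℝ m)) {u u' : X → E d} (hu : MemLp u 2 μ)
    (hu' : MemLp u' 2 μ) :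
    |(∫ x, m (u' x) ∂μ) - (∫ x, m (u x) ∂μ) - ∫ x, fderiv ℝ m (u x) (u' x - u x) ∂μ| ≤
      K * ∫ x, ‖u' x - u x‖ ^ 2 ∂μ := by
  have i1 := integrable_comp_of_lipschitz_fderiv hm hm' hu'
  have i2 := integrable_comp_of_lipschitz_fderiv hm hm' hu
  have hw : MemLp (fun x => u' x - u x) 2 μ := hu'.sub hu
  have i3 := integrable_fderiv_comp hm' hu hw
  have i12 : Integrable (fun x => m (u' x) - m (u x)) μ := i1.sub i2
  rw [← integral_sub i1 i2, ← integral_sub i12 i3, ← integral_const_mul]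
  refine abs_integral_le_integral_abs.trans
    (integral_mono (i12.sub i3).abs (hw.norm.integrable_sq.const_mul _) fun x => ?_)
  have := norm_taylor_le hm (norm_fderiv_sub_le hm') (u x) (u' x - u x)
  rwa [add_sub_cancel, Real.norm_eq_abs] at this

end Remainder

/-! ### The elastic energy density -/

section Elastic

variable {d : ℕ} {P : Problem d}

/-- The density `C ε(u) : ε(v)`. -/
def Problem.elastic (P : Problem d) (u v : H1 P.D) (x : E d) : ℝ :=
  ddot ((P.C x).app (u.strain x)) (v.strain x)

theorem ddot_smul_app (c : ℝ) (T : Tensor4 d) (A B : Matrix (Fin d) (Fin d) ℝ) :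
    ddot (Tensor4.app (c • T) A) B = c * ddot (T.app A) B := by
  simp only [ddot, Tensor4.app, Matrix.of_apply, Pi.smul_apply, smul_eq_mul, Finset.mul_sum,
    Finset.sum_mul, mul_assoc]

theorem ddot_app_eq_sum (T : Tensor4 d) (A B : Matrix (Fin d) (Fin d) ℝ) :
    ddot (T.app A) B = ∑ i, ∑ j, ∑ k, ∑ l, T i j k l * (A k l * B i j) := by
  simp only [ddot, Tensor4.app, Matrix.of_apply, Finset.sum_mul, mul_assoc]

theorem ddot_app_comm {T : Tensor4 d} (hT : ∀ i j k l, T i j k l = T k l i j)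
    (A B : Matrix (Fin d) (Fin d) ℝ) : ddot (T.app A) B = ddot (T.app B) A := by
  rw [ddot_app_eq_sum, ddot_app_eq_sum]
  have h (f : Fin d → Fin d → Fin d → Fin d → ℝ) :
      ∑ i, ∑ j, ∑ k, ∑ l, f i j k l = ∑ i, ∑ j, ∑ k, ∑ l, f k l i j := by
    have e1 : ∀ g : Fin d → Fin d → Fin d → Fin d → ℝ, ∑ i, ∑ j, ∑ k, ∑ l, g i j k l =
        ∑ p : Fin d × Fin d, ∑ r : Fin d × Fin d, g p.1 p.2 r.1 r.2 := fun g => by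
      simp only [Fintype.sum_prod_type]
    rw [e1, e1, Finset.sum_comm]
  rw [h]
  refine Finset.sum_congr rfl fun i _ => Finset.sum_congr rfl fun j _ =>
    Finset.sum_congr rfl fun k _ => Finset.sum_congr rfl fun l _ => ?_
  rw [hT i j k l]
  ring

/-- Young's inequality with a free weight replaces Cauchy–Schwarz. The weight is later used for
absorption in `le_mul_of_forall_weight`, and set to `δ⁻¹` in `exists_increment_le`. -/
theorem abs_ddot_app_le {T : Tensor4 d} {B₀ : ℝ} (hT : ∀ i j k l, |T i j k l| ≤ B₀)
    (hB₀ : 0 ≤ B₀) (A B : Matrix (Fin d) (Fin d) ℝ) {t : ℝ} (ht : 0 < t) :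
    |ddot (T.app A) B| ≤ B₀ * d ^ 2 * (t * ddot A A + t⁻¹ * ddot B B) := by
  have hpt (i j k l : Fin d) : |T i j k l * (A k l * B i j)| ≤
      B₀ * (t * (A k l * A k l) + t⁻¹ * (B i j * B i j)) := by
    rw [abs_mul]
    refine mul_le_mul (hT i j k l) ?_ (abs_nonneg _) hB₀
    rw [abs_mul]
    have h1 : t * (A k l * A k l) + t⁻¹ * (B i j * B i j) - 2 * (|A k l| * |B i j|) =
        t⁻¹ * (t * |A k l| - |B i j|) ^ 2 := by
      have h2 : A k l * A k l = |A k l| ^ 2 := by rw [sq_abs, sq]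
      have h3 : B i j * B i j = |B i j| ^ 2 := by rw [sq_abs, sq]
      rw [h2, h3]
      field_simp
      ring
    have h4 : 0 ≤ t⁻¹ * (t * |A k l| - |B i j|) ^ 2 := by positivity
    have h5 : 0 ≤ |A k l| * |B i j| := by positivity
    linarith
  rw [ddot_app_eq_sum]
  have habs : |∑ i, ∑ j, ∑ k, ∑ l, T i j k l * (A k l * B i j)| ≤
      ∑ i, ∑ j, ∑ k, ∑ l, B₀ * (t * (A k l * A k l) + t⁻¹ * (B i j * B i j)) := by
    refine (Finset.abs_sum_le_sum_abs _ _).trans (Finset.sum_le_sum fun i _ => ?_)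
    refine (Finset.abs_sum_le_sum_abs _ _).trans (Finset.sum_le_sum fun j _ => ?_)
    refine (Finset.abs_sum_le_sum_abs _ _).trans (Finset.sum_le_sum fun k _ => ?_)
    exact (Finset.abs_sum_le_sum_abs _ _).trans (Finset.sum_le_sum fun l _ => hpt i j k l)
  refine habs.trans (le_of_eq ?_)
  have h (c : ℝ) : ∑ k : Fin d, ∑ l : Fin d, B₀ * (t * (A k l * A k l) + t⁻¹ * c) =
      B₀ * (t * ddot A A + d ^ 2 * (t⁻¹ * c)) := by
    simp only [← Finset.mul_sum, Finset.sum_add_distrib, Finset.sum_const, Finset.card_univ,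
      Fintype.card_fin, nsmul_eq_mul, ddot]
    ring
  have h' (c : ℝ) : ∑ i : Fin d, ∑ j : Fin d, B₀ * (c + d ^ 2 * (t⁻¹ * (B i j * B i j))) =
      B₀ * (d ^ 2 * c + d ^ 2 * (t⁻¹ * ddot B B)) := by
    simp only [← Finset.mul_sum, Finset.sum_add_distrib, Finset.sum_const, Finset.card_univ,
      Fintype.card_fin, nsmul_eq_mul, ddot]
    ring
  simp only [h, h']
  ring

theorem H1.isSymm_strain {D : Set (E d)} (v : H1 D) (x : E d) : (v.strain x).IsSymm := by
  rw [Matrix.IsSymm, H1.strain, Matrix.transpose_smul, Matrix.transpose_add,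
    Matrix.transpose_transpose, add_comm]

theorem Problem.Admissible.integrable_elastic (hP : P.Admissible) (u v : H1 P.D) :
    Integrable (P.elastic u v) (volume.restrict P.D) := by
  unfold Problem.elastic
  simp only [ddot_app_eq_sum]
  refine integrable_finsetSum _ fun i _ => integrable_finsetSum _ fun j _ =>
    integrable_finsetSum _ fun k _ => integrable_finsetSum _ fun l _ => ?_
  have h : Integrable (fun x => u.strain x k l * v.strain x i j) (volume.restrict P.D) :=
    (u.memLp_strain k l).integrable_mul (v.memLp_strain i j)
  exact h.mul_of_top_right (hP.C_bdd i j k l)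

theorem Problem.Admissible.elastic_comm (hP : P.Admissible) (u v : H1 P.D) :
    P.elastic u v =ᵐ[volume.restrict P.D] P.elastic v u := by
  filter_upwards [hP.C_symm] with x hx
  exact ddot_app_comm (fun i j k l => (hx i j k l).2) _ _

theorem Problem.Admissible.exists_abs_elastic_le (hP : P.Admissible) :
    ∃ K : ℝ, 0 ≤ K ∧ ∀ u v : H1 P.D, ∀ t > 0, ∀ᵐ x ∂volume.restrict P.D, |P.elastic u v x| ≤
      K * (t * ddot (u.strain x) (u.strain x) + t⁻¹ * ddot (v.strain x) (v.strain x)) := by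
  have h (i j k l) : ∃ B : ℝ, ∀ᵐ x ∂volume.restrict P.D, |P.C x i j k l| ≤ B := by
    set f := (hP.C_bdd i j k l).toLp with hf
    refine ⟨‖f‖, ?_⟩
    filter_upwards [Lp_top_ae_abs_le f, (hP.C_bdd i j k l).coeFn_toLp] with x h1 h2
    rwa [h2] at h1
  choose B hB using h
  set B' : Fin d × Fin d × Fin d × Fin d → ℝ := fun z => |B z.1 z.2.1 z.2.2.1 z.2.2.2| with hB'
  set B₀ := ∑ z, B' z with hB₀
  have hB₀0 : 0 ≤ B₀ := Finset.sum_nonneg fun _ _ => abs_nonneg _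
  have hle (i j k l) : B i j k l ≤ B₀ :=
    (le_abs_self _).trans (Finset.single_le_sum (f := B') (fun _ _ => abs_nonneg _)
      (Finset.mem_univ (i, j, k, l)))
  refine ⟨B₀ * d ^ 2, by positivity, fun u v t ht => ?_⟩
  have hall : ∀ᵐ x ∂volume.restrict P.D, ∀ i j k l, |P.C x i j k l| ≤ B₀ := by
    simp only [ae_all_iff]
    intro i j k l
    filter_upwards [hB i j k l] with x hx using hx.trans (hle i j k l)
  filter_upwards [hall] with x hx
  exact abs_ddot_app_le hx hB₀0 _ _ ht

/-- Bound of a weighted elastic form, with a weight of size `δ`. -/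
theorem Problem.Admissible.exists_integral_mul_elastic_le (hP : P.Admissible) :
    ∃ K : ℝ, 0 ≤ K ∧ ∀ u v : H1 P.D, ∀ t > 0, ∀ (δ : ℝ) (κ : E d → ℝ), 0 ≤ δ →
      (∀ᵐ x ∂volume.restrict P.D, |κ x| ≤ δ) →
      |∫ x in P.D, κ x * P.elastic u v x| ≤ δ * K * (t * u.energy + t⁻¹ * v.energy) := by
  obtain ⟨K, hK, h⟩ := hP.exists_abs_elastic_le
  refine ⟨K, hK, fun u v t ht δ κ hδ hκ => ?_⟩
  have hint : Integrable (fun x => δ * K * (t * ddot (u.strain x) (u.strain x) +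
      t⁻¹ * ddot (v.strain x) (v.strain x))) (volume.restrict P.D) :=
    (((u.integrable_ddot_strain u).const_mul t).add
      ((v.integrable_ddot_strain v).const_mul t⁻¹)).const_mul _
  refine abs_integral_le_integral_abs.trans ?_
  refine (integral_mono_of_nonneg (Eventually.of_forall fun x => abs_nonneg _) hint ?_).trans
    (le_of_eq ?_)
  · filter_upwards [h u v t ht, hκ] with x h1 h2
    rw [abs_mul, mul_assoc]
    exact mul_le_mul h2 h1 (abs_nonneg _) hδ
  · rw [integral_const_mul, integral_add ((u.integrable_ddot_strain u).const_mul t)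
      ((v.integrable_ddot_strain v).const_mul t⁻¹), integral_const_mul, integral_const_mul]
    rfl

theorem Problem.integral_Fstar (φ : P.Phase) (u v : H1 P.D) :
    ∫ x in P.D, ddot ((P.Fstar x (φ x)).app (u.strain x)) (v.strain x) =
      ∫ x in P.D, interp P.kmin P.q (φ x) * P.elastic u v x := by
  simp only [Problem.Fstar, ddot_smul_app, Problem.elastic]

theorem Problem.Admissible.integrable_mul_elastic (hP : P.Admissible) {κ : E d → ℝ} {M : ℝ}
    (hκ : AEStronglyMeasurable κ (volume.restrict P.D))
    (hM : ∀ᵐ x ∂volume.restrict P.D, |κ x| ≤ M) (u v : H1 P.D) :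
    Integrable (fun x => κ x * P.elastic u v x) (volume.restrict P.D) :=
  (hP.integrable_elastic u v).bdd_mul hκ hM

theorem Problem.aestronglyMeasurable_interp (φ : P.Phase) :
    AEStronglyMeasurable (fun x => interp P.kmin P.q (φ x)) (volume.restrict P.D) :=
  (continuous_interp _ _).comp_aestronglyMeasurable (Lp.aestronglyMeasurable φ)

theorem Problem.Admissible.integrable_interp_mul_elastic (hP : P.Admissible) (φ : P.Phase)
    (u v : H1 P.D) :
    Integrable (fun x => interp P.kmin P.q (φ x) * P.elastic u v x) (volume.restrict P.D) := by
  obtain ⟨M, -, hM, -⟩ := exists_interp_bounds P.kmin P.q ‖φ‖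
  refine hP.integrable_mul_elastic (P.aestronglyMeasurable_interp φ) (M := M) ?_ u v
  filter_upwards [Lp_top_ae_abs_le φ] with x hx using hM _ hx

/-! ### The contact boundary -/

theorem Problem.Admissible.memLp_tang (hP : P.Admissible) (v : H1 P.D) :
    MemLp (P.tang v) 2 ((surface P.D).restrict P.bdC) := by
  have ht := v.memLp_trace.restrict P.bdC
  refine ht.mono (ht.1.inner hP.measurable_τ) ?_
  filter_upwards [hP.tangent] with x hx
  refine (norm_inner_le_norm _ _).trans ?_
  rw [hx.1, mul_one]

theorem Problem.Admissible.integral_tang_sq_le (hP : P.Admissible) (v : H1 P.D) :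
    ∫ x in P.bdC, P.tang v x ^ 2 ∂surface P.D ≤ ∫ x, ‖v.trace x‖ ^ 2 ∂surface P.D := by
  refine le_trans ?_ (setIntegral_le_integral (s := P.bdC) v.memLp_trace.norm.integrable_sq
    (Eventually.of_forall fun _ => sq_nonneg _))
  refine integral_mono_ae (hP.memLp_tang v).integrable_sq
    (v.memLp_trace.norm.integrable_sq.restrict) ?_
  filter_upwards [hP.tangent] with x hx
  have h := norm_inner_le_norm (𝕜 := ℝ) (v.trace x) (P.τ x)
  rw [hx.1, mul_one, Real.norm_eq_abs] at h
  rw [← sq_abs]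
  exact pow_le_pow_left₀ (abs_nonneg _) h 2

/-- The smallness condition makes the linearized problem coercive. -/
theorem Problem.Admissible.exists_coercive (hP : P.Admissible) :
    ∃ c > 0, ∀ v ∈ P.VD, c * v.energy ≤ P.kmin * P.mC * v.energy -
      P.αj * ∫ x in P.bdC, P.tang v x ^ 2 ∂surface P.D := by
  have hkm : 0 < P.kmin * P.mC := mul_pos hP.kmin_pos hP.mC_pos
  -- A finite lower bound `l` stands in for the eigenvalue, which may be `∞`.
  obtain ⟨l, hl, hle⟩ : ∃ l : ℝ, P.αj < l * (P.kmin * P.mC) ∧ ENNReal.ofReal l ≤ P.eigenvalue := by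
    by_cases htop : P.eigenvalue = ⊤
    · refine ⟨P.αj / (P.kmin * P.mC) + 1, ?_, by simp [htop]⟩
      rw [add_mul, div_mul_cancel₀ _ hkm.ne']
      linarith
    · refine ⟨P.eigenvalue.toReal, ?_, by rw [ENNReal.ofReal_toReal htop]⟩
      have := hP.small
      rw [← ENNReal.ofReal_toReal htop, ← ENNReal.ofReal_mul ENNReal.toReal_nonneg] at this
      exact (ENNReal.ofReal_lt_ofReal_iff_of_nonneg hP.αj_nonneg).1 this
  have hl0 : 0 < l := by
    by_contra! h
    nlinarith [hP.αj_nonneg]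
  have hray : ∀ v ∈ P.VD, l * (∫ x in P.bdC, P.tang v x ^ 2 ∂surface P.D) ≤ v.energy := by
    intro v hv
    set T := ∫ x in P.bdC, P.tang v x ^ 2 ∂surface P.D with hT
    have hT0 : 0 ≤ T := integral_nonneg fun _ => sq_nonneg _
    rcases hT0.eq_or_lt with h0 | hpos
    · rw [← h0, mul_zero]
      exact v.energy_nonneg
    · have h1 : P.eigenvalue ≤ ENNReal.ofReal (v.energy / T) :=
        iInf_le_of_le v (iInf_le_of_le hv (iInf_le_of_le hpos le_rfl))
      have h2 := (ENNReal.ofReal_le_ofReal_iff (div_nonneg v.energy_nonneg hT0)).1 (hle.trans h1)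
      rwa [le_div_iff₀ hpos] at h2
  -- The friction defect `αj * ‖v_τ‖ ^ 2` is at most `αj / l` times the energy; the smallness
  -- condition leaves a positive rest.
  refine ⟨P.kmin * P.mC - P.αj / l, ?_, fun v hv => ?_⟩
  · rw [gt_iff_lt, sub_pos, div_lt_iff₀ hl0]
    linarith
  · have h := mul_le_mul_of_nonneg_left (hray v hv) (div_nonneg hP.αj_nonneg hl0.le)
    have h' : P.αj / l * (l * ∫ x in P.bdC, P.tang v x ^ 2 ∂surface P.D) =
        P.αj * ∫ x in P.bdC, P.tang v x ^ 2 ∂surface P.D := by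
      field_simp
    rw [h'] at h
    linarith

end Elastic

/-! ### Stability of the state -/

section State

variable {d : ℕ} {P : Problem d}

theorem Problem.elastic_sub_left (u v w : H1 P.D) (x : E d) :
    P.elastic (u.sub v) w x = P.elastic u w x - P.elastic v w x := by
  simp only [Problem.elastic, ddot_app_eq_sum, H1.strain_sub, Matrix.sub_apply, sub_mul, mul_sub,
    Finset.sum_sub_distrib]

theorem Problem.Admissible.isFiniteMeasure_restrict (hP : P.Admissible) :
    IsFiniteMeasure (volume.restrict P.D) :=
  ⟨by rw [Measure.restrict_apply_univ]; exact hP.lipschitz.isBounded.measure_lt_top⟩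

theorem Problem.Admissible.bddLip_deriv_j (hP : P.Admissible) : BddLip (deriv P.j) :=
  bddLip_deriv_potential hP.ε_pos hP.α_nonneg

theorem Problem.Admissible.bddLip_deriv_deriv_j (hP : P.Admissible) :
    BddLip (deriv (deriv P.j)) :=
  bddLip_deriv_deriv_potential hP.ε_pos hP.α_nonneg

theorem Problem.Admissible.memLp_comp_tang_mul (hP : P.Admissible) {g : ℝ → ℝ} (hg : BddLip g)
    (u v : H1 P.D) :
    MemLp (fun x => g (P.tang u x) * P.tang v x) 2 ((surface P.D).restrict P.bdC) := by
  have hc := hg.continuous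
  obtain ⟨M, -, hM, -⟩ := hg
  refine ((hP.memLp_tang v).const_mul M).mono
    ((hc.comp_aestronglyMeasurable (hP.memLp_tang u).1).mul (hP.memLp_tang v).1)
    (Eventually.of_forall fun x => ?_)
  rw [norm_mul, norm_mul]
  gcongr
  exact (hM _).trans (le_abs_self M)

theorem Problem.Admissible.integrable_comp_tang_mul (hP : P.Admissible) {g : ℝ → ℝ}
    (hg : BddLip g) (u v : H1 P.D) :
    Integrable (fun x => g (P.tang u x) * P.tang v x) ((surface P.D).restrict P.bdC) := by
  have := hP.lipschitz.isFiniteMeasure_surface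
  exact (hP.memLp_comp_tang_mul hg u v).integrable (by norm_num)

/-- The equation for the difference of two states. -/
theorem Problem.Admissible.state_sub (hP : P.Admissible) {φ ψ : P.Phase} {u u' : H1 P.D}
    (hu : P.IsState φ u) (hu' : P.IsState ψ u') {v : H1 P.D} (hv : v ∈ P.VD) :
    (∫ x in P.D, interp P.kmin P.q (ψ x) * P.elastic (u'.sub u) v x) +
        ∫ x in P.bdC, (deriv P.j (P.tang u' x) - deriv P.j (P.tang u x)) * P.tang v x
          ∂surface P.D =
      -∫ x in P.D, (interp P.kmin P.q (ψ x) - interp P.kmin P.q (φ x)) * P.elastic u v x := by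
  have h1 := hu.2 v hv
  have h2 := hu'.2 v hv
  rw [P.integral_Fstar] at h1 h2
  have i1 := hP.integrable_interp_mul_elastic ψ u' v
  have i2 := hP.integrable_interp_mul_elastic ψ u v
  have i3 := hP.integrable_interp_mul_elastic φ u v
  have j1 := hP.integrable_comp_tang_mul hP.bddLip_deriv_j u' v
  have j2 := hP.integrable_comp_tang_mul hP.bddLip_deriv_j u v
  simp only [P.elastic_sub_left, mul_sub, sub_mul]
  rw [integral_sub i1 i2, integral_sub j1 j2, integral_sub i2 i3]
  linarith

theorem Problem.ae_abs_sub_le (φ ψ : P.Phase) :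
    ∀ᵐ x ∂volume.restrict P.D, |ψ x - φ x| ≤ ‖ψ - φ‖ := by
  filter_upwards [Lp_top_ae_abs_le (ψ - φ), Lp.coeFn_sub ψ φ] with x h1 h2
  rwa [h2, Pi.sub_apply] at h1

theorem Problem.ae_abs_le_add_one {φ ψ : P.Phase} (h : ‖ψ - φ‖ ≤ 1) :
    ∀ᵐ x ∂volume.restrict P.D, |ψ x| ≤ ‖φ‖ + 1 := by
  filter_upwards [Lp_top_ae_abs_le ψ] with x hx
  have := norm_le_insert' ψ φ
  linarith

theorem Problem.exists_abs_interp_sub_le (φ : P.Phase) :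
    ∃ M : ℝ, 0 ≤ M ∧ ∀ ψ : P.Phase, ‖ψ - φ‖ ≤ 1 → ∀ᵐ x ∂volume.restrict P.D,
      |interp P.kmin P.q (ψ x) - interp P.kmin P.q (φ x)| ≤ M * ‖ψ - φ‖ := by
  obtain ⟨M, hM, -, -, h⟩ := exists_interp_bounds P.kmin P.q (‖φ‖ + 1)
  refine ⟨M, hM, fun ψ hψ => ?_⟩
  filter_upwards [P.ae_abs_sub_le φ ψ, P.ae_abs_le_add_one hψ, Lp_top_ae_abs_le φ]
    with x h1 h2 h3
  exact (h _ _ (h3.trans (by linarith)) h2).1.trans (by gcongr)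

/-- The weight `t = 2 * A / c` turns `A * t⁻¹ * y` into `c / 2 * y`, which the left side absorbs.
For `A = 0` this weight is not positive, hence the separate case. -/
theorem le_mul_of_forall_weight {c A x y : ℝ} (hc : 0 < c) (hA : 0 ≤ A)
    (h : ∀ t > 0, c * y ≤ A * (t * x + t⁻¹ * y)) : y ≤ 4 * A ^ 2 / c ^ 2 * x := by
  rcases hA.eq_or_lt with rfl | hA
  · have := h 1 one_pos
    simp only [zero_mul] at this
    have hy : y ≤ 0 := by
      by_contra! hy
      nlinarith
    simpa using hy
  · have := h (2 * A / c) (by positivity)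
    have e : A * (2 * A / c * x + (2 * A / c)⁻¹ * y) = 2 * A ^ 2 / c * x + c / 2 * y := by
      field_simp
    rw [e] at this
    have h2 : c / 2 * y ≤ 2 * A ^ 2 / c * x := by linarith
    have h3 : y = 2 / c * (c / 2 * y) := by field_simp
    rw [h3]
    calc 2 / c * (c / 2 * y) ≤ 2 / c * (2 * A ^ 2 / c * x) := by gcongr
      _ = _ := by field_simp; ring

/-- The stiffness and the friction terms of the difference of two states control its energy. -/
theorem Problem.Admissible.coercive_sub_le (hP : P.Admissible) {c : ℝ}
    (hc : ∀ v ∈ P.VD, c * v.energy ≤ P.kmin * P.mC * v.energy -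
      P.αj * ∫ x in P.bdC, P.tang v x ^ 2 ∂surface P.D) (ψ : P.Phase) {u u' : H1 P.D}
    (hu : u ∈ P.VD) (hu' : u' ∈ P.VD) :
    c * (u'.sub u).energy ≤
      (∫ x in P.D, interp P.kmin P.q (ψ x) * P.elastic (u'.sub u) (u'.sub u) x) +
        ∫ x in P.bdC, (deriv P.j (P.tang u' x) - deriv P.j (P.tang u x)) *
          P.tang (u'.sub u) x ∂surface P.D := by
  set w := u'.sub u with hw
  have h1 : P.kmin * P.mC * w.energy ≤
      ∫ x in P.D, interp P.kmin P.q (ψ x) * P.elastic w w x := by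
    rw [H1.energy, ← integral_const_mul]
    refine integral_mono_ae ((w.integrable_ddot_strain w).const_mul _)
      (hP.integrable_interp_mul_elastic ψ w w) ?_
    filter_upwards [hP.C_stable] with x hx
    have h2 := hx _ (w.isSymm_strain x)
    have h3 : 0 ≤ P.mC * ddot (w.strain x) (w.strain x) :=
      mul_nonneg hP.mC_pos.le (ddot_self_nonneg _)
    rw [mul_assoc]
    exact mul_le_mul (le_interp _ _ _) h2 h3 (hP.kmin_pos.le.trans (le_interp _ _ _))
  have h2 : -(P.αj * ∫ x in P.bdC, P.tang w x ^ 2 ∂surface P.D) ≤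
      ∫ x in P.bdC, (deriv P.j (P.tang u' x) - deriv P.j (P.tang u x)) * P.tang w x
        ∂surface P.D := by
    rw [← integral_const_mul, ← integral_neg]
    have j1 : Integrable (fun x => (deriv P.j (P.tang u' x) - deriv P.j (P.tang u x)) *
        P.tang w x) ((surface P.D).restrict P.bdC) := by
      simp only [sub_mul]
      exact (hP.integrable_comp_tang_mul hP.bddLip_deriv_j u' w).sub
        (hP.integrable_comp_tang_mul hP.bddLip_deriv_j u w)
    refine integral_mono ((hP.memLp_tang w).integrable_sq.const_mul _).neg j1 fun x => ?_
    have h3 := hP.relaxed_monotone (P.tang u x) (P.tang u' x)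
    rw [sq_abs] at h3
    simp only [hw, P.tang_sub]
    nlinarith
  have h3 := hc w (P.sub_mem_VD hu' hu)
  linarith

/-- The state is Lipschitz continuous with respect to the phase field, locally. -/
theorem Problem.Admissible.exists_energy_sub_le (hP : P.Admissible) {u : P.Phase → H1 P.D}
    (hu : ∀ ψ : P.Phase, P.IsState ψ (u ψ)) (φ : P.Phase) :
    ∃ C : ℝ, 0 ≤ C ∧ ∀ ψ : P.Phase, ‖ψ - φ‖ ≤ 1 →
      ((u ψ).sub (u φ)).energy ≤ C * ‖ψ - φ‖ ^ 2 := by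
  obtain ⟨c, hc0, hc⟩ := hP.exists_coercive
  obtain ⟨M, hM0, hM⟩ := P.exists_abs_interp_sub_le φ
  obtain ⟨K, hK0, hK⟩ := hP.exists_integral_mul_elastic_le
  refine ⟨4 * (M * K) ^ 2 / c ^ 2 * (u φ).energy,
    mul_nonneg (by positivity) (u φ).energy_nonneg, fun ψ hψ => ?_⟩
  set w := (u ψ).sub (u φ) with hw
  have hcoer := hP.coercive_sub_le hc ψ (hu φ).1 (hu ψ).1
  -- The difference equation is tested with `w` itself. Its right side is a weight of size `M * ‖ψ -
  -- φ‖` against the elastic product of `u φ` and `w`.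
  rw [hP.state_sub (hu φ) (hu ψ) (P.sub_mem_VD (hu ψ).1 (hu φ).1)] at hcoer
  have h := le_mul_of_forall_weight (x := (u φ).energy) (y := w.energy)
    (A := M * ‖ψ - φ‖ * K) hc0 (by positivity) fun t ht => hcoer.trans ((neg_le_abs _).trans
      (hK (u φ) w t ht _ _ (by positivity) (hM ψ hψ)))
  refine h.trans (le_of_eq ?_)
  ring

end State

/-! ### First-order expansion of the objective -/

section Expansion

variable {d : ℕ} {P : Problem d}

theorem Problem.Admissible.surface_restrict_boundary (hP : P.Admissible) :
    (surface P.D).restrict (P.bdD ∪ ((P.bdN ∪ P.bd0) ∪ P.bdC)) = surface P.D := by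
  have h : P.bdD ∪ ((P.bdN ∪ P.bd0) ∪ P.bdC) = frontier P.D := by
    rw [← hP.boundary]
    ext x
    simp only [mem_union]
    tauto
  rw [h, surface, Measure.restrict_restrict isClosed_frontier.measurableSet, inter_self]

/-- For `v ∈ V_D` the boundary term of the adjoint problem is an integral over `∂D`. -/
theorem Problem.Admissible.integral_surface_eq (hP : P.Admissible) (u : H1 P.D) {v : H1 P.D}
    (hv : v ∈ P.VD) :
    ∫ x, fderiv ℝ P.r (u.trace x) (v.trace x) ∂surface P.D =
      (∫ x in P.bdN ∪ P.bd0, fderiv ℝ P.r (u.trace x) (v.trace x) ∂surface P.D) +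
        ∫ x in P.bdC, fderiv ℝ P.r (u.trace x)
          (tangentialPart (outerNormal P.D x) (v.trace x)) ∂surface P.D := by
  have := hP.lipschitz.isFiniteMeasure_surface
  obtain ⟨K, hK⟩ := hP.r_lip
  have hint := integrable_fderiv_comp hK u.memLp_trace v.memLp_trace
  -- On the contact part the trace of `v` is already tangential, and on the Dirichlet part it
  -- vanishes.
  have hC : ∫ x in P.bdC, fderiv ℝ P.r (u.trace x)
      (tangentialPart (outerNormal P.D x) (v.trace x)) ∂surface P.D =
      ∫ x in P.bdC, fderiv ℝ P.r (u.trace x) (v.trace x) ∂surface P.D := by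
    refine integral_congr_ae ?_
    filter_upwards [hv.2] with x hx
    rw [tangentialPart, hx, zero_smul, sub_zero]
  have hD : ∫ x in P.bdD, fderiv ℝ P.r (u.trace x) (v.trace x) ∂surface P.D = 0 := by
    refine integral_eq_zero_of_ae ?_
    filter_upwards [hv.1] with x hx
    rw [hx, map_zero, Pi.zero_apply]
  have d1 : Disjoint P.bdD ((P.bdN ∪ P.bd0) ∪ P.bdC) :=
    (hP.disjoint_DN.union_right hP.disjoint_D0).union_right hP.disjoint_DC
  have d2 : Disjoint (P.bdN ∪ P.bd0) P.bdC := hP.disjoint_NC.union_left hP.disjoint_C0.symm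
  rw [hC, ← setIntegral_union d2 hP.measurable_bdC hint.integrableOn hint.integrableOn]
  conv_lhs => rw [← hP.surface_restrict_boundary]
  rw [setIntegral_union d1 ((hP.measurable_bdN.union hP.measurable_bd0).union hP.measurable_bdC)
    hint.integrableOn hint.integrableOn, hD, zero_add]

theorem Problem.Admissible.integrable_interpDeriv_mul_elastic (hP : P.Admissible) (φ : P.Phase)
    (u v : H1 P.D) :
    Integrable (fun x => interpDeriv P.kmin P.q (φ x) * P.elastic u v x)
      (volume.restrict P.D) := by
  obtain ⟨M, -, -, hM, -⟩ := exists_interp_bounds P.kmin P.q ‖φ‖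
  refine hP.integrable_mul_elastic ((measurable_interpDeriv _ _).comp_aemeasurable
    (Lp.aestronglyMeasurable φ).aemeasurable).aestronglyMeasurable (M := M) ?_ u v
  filter_upwards [Lp_top_ae_abs_le φ] with x hx using hM _ hx

/-- Off the kink the tensor-valued `deriv` equals `interpDeriv • C`. This provides a factor whose
measurability and bounds are known. -/
theorem Problem.sensitivity_ae_eq {φ : P.Phase}
    (hφ : ∀ᵐ x ∂volume.restrict P.D, φ x ^ P.q ≠ P.kmin) (u p : H1 P.D) :
    P.sensitivity φ u p =ᵐ[volume.restrict P.D]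
      fun x => interpDeriv P.kmin P.q (φ x) * P.elastic u p x := by
  filter_upwards [hφ] with x hx
  have h : HasDerivAt (P.Fstar x) (interpDeriv P.kmin P.q (φ x) • P.C x) (φ x) :=
    (hasDerivAt_interp hx).smul_const (P.C x)
  rw [Problem.sensitivity, h.deriv, ddot_smul_app, Problem.elastic]

/-- The error of the first-order expansion consists of the remainders of the interpolation, of the
friction law and of the objective, and of a product of two increments. -/
theorem Problem.Admissible.exists_objective_sub_le (hP : P.Admissible) :
    ∃ K : ℝ, 0 ≤ K ∧ ∀ {φ ψ : P.Phase} {u u' p : H1 P.D}, P.IsState φ u → P.IsState ψ u' →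
      P.IsAdjoint φ u p →
      |P.objective u' - P.objective u -
          ∫ x in P.D, interpDeriv P.kmin P.q (φ x) * P.elastic u p x * (ψ x - φ x)| ≤
        |∫ x in P.D, (interp P.kmin P.q (ψ x) - interp P.kmin P.q (φ x) -
          interpDeriv P.kmin P.q (φ x) * (ψ x - φ x)) * P.elastic u p x| +
        |∫ x in P.D, (interp P.kmin P.q (ψ x) - interp P.kmin P.q (φ x)) *
          P.elastic (u'.sub u) p x| +
        |∫ x in P.bdC, (deriv P.j (P.tang u' x) - deriv P.j (P.tang u x) -
          deriv (deriv P.j) (P.tang u x) * P.tang (u'.sub u) x) * P.tang p x ∂surface P.D| +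
        K * (u'.sub u).energy := by
  obtain ⟨C, hC0, hC⟩ := hP.exists_korn
  obtain ⟨Km, hKm⟩ := hP.m_lip
  obtain ⟨Kr, hKr⟩ := hP.r_lip
  refine ⟨Km * C + Kr * C, by positivity, fun {φ ψ u u' p} hu hu' hp => ?_⟩
  have := hP.lipschitz.isFiniteMeasure_surface
  have := hP.isFiniteMeasure_restrict
  set w := u'.sub u with hw
  have hwV : w ∈ P.VD := P.sub_mem_VD hu'.1 hu.1
  have hm := abs_integral_taylor_le hP.m_diff hKm u.memLp_val u'.memLp_val
  have hr := abs_integral_taylor_le hP.r_diff hKr u.memLp_trace u'.memLp_trace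
  have hm' : Km * (∫ x in P.D, ‖u'.val x - u.val x‖ ^ 2) ≤ Km * (C * w.energy) := by
    gcongr
    exact (hC w hwV).1
  have hr' : Kr * (∫ x, ‖u'.trace x - u.trace x‖ ^ 2 ∂surface P.D) ≤ Kr * (C * w.energy) := by
    gcongr
    exact (hC w hwV).2
  have hadj := hp.2 w hwV
  have hst := hP.state_sub hu hu' hp.1
  have hsurf := hP.integral_surface_eq u hwV
  have hcomm : ∫ x in P.D, interp P.kmin P.q (φ x) * P.elastic p w x =
      ∫ x in P.D, interp P.kmin P.q (φ x) * P.elastic w p x := by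
    refine integral_congr_ae ?_
    filter_upwards [hP.elastic_comm p w] with x hx
    rw [hx]
  rw [P.integral_Fstar, hcomm] at hadj
  have e1 : ∫ x in P.D, (interp P.kmin P.q (ψ x) - interp P.kmin P.q (φ x)) * P.elastic w p x =
      (∫ x in P.D, interp P.kmin P.q (ψ x) * P.elastic w p x) -
        ∫ x in P.D, interp P.kmin P.q (φ x) * P.elastic w p x := by
    simp only [sub_mul]
    exact integral_sub (hP.integrable_interp_mul_elastic ψ w p)
      (hP.integrable_interp_mul_elastic φ w p)
  have i1 : Integrable (fun x => (interp P.kmin P.q (ψ x) - interp P.kmin P.q (φ x)) *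
      P.elastic u p x) (volume.restrict P.D) := by
    simp only [sub_mul]
    exact (hP.integrable_interp_mul_elastic ψ u p).sub (hP.integrable_interp_mul_elastic φ u p)
  have i2 : Integrable (fun x => interpDeriv P.kmin P.q (φ x) * P.elastic u p x *
      (ψ x - φ x)) (volume.restrict P.D) :=
    (hP.integrable_interpDeriv_mul_elastic φ u p).mul_bdd
      ((Lp.aestronglyMeasurable ψ).sub (Lp.aestronglyMeasurable φ)) (P.ae_abs_sub_le φ ψ)
  have e2 : ∫ x in P.D, (interp P.kmin P.q (ψ x) - interp P.kmin P.q (φ x) -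
      interpDeriv P.kmin P.q (φ x) * (ψ x - φ x)) * P.elastic u p x =
      (∫ x in P.D, (interp P.kmin P.q (ψ x) - interp P.kmin P.q (φ x)) * P.elastic u p x) -
        ∫ x in P.D, interpDeriv P.kmin P.q (φ x) * P.elastic u p x * (ψ x - φ x) := by
    rw [← integral_sub i1 i2]
    congr 1 with x
    ring
  have j1 : Integrable (fun x => (deriv P.j (P.tang u' x) - deriv P.j (P.tang u x)) *
      P.tang p x) ((surface P.D).restrict P.bdC) := by
    simp only [sub_mul]
    exact (hP.integrable_comp_tang_mul hP.bddLip_deriv_j u' p).sub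
      (hP.integrable_comp_tang_mul hP.bddLip_deriv_j u p)
  have j2 : Integrable (fun x => deriv (deriv P.j) (P.tang u x) * P.tang p x * P.tang w x)
      ((surface P.D).restrict P.bdC) :=
    (hP.memLp_comp_tang_mul hP.bddLip_deriv_deriv_j u p).integrable_mul (hP.memLp_tang w)
  have e3 : ∫ x in P.bdC, (deriv P.j (P.tang u' x) - deriv P.j (P.tang u x) -
      deriv (deriv P.j) (P.tang u x) * P.tang w x) * P.tang p x ∂surface P.D =
      (∫ x in P.bdC, (deriv P.j (P.tang u' x) - deriv P.j (P.tang u x)) * P.tang p x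
        ∂surface P.D) -
        ∫ x in P.bdC, deriv (deriv P.j) (P.tang u x) * P.tang p x * P.tang w x ∂surface P.D := by
    rw [← integral_sub j1 j2]
    congr 1 with x
    ring
  rw [e1, e2, e3, Problem.objective, Problem.objective]
  change |_ - _ - ∫ x in P.D, fderiv ℝ P.m (u.val x) (w.val x)| ≤ _ at hm
  change |_ - _ - ∫ x, fderiv ℝ P.r (u.trace x) (w.trace x) ∂surface P.D| ≤ _ at hr
  rw [hsurf] at hr
  generalize (∫ x in P.D, interp P.kmin P.q (ψ x) * P.elastic w p x) = a1 at *
  generalize (∫ x in P.D, interp P.kmin P.q (φ x) * P.elastic w p x) = a2 at *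
  generalize (∫ x in P.D, (interp P.kmin P.q (ψ x) - interp P.kmin P.q (φ x)) *
    P.elastic u p x) = a3 at *
  generalize (∫ x in P.D, interpDeriv P.kmin P.q (φ x) * P.elastic u p x * (ψ x - φ x)) = a4 at *
  generalize (∫ x in P.bdC, (deriv P.j (P.tang u' x) - deriv P.j (P.tang u x)) * P.tang p x
        ∂surface P.D) = a5 at *
  generalize (∫ x in P.bdC, deriv (deriv P.j) (P.tang u x) * P.tang p x * P.tang w x
    ∂surface P.D) = a6 at *
  have hm2 := hm.trans hm'
  have hr2 := hr.trans hr'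
  -- The state equation tested with `p` reads `a1 + a5 = -a3`. The adjoint equation tested with `w`
  -- expresses the linear terms of the objective as `-(a2 + a6)`. Together they give this exact
  -- identity.
  have key : (∫ x in P.D, P.m (u'.val x)) + (∫ x, P.r (u'.trace x) ∂surface P.D) -
      ((∫ x in P.D, P.m (u.val x)) + ∫ x, P.r (u.trace x) ∂surface P.D) - a4 =
      (a3 - a4) + (a1 - a2) + (a5 - a6) +
      (((∫ x in P.D, P.m (u'.val x)) - (∫ x in P.D, P.m (u.val x)) -
        ∫ x in P.D, fderiv ℝ P.m (u.val x) (w.val x)) +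
      ((∫ x, P.r (u'.trace x) ∂surface P.D) - (∫ x, P.r (u.trace x) ∂surface P.D) -
        ((∫ x in P.bdN ∪ P.bd0, fderiv ℝ P.r (u.trace x) (w.trace x) ∂surface P.D) +
        ∫ x in P.bdC, fderiv ℝ P.r (u.trace x)
          (tangentialPart (outerNormal P.D x) (w.trace x)) ∂surface P.D))) := by
    linarith
  rw [key]
  refine (abs_add_le _ _).trans (add_le_add (abs_add_three _ _ _) ?_)
  refine (abs_add_le _ _).trans ?_
  rw [add_mul, mul_assoc, mul_assoc]
  exact add_le_add hm2 hr2

/-- The remainder of the interpolation function is of lower order, when it is tested with an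
integrable function. -/
theorem Problem.Admissible.exists_interp_remainder_le (hP : P.Admissible) {φ : P.Phase}
    (hφ : ∀ᵐ x ∂volume.restrict P.D, φ x ^ P.q ≠ P.kmin) (u p : H1 P.D) {e : ℝ} (he : 0 < e) :
    ∃ ρ > 0, ∀ ψ : P.Phase, ‖ψ - φ‖ ≤ ρ →
      |∫ x in P.D, (interp P.kmin P.q (ψ x) - interp P.kmin P.q (φ x) -
        interpDeriv P.kmin P.q (φ x) * (ψ x - φ x)) * P.elastic u p x| ≤ e * ‖ψ - φ‖ := by
  obtain ⟨M, hM0, -, -, hM⟩ := exists_interp_bounds P.kmin P.q (‖φ‖ + 1)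
  set f := P.elastic u p with hf
  have hfi : Integrable f (volume.restrict P.D) := hP.integrable_elastic u p
  set g : E d → ℝ := fun x => |φ x ^ P.q - P.kmin| with hg
  have hgm : Measurable g :=
    (((Lp.stronglyMeasurable φ).measurable.pow_const _).sub measurable_const).norm
  obtain ⟨ρ, hρ, hρ'⟩ := exists_setIntegral_le (μ := volume.restrict P.D) hfi hgm
    (by filter_upwards [hφ] with x hx using abs_pos.2 (sub_ne_zero.2 hx))
    (e := e / (2 * (2 * M + 1))) (by positivity)
  set I := ∫ x in P.D, |f x| with hI
  have hI0 : 0 ≤ I := integral_nonneg fun _ => abs_nonneg _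
  refine ⟨min 1 (min (ρ / (M + 1)) (e / (2 * (M * I + 1)))), by positivity, fun ψ hψ => ?_⟩
  set δ := ‖ψ - φ‖ with hδ
  have hδ0 : 0 ≤ δ := norm_nonneg _
  have hδ1 : δ ≤ 1 := hψ.trans (min_le_left _ _)
  have hδ2 : M * δ ≤ ρ := by
    have h := hψ.trans ((min_le_right _ _).trans (min_le_left _ _))
    rw [le_div_iff₀ (by positivity)] at h
    nlinarith
  have hδ3 : M * I * δ ≤ e / 2 := by
    have h := hψ.trans ((min_le_right _ _).trans (min_le_right _ _))
    rw [le_div_iff₀ (by positivity)] at h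
    nlinarith
  -- Close to the kink the remainder is only `2 * M * δ`, but the integral of `|f|` over `s` is
  -- small; off `s` the perturbation stays on one branch and the remainder is quadratic.
  set s : Set (E d) := {x | g x ≤ M * δ} with hs
  have hsm : MeasurableSet s := measurableSet_le hgm measurable_const
  have hbound : Integrable (fun x => M * δ ^ 2 * |f x| +
      s.indicator (fun x => 2 * M * δ * |f x|) x) (volume.restrict P.D) :=
    (hfi.abs.const_mul _).add ((hfi.abs.const_mul _).indicator hsm)
  refine abs_integral_le_integral_abs.trans ((integral_mono_of_nonneg
    (Eventually.of_forall fun x => abs_nonneg _) hbound ?_).trans ?_)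
  · filter_upwards [P.ae_abs_sub_le φ ψ, P.ae_abs_le_add_one hδ1, Lp_top_ae_abs_le φ]
      with x h1 h2 h3
    obtain ⟨-, h4, h5⟩ := hM (φ x) (ψ x) (h3.trans (by linarith)) h2
    rw [abs_mul]
    by_cases hx : x ∈ s
    · rw [indicator_of_mem hx]
      have h6 : 2 * M * |ψ x - φ x| ≤ 2 * M * δ := by gcongr
      have h7 := mul_le_mul_of_nonneg_right (h4.trans h6) (abs_nonneg (f x))
      have h8 : 0 ≤ M * δ ^ 2 * |f x| := by positivity
      linarith
    · rw [indicator_of_notMem hx, add_zero]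
      have h6 : M * |ψ x - φ x| < |φ x ^ P.q - P.kmin| :=
        lt_of_le_of_lt (by gcongr) (not_le.1 hx)
      have h7 : M * |ψ x - φ x| ^ 2 ≤ M * δ ^ 2 := by gcongr
      exact mul_le_mul_of_nonneg_right ((h5 h6).trans h7) (abs_nonneg _)
  · rw [integral_add (hfi.abs.const_mul _) ((hfi.abs.const_mul _).indicator hsm),
      integral_indicator hsm, integral_const_mul, integral_const_mul]
    have h1 := hρ' _ hδ2
    have h2 : 2 * M * δ * (∫ x in s, |f x| ∂volume.restrict P.D) ≤
        2 * M * δ * (e / (2 * (2 * M + 1))) := by gcongr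
    have h3 : 2 * M * δ * (e / (2 * (2 * M + 1))) ≤ e / 2 * δ := by
      have : 2 * M * δ * (e / (2 * (2 * M + 1))) = (2 * M / (2 * M + 1)) * (e / 2 * δ) := by
        field_simp
      rw [this]
      refine mul_le_of_le_one_left (by positivity) ?_
      rw [div_le_one (by positivity)]
      linarith
    have h4 : M * δ ^ 2 * I = M * I * δ * δ := by ring
    rw [h4]
    have h5 : M * I * δ * δ ≤ e / 2 * δ := by gcongr
    linarith

/-- The remainder of the friction law is of lower order. -/
theorem Problem.Admissible.exists_friction_remainder_le (hP : P.Admissible)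
    {u : P.Phase → H1 P.D} (hu : ∀ ψ : P.Phase, P.IsState ψ (u ψ)) (φ : P.Phase) (p : H1 P.D)
    {e : ℝ} (he : 0 < e) :
    ∃ ρ > 0, ∀ ψ : P.Phase, 0 < ‖ψ - φ‖ → ‖ψ - φ‖ ≤ ρ →
      |∫ x in P.bdC, (deriv P.j (P.tang (u ψ) x) - deriv P.j (P.tang (u φ) x) -
        deriv (deriv P.j) (P.tang (u φ) x) * P.tang ((u ψ).sub (u φ)) x) * P.tang p x
          ∂surface P.D| ≤ e * ‖ψ - φ‖ := by
  obtain ⟨M, hM0, hM⟩ := exists_deriv_potential_remainder (a := P.a) (b := P.b) hP.ε_pos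
    hP.α_nonneg
  obtain ⟨C, hC0, hC⟩ := hP.exists_korn
  obtain ⟨C', hC0', hC'⟩ := hP.exists_energy_sub_le hu φ
  obtain ⟨ρ, hρ, h⟩ := exists_integral_remainder_le (hP.memLp_tang p) (C := C * C')
    (by positivity) (e := e / (M + 1)) (by positivity)
  refine ⟨min 1 ρ, by positivity, fun ψ hδ0 hψ => ?_⟩
  set w := (u ψ).sub (u φ) with hw
  set δ := ‖ψ - φ‖ with hδ
  have hwV : w ∈ P.VD := P.sub_mem_VD (hu ψ).1 (hu φ).1
  -- Korn's inequality turns the energy bound for `w` into a bound for its tangential trace.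
  have hwt : ∫ x in P.bdC, P.tang w x ^ 2 ∂surface P.D ≤ C * C' * δ ^ 2 := by
    refine (hP.integral_tang_sq_le w).trans ((hC w hwV).2.trans ?_)
    rw [mul_assoc]
    gcongr
    exact hC' ψ (hψ.trans (min_le_left _ _))
  have hle := h δ hδ0 (hψ.trans (min_le_right _ _)) _ (hP.memLp_tang w) hwt
  have hint : Integrable (fun x => M * (|P.tang w x| * min |P.tang w x| 1 * |P.tang p x|))
      ((surface P.D).restrict P.bdC) := by
    have hc : Continuous fun t : ℝ × ℝ => |t.1| * min |t.1| 1 * |t.2| := by fun_prop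
    refine Integrable.const_mul (((hP.memLp_tang w).norm.integrable_mul
      (hP.memLp_tang p).norm).mono' (hc.comp_aestronglyMeasurable
        ((hP.memLp_tang w).1.prodMk (hP.memLp_tang p).1)) (Eventually.of_forall fun x => ?_)) M
    rw [Real.norm_eq_abs, abs_of_nonneg (by positivity)]
    refine mul_le_mul_of_nonneg_right ?_ (abs_nonneg _)
    exact mul_le_of_le_one_right (abs_nonneg _) (min_le_right _ _)
  refine abs_integral_le_integral_abs.trans ((integral_mono_of_nonneg
    (Eventually.of_forall fun x => abs_nonneg _) hint (Eventually.of_forall fun x => ?_)).trans ?_)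
  · have h1 := hM (P.tang (u φ) x) (P.tang w x)
    have h2 : P.tang (u φ) x + P.tang w x = P.tang (u ψ) x := by
      rw [hw, P.tang_sub]
      ring
    rw [h2] at h1
    have h3 := mul_le_mul_of_nonneg_right h1 (abs_nonneg (P.tang p x))
    calc _ = _ := abs_mul _ _
      _ ≤ _ := h3
      _ = _ := by ring
  · rw [integral_const_mul]
    calc _ ≤ M * (e / (M + 1) * δ) := by gcongr
      _ = M / (M + 1) * (e * δ) := by ring
      _ ≤ e * δ := by
          refine mul_le_of_le_one_left (by positivity) ?_
          rw [div_le_one (by positivity)]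
          linarith

/-- The product of the increments of stiffness and state is of second order. -/
theorem Problem.Admissible.exists_increment_le (hP : P.Admissible)
    {u : P.Phase → H1 P.D} (hu : ∀ ψ : P.Phase, P.IsState ψ (u ψ)) (φ : P.Phase) (p : H1 P.D) :
    ∃ C : ℝ, 0 ≤ C ∧ ∀ ψ : P.Phase, 0 < ‖ψ - φ‖ → ‖ψ - φ‖ ≤ 1 →
      |∫ x in P.D, (interp P.kmin P.q (ψ x) - interp P.kmin P.q (φ x)) *
        P.elastic ((u ψ).sub (u φ)) p x| ≤ C * ‖ψ - φ‖ ^ 2 := by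
  obtain ⟨C', hC0', hC'⟩ := hP.exists_energy_sub_le hu φ
  obtain ⟨M, hM0, hM⟩ := P.exists_abs_interp_sub_le φ
  obtain ⟨K, hK0, hK⟩ := hP.exists_integral_mul_elastic_le
  have hp := p.energy_nonneg
  refine ⟨M * K * (C' + p.energy), by positivity, fun ψ hδ0 hδ1 => ?_⟩
  set δ := ‖ψ - φ‖ with hδ
  -- The weight `δ⁻¹` balances the energy of the increment, of order `δ ^ 2`, against the fixed
  -- energy of `p`.
  refine (hK ((u ψ).sub (u φ)) p δ⁻¹ (by positivity) _ _ (by positivity) (hM ψ hδ1)).trans ?_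
  calc M * δ * K * (δ⁻¹ * ((u ψ).sub (u φ)).energy + δ⁻¹⁻¹ * p.energy)
      ≤ M * δ * K * (δ⁻¹ * (C' * δ ^ 2) + δ⁻¹⁻¹ * p.energy) := by
        gcongr
        exact hC' ψ hδ1
    _ = M * K * (C' + p.energy) * δ ^ 2 := by
        field_simp

/-- The sensitivity is the Fréchet derivative of the reduced objective. -/
theorem Problem.Admissible.hasFDerivAt_objective (hP : P.Admissible) {u : P.Phase → H1 P.D}
    (hu : ∀ ψ : P.Phase, P.IsState ψ (u ψ)) {φ : P.Phase}
    (hφ : ∀ᵐ x ∂volume.restrict P.D, φ x ^ P.q ≠ P.kmin) {p : H1 P.D}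
    (hp : P.IsAdjoint φ (u φ) p) {L : P.Phase →L[ℝ] ℝ}
    (hL : ∀ θ : P.Phase, L θ = ∫ x in P.D, P.sensitivity φ (u φ) p x * θ x) :
    HasFDerivAt (fun ψ : P.Phase => P.objective (u ψ)) L φ := by
  refine .of_isLittleO (Asymptotics.isLittleO_iff.2 fun e he => ?_)
  obtain ⟨K, hK0, hK⟩ := hP.exists_objective_sub_le
  obtain ⟨C', hC0', hC'⟩ := hP.exists_energy_sub_le hu φ
  obtain ⟨C, hC0, hC⟩ := hP.exists_increment_le hu φ p
  obtain ⟨ρ₁, hρ₁, h₁⟩ := hP.exists_interp_remainder_le hφ (u φ) p (e := e / 3) (by positivity)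
  obtain ⟨ρ₂, hρ₂, h₂⟩ := hP.exists_friction_remainder_le hu φ p (e := e / 3) (by positivity)
  -- The allowance `e` is shared in thirds: the interpolation remainder, the friction remainder, and
  -- all terms of second order.
  set ρ := min (min 1 (e / (3 * (C + K * C' + 1)))) (min ρ₁ ρ₂) with hρ
  have hρ0 : 0 < ρ := by positivity
  filter_upwards [Metric.closedBall_mem_nhds φ hρ0] with ψ hψ
  rw [Metric.mem_closedBall, dist_eq_norm] at hψ
  rcases (norm_nonneg (ψ - φ)).eq_or_lt with h0 | hδ0
  · have : ψ = φ := sub_eq_zero.1 (norm_eq_zero.1 h0.symm)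
    simp [this]
  set δ := ‖ψ - φ‖ with hδ
  have hδ1 : δ ≤ 1 := hψ.trans ((min_le_left _ _).trans (min_le_left _ _))
  have hδ2 : (C + K * C') * δ ≤ e / 3 := by
    have h := hψ.trans ((min_le_left _ _).trans (min_le_right _ _))
    rw [le_div_iff₀ (by positivity)] at h
    nlinarith
  have hLψ : L (ψ - φ) =
      ∫ x in P.D, interpDeriv P.kmin P.q (φ x) * P.elastic (u φ) p x * (ψ x - φ x) := by
    rw [hL]
    refine integral_congr_ae ?_
    filter_upwards [Problem.sensitivity_ae_eq hφ (u φ) p, Lp.coeFn_sub ψ φ] with x h1 h2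
    rw [h1, h2, Pi.sub_apply]
  have t1 := h₁ ψ (hψ.trans ((min_le_right _ _).trans (min_le_left _ _)))
  have t2 := h₂ ψ hδ0 (hψ.trans ((min_le_right _ _).trans (min_le_right _ _)))
  have t3 := hC ψ hδ0 hδ1
  have t4 : K * ((u ψ).sub (u φ)).energy ≤ K * (C' * δ ^ 2) := by
    gcongr
    exact hC' ψ hδ1
  have t5 : (C + K * C') * δ * δ ≤ e / 3 * δ := by gcongr
  have t6 := hK (hu φ) (hu ψ) hp
  rw [hLψ, Real.norm_eq_abs]
  refine t6.trans ?_
  nlinarith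

/-- Integration against an integrable function, as a functional on `L^∞`. -/
theorem exists_clm_integral_mul {X : Type*} [MeasurableSpace X] {μ : Measure X} {f : X → ℝ}
    (hf : Integrable f μ) :
    ∃ L : Lp ℝ ⊤ μ →L[ℝ] ℝ, ∀ θ : Lp ℝ ⊤ μ, L θ = ∫ x, f x * θ x ∂μ := by
  have hi (θ : Lp ℝ ⊤ μ) : Integrable (fun x => f x * θ x) μ :=
    hf.mul_bdd (Lp.aestronglyMeasurable θ) (Lp_top_ae_abs_le θ)
  let A : Lp ℝ ⊤ μ →ₗ[ℝ] ℝ :=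
    { toFun := fun θ => ∫ x, f x * θ x ∂μ
      map_add' := fun θ η => by
        rw [← integral_add (hi θ) (hi η)]
        refine integral_congr_ae ?_
        filter_upwards [Lp.coeFn_add θ η] with x hx
        rw [hx, Pi.add_apply, mul_add]
      map_smul' := fun c θ => by
        rw [RingHom.id_apply, smul_eq_mul, ← integral_const_mul]
        refine integral_congr_ae ?_
        filter_upwards [Lp.coeFn_smul c θ] with x hx
        rw [hx, Pi.smul_apply, smul_eq_mul, mul_left_comm] }
  refine ⟨A.mkContinuous (∫ x, |f x| ∂μ) fun θ => ?_, fun θ => rfl⟩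
  rw [← integral_mul_const]
  refine (abs_integral_le_integral_abs).trans (integral_mono_ae (hi θ).abs
    (hf.abs.mul_const _) ?_)
  filter_upwards [Lp_top_ae_abs_le θ] with x hx
  rw [abs_mul]
  gcongr

end Expansion

end PhaseField

end

theorem mainTheorem6 {d : ℕ} (hd : d = 2 ∨ d = 3) (P : PhaseField.Problem d) (hP : P.Admissible)
    (u : P.Phase → PhaseField.H1 P.D) (hu : ∀ ψ : P.Phase, P.IsState ψ (u ψ))
    (φ : P.Phase) (hφ : ∀ᵐ x ∂volume.restrict P.D, φ x ^ P.q ≠ P.kmin)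
    (p : PhaseField.H1 P.D) (hp : P.IsAdjoint φ (u φ) p) :
    Integrable (P.sensitivity φ (u φ) p) (volume.restrict P.D) ∧
      ∃ L : P.Phase →L[ℝ] ℝ,
        HasFDerivAt (fun ψ : P.Phase => P.objective (u ψ)) L φ ∧
          ∀ θ : P.Phase, L θ = ∫ x in P.D, P.sensitivity φ (u φ) p x * θ x := by
  have hint : Integrable (P.sensitivity φ (u φ) p) (volume.restrict P.D) :=
    (hP.integrable_interpDeriv_mul_elastic φ (u φ) p).congr
      (PhaseField.Problem.sensitivity_ae_eq hφ (u φ) p).symm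
  obtain ⟨L, hL⟩ := PhaseField.exists_clm_integral_mul hint
  exact ⟨hint, L, hP.hasFDerivAt_objective hu hφ hp hL, hL⟩
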